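/- **Setting.** Let $L\ge 1$, $N=2^L$. An *admissible wavelet packet tree* $T$ with root $W^L_0$ is a finite binary tree with nodes $W^j_m$, $j\ge 1$, in which every node is a leaf or has the two children $W^{j-1}_{2m}$ (left) and $W^{j-1}_{2m+1}$ (right). $T$ is *wave atom admissible* if any two leaves $W^{j}_{m},W^{j'}_{m'}$ that are neighbours in the left-to-right order satisfy $|j-j'|\le 1$, with $m,m'$ both odd if $j'=j+1$ and both even if $j'=j-1$. Denote by $W^{j_l}_0$ and $W^{j_r}_{m_r}$ the leftmost and rightmost leaves. For $p\in\{0,\dots,N-1\}$ there is exactly one leaf $W^j_m$ and one $0\le n<2^j$ with $p=m2^j+n$; for $1\le i<L$ put $h_i(p)=1$ if $j\ge i$ and $h_i(p)=0$ otherwise. Let $g:\mathbb R\to\mathbb R$ be continuous, vanishing outside $(-\tfrac76\pi,\tfrac56\pi)$, with $g(\tfrac\pi2-w)^2+g(\tfrac\pi2+w)^2=1$ and $g(-2w-\tfrac\pi2)=g(\tfrac\pi2+w)$ for $|w|\le\tfrac\pi3$. With $\alpha_m=\tfrac\pi2(m+\tfrac12)$ let $$\hat\psi^0_m(\xi)=e^{-i\pi\xi}\big[e^{i\alpha_m}g((-1)^m(2\pi\xi-2\alpha_m))+e^{-i\alpha_m}g((-1)^{m+1}(2\pi\xi+2\alpha_m))\big],\qquad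 \hat\psi^j_m(\xi)=2^{-j/2}\hat\psi^0_m(2^{-j}\xi),$$ and $\mu_0(j,m)=\lfloor 2^{j-[m\text{ odd}]}/3\rfloor$. For a leaf $W^j_m$ and $k\in\mathbb Z$ let $\tilde\psi^j_m(k)=2^{-j/2}e^{-i\pi2^{-j}k}e^{\pm i\alpha_m}$ (sign $+$ if $k\ge0$, $-$ if $k<0$) if either $W^j_m=W^{j_l}_0$ and $|k|\le\mu_0(j_l,0)$, or $W^j_m=W^{j_r}_{m_r}$ and $|k|>m_r2^{j_r-1}+\mu_0(j_r,m_r)$; otherwise let $\tilde\psi^j_m(k)=\hat\psi^j_m(k)$. Put $\tilde\psi^j_{m,n}(k)=e^{-2\pi i n2^{-j}k}\tilde\psi^j_m(k)$. Let $d(i)=i/2$ for even $i$ and $d(i)=-(i+1)/2$ for odd $i$. The *quantum wave atom transform* for $T$ and $g$ is the linear map on $L$ qubits $$\sum_{k=0}^{N-1}f[k]\,|k\rangle\mapsto\sum_{W^j_m\text{ leaf}}\ \sum_{n=0}^{2^j-1}\Big(\sum_{i=0}^{N-1}\overline{\tilde\psi^j_{m,n}(d(i))}\,\hat f[d(i)]\Big)|m2^j+n\rangle,\qquad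 \hat f[k]=\frac1{\sqrt N}\sum_{x=0}^{N-1}e^{-2\pi i kx/N}f[x].$$ The *blending matrix* $G^A\in\mathbb C^{N\times N}$ has, for every leaf $W^j_m\neq W^{j_l}_0$ and every integer $|s|\le\mu_0(j,m)$, on the indices $m2^j+2s-1,\ m2^j+2s$ the diagonal block $\begin{pmatrix}g_-&g_+\\g_+&g_-\end{pmatrix}$ with $$g_-=g\big((-1)^m(2^{1-j}\pi|s|-\tfrac\pi2)\big),\qquad g_+=i\,(-1)^{[s<0]}\,g\big((-1)^{m+1}(2^{1-j}\pi|s|+\tfrac\pi2)\big),$$ and is the identity on all other indices. A linear map is *implemented with $K$ gates* if a circuit of at most $K$ arbitrary single- and two-qubit unitary gates, acting on the register and on some number of ancilla qubits that start and end in $|0\rangle$, realizes it exactly. **Theorem 3.** For all constants $A,B$ there is a constant $C$, depending only on $A$ and $B$, such that for every $L$, every wave atom admissible tree $T$ with root $W^L_0$ and every $g$ as above: if $G^A$ can be implemented with $A L^2$ gates, and the map $$|p\rangle|b_1\dots b_{L-1}\rangle\mapsto|p\rangle|b_1\oplus h_1(p),\dots,b_{L-1}\oplus h_{L-1}(p)\rangle$$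 can be implemented with $B L^2$ gates, then the quantum wave atom transform for $T$ and $g$ can be implemented with $C L^2$ gates. (That is, if the two inputs have gate complexity $O(L^2)$, so does the transform.) -/

import Mathlib

/-! ### Quantum circuits with single- and two-qubit gates

The computational basis of `n` qubits is `Fin n → Fin 2`; qubit `i` carries the binary digit
of weight `2 ^ i`. An operator on `n` qubits is a matrix over this basis. -/

/-- The basis of `n` qubits. -/
abbrev QBasis (n : ℕ) : Type := Fin n → Fin 2

/-- An arbitrary unitary acting on one or two distinct qubits of an `n`-qubit register. -/
structure QGate (n : ℕ) where
  /-- number of qubits the gate acts on -/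
  arity : ℕ
  arity_eq : arity = 1 ∨ arity = 2
  /-- the (distinct) qubits the gate acts on -/
  wires : Fin arity ↪ Fin n
  /-- the unitary applied to them -/
  op : Matrix.unitaryGroup (QBasis arity) ℂ

/-- The operator of a gate on the whole register: the gate on its wires, tensored with the
identity on all other qubits. -/
noncomputable def QGate.toMatrix {n : ℕ} (G : QGate n) : Matrix (QBasis n) (QBasis n) ℂ :=
  Matrix.of fun y x =>
    if ∀ i, (∀ k, G.wires k ≠ i) → y i = x i then
      (G.op : Matrix (QBasis G.arity) (QBasis G.arity) ℂ) (y ∘ G.wires) (x ∘ G.wires)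
    else 0

/-- A circuit on `n` qubits: the list of its gates, the first gate being applied first. -/
abbrev QCircuit (n : ℕ) : Type := List (QGate n)

/-- The operator of a circuit. -/
noncomputable def QCircuit.toMatrix {n : ℕ} : QCircuit n → Matrix (QBasis n) (QBasis n) ℂ
  | [] => 1
  | G :: c => QCircuit.toMatrix c * G.toMatrix

/-- The circuit `c` on `n` qubits and `a` ancilla qubits implements the `n`-qubit operator `M`:
it maps `|x⟩ ⊗ |0⟩` to `(M |x⟩) ⊗ |0⟩` for every basis state `x`. -/
def QCircuit.Implements {n a : ℕ} (c : QCircuit (n + a))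
    (M : Matrix (QBasis n) (QBasis n) ℂ) : Prop :=
  ∀ (x y : QBasis n) (z : QBasis a),
    QCircuit.toMatrix c (Fin.append y z) (Fin.append x 0) = if z = 0 then M y x else 0

/-- The `n`-qubit operator `M` can be implemented exactly, with some number of ancilla qubits
that start and end in the state `|0⟩`, by a circuit of at most `k` single- and two-qubit gates. -/
def ImplementableWith {n : ℕ} (M : Matrix (QBasis n) (QBasis n) ℂ) (k : ℕ) : Prop :=
  ∃ (a : ℕ) (c : QCircuit (n + a)), c.length ≤ k ∧ c.Implements M

/-- A matrix of size `2 ^ n` as an operator on `n` qubits, through binary representation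
(`finFunctionFinEquiv` sends `x` to `∑ i, x i * 2 ^ i`). -/
def onQubits {n : ℕ} (M : Matrix (Fin (2 ^ n)) (Fin (2 ^ n)) ℂ) :
    Matrix (QBasis n) (QBasis n) ℂ :=
  M.submatrix finFunctionFinEquiv finFunctionFinEquiv

/-! ### Wavelet packet trees -/

/-- `WaveletTree j` is the type of admissible wavelet packet (sub)trees whose root is on level
`j`: every node on level `j` is a leaf, or has two children on level `j - 1`, and all levels are
at least `1`. A `WaveletTree L` is placed with its root at `W^L_0`. -/
inductive WaveletTree : ℕ → Type
  | leaf {j : ℕ} (hj : 1 ≤ j) : WaveletTree j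
  | node {j : ℕ} (left right : WaveletTree j) : WaveletTree (j + 1)

namespace WaveletTree

/-- The leaf nodes `(j, m)`, from left to right, of a subtree whose root is the node `(j, m)`;
the children of `(j + 1, m)` are `(j, 2 * m)` and `(j, 2 * m + 1)`. -/
def leavesFrom : {j : ℕ} → WaveletTree j → ℕ → List (ℕ × ℕ)
  | j, leaf _, m => [(j, m)]
  | _, node l r, m => l.leavesFrom (2 * m) ++ r.leavesFrom (2 * m + 1)

/-- The leaf nodes `(j, m)` of the tree with root `(L, 0)`, from left to right. -/
def leaves {L : ℕ} (T : WaveletTree L) : List (ℕ × ℕ) := T.leavesFrom 0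

/-- Descend from the node `(j, m)` to the leaf whose block of indices contains `p`. -/
def leafFrom : {j : ℕ} → WaveletTree j → ℕ → ℕ → ℕ × ℕ
  | j, leaf _, m, _ => (j, m)
  | _, node (j := j) l r, m, p =>
    if p < (2 * m + 1) * 2 ^ j then l.leafFrom (2 * m) p else r.leafFrom (2 * m + 1) p

/-- The leaf `(j, m)` with `m * 2 ^ j ≤ p < (m + 1) * 2 ^ j`, for `p < 2 ^ L`. -/
def leafAt {L : ℕ} (T : WaveletTree L) (p : ℕ) : ℕ × ℕ := T.leafFrom 0 p

theorem leafFrom_spec {j : ℕ} (T : WaveletTree j) (m p : ℕ) (h₁ : m * 2 ^ j ≤ p)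
    (h₂ : p < (m + 1) * 2 ^ j) :
    T.leafFrom m p ∈ T.leavesFrom m ∧
      (T.leafFrom m p).2 * 2 ^ (T.leafFrom m p).1 ≤ p ∧
      p < ((T.leafFrom m p).2 + 1) * 2 ^ (T.leafFrom m p).1 := by
  induction T generalizing m with
  | leaf hj => simp [leafFrom, leavesFrom, h₁, h₂]
  | @node j l r ihl ihr =>
    simp only [leafFrom, leavesFrom, List.mem_append]
    rw [pow_succ] at h₁ h₂
    split_ifs with h
    · obtain ⟨a, b⟩ := ihl (2 * m) (by nlinarith) h
      exact ⟨Or.inl a, b⟩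
    · obtain ⟨a, b⟩ := ihr (2 * m + 1) (by nlinarith) (by nlinarith)
      exact ⟨Or.inr a, b⟩

theorem leavesFrom_range {j : ℕ} (T : WaveletTree j) (m : ℕ) (q : ℕ × ℕ)
    (hq : q ∈ T.leavesFrom m) :
    m * 2 ^ j ≤ q.2 * 2 ^ q.1 ∧ (q.2 + 1) * 2 ^ q.1 ≤ (m + 1) * 2 ^ j := by
  induction T generalizing m with
  | leaf hj =>
    simp only [leavesFrom, List.mem_singleton] at hq
    subst hq
    simp
  | @node j l r ihl ihr =>
    simp only [leavesFrom, List.mem_append] at hq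
    rw [pow_succ]
    rcases hq with hq | hq
    · have := ihl (2 * m) hq
      constructor <;> nlinarith [this.1, this.2, pow_pos (two_pos : (0 : ℕ) < 2) j]
    · have := ihr (2 * m + 1) hq
      constructor <;> nlinarith [this.1, this.2, pow_pos (two_pos : (0 : ℕ) < 2) j]

theorem leafFrom_eq {j : ℕ} (T : WaveletTree j) (m : ℕ) (q : ℕ × ℕ)
    (hq : q ∈ T.leavesFrom m) (p : ℕ) (h₁ : q.2 * 2 ^ q.1 ≤ p)
    (h₂ : p < (q.2 + 1) * 2 ^ q.1) : T.leafFrom m p = q := by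
  induction T generalizing m with
  | leaf hj =>
    simp only [leavesFrom, List.mem_singleton] at hq
    simp [leafFrom, hq]
  | @node j l r ihl ihr =>
    simp only [leavesFrom, List.mem_append] at hq
    simp only [leafFrom]
    rcases hq with hq | hq
    · rw [if_pos (lt_of_lt_of_le h₂ (leavesFrom_range l _ q hq).2)]
      exact ihl _ hq
    · rw [if_neg (not_lt.mpr ((leavesFrom_range r _ q hq).1.trans h₁))]
      exact ihr _ hq

/-- `p ↦ (j, m, n)` with `(j, m) = T.leafAt p` and `n = p - m * 2 ^ j` is well defined. -/
theorem leafAt_spec {L : ℕ} (T : WaveletTree L) (p : ℕ) (hp : p < 2 ^ L) :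
    T.leafAt p ∈ T.leaves ∧ (T.leafAt p).2 * 2 ^ (T.leafAt p).1 ≤ p ∧
      p < ((T.leafAt p).2 + 1) * 2 ^ (T.leafAt p).1 :=
  leafFrom_spec T 0 p (by simp) (by simpa using hp)

/-- ... and it is inverse to the encoding `(j, m, n) ↦ m * 2 ^ j + n`. -/
theorem leafAt_encode {L : ℕ} (T : WaveletTree L) (j m n : ℕ) (hq : (j, m) ∈ T.leaves)
    (hn : n < 2 ^ j) : T.leafAt (m * 2 ^ j + n) = (j, m) :=
  leafFrom_eq T 0 (j, m) hq _ (by simp) (by simp only; nlinarith)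

/-- Wave atom admissible trees: conditions on every two neighbouring leaves. -/
def WaveAtomAdmissible {L : ℕ} (T : WaveletTree L) : Prop :=
  T.leaves.IsChain fun q q' =>
    |(q.1 : ℤ) - (q'.1 : ℤ)| ≤ 1 ∧
      (q'.1 = q.1 + 1 → Odd q.2 ∧ Odd q'.2) ∧
      (q.1 = q'.1 + 1 → Even q.2 ∧ Even q'.2)

/-- The helper decoding function `h_j`: `h_j p = 1` if and only if the leaf containing the
index `p` is on level at least `j`. -/
def helper {L : ℕ} (T : WaveletTree L) (j p : ℕ) : Fin 2 :=
  if j ≤ (T.leafAt p).1 then 1 else 0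

/-- The map `(p, b_1, …, b_{L-1}) ↦ (p, b_1 ⊕ h_1 p, …, b_{L-1} ⊕ h_{L-1} p)` on basis states
of `L + (L - 1)` qubits (addition in `Fin 2` is `⊕`; the qubit `i` of the second register
carries `b_{i+1}`). -/
def helperMap {L : ℕ} (T : WaveletTree L) (x : QBasis (L + (L - 1))) : QBasis (L + (L - 1)) :=
  let p : QBasis L := fun i => x (Fin.castAdd (L - 1) i)
  let b : QBasis (L - 1) := fun i => x (Fin.natAdd L i)
  Fin.append p fun i => b i + T.helper ((i : ℕ) + 1) (finFunctionFinEquiv p : ℕ)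

/-- The operator that computes all helper decoding functions. -/
def helperOperator {L : ℕ} (T : WaveletTree L) :
    Matrix (QBasis (L + (L - 1))) (QBasis (L + (L - 1))) ℂ :=
  Matrix.of fun y x => if y = T.helperMap x then 1 else 0

end WaveletTree

/-! ### Wave atoms -/

/-- The requirements on the function `g` that generates the wave atoms. -/
structure IsWaveAtomProfile (g : ℝ → ℝ) : Prop where
  continuous : Continuous g
  support_subset : Function.support g ⊆ Set.Ioo (-(7 / 6 * Real.pi)) (5 / 6 * Real.pi)
  sum_sq : ∀ w ∈ Set.Icc (-(Real.pi / 3)) (Real.pi / 3),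
    g (Real.pi / 2 - w) ^ 2 + g (Real.pi / 2 + w) ^ 2 = 1
  stretch : ∀ w ∈ Set.Icc (-(Real.pi / 3)) (Real.pi / 3),
    g (-2 * w - Real.pi / 2) = g (Real.pi / 2 + w)

namespace WaveAtom

open Complex

/-- Frequency decoding: index `i` stands for the frequency `i / 2` if `i` is even and for
`-(i + 1) / 2` if `i` is odd. -/
def freqDecode (i : ℕ) : ℤ := if Even i then ((i / 2 : ℕ) : ℤ) else -(((i + 1) / 2 : ℕ) : ℤ)

/-- `α_m = (π / 2) (m + 1 / 2)`. -/
noncomputable def alpha (m : ℕ) : ℝ := Real.pi / 2 * ((m : ℝ) + 1 / 2)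

/-- The mother wave packet `ψ̂^0_m(ξ)` in the frequency domain. -/
noncomputable def psiHatZero (g : ℝ → ℝ) (m : ℕ) (ξ : ℝ) : ℂ :=
  exp (-(I * Real.pi * ξ)) *
    (exp (I * alpha m) * g ((-1) ^ m * (2 * Real.pi * ξ - 2 * alpha m)) +
      exp (-(I * alpha m)) * g ((-1) ^ (m + 1) * (2 * Real.pi * ξ + 2 * alpha m)))

/-- `ψ̂^j_m(ξ) = 2^{-j/2} ψ̂^0_m(2^{-j} ξ)`. -/
noncomputable def psiHat (g : ℝ → ℝ) (j m : ℕ) (ξ : ℝ) : ℂ :=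
  ((1 / Real.sqrt (2 ^ j) : ℝ) : ℂ) * psiHatZero g m (ξ / 2 ^ j)

/-- `μ_0(j, m) = ⌊2^{j - I(m is odd)} / 3⌋` (used for `j ≥ 1`). -/
def muZero (j m : ℕ) : ℕ := 2 ^ (j - m % 2) / 3

/-- `2^{-j/2} e^{-iπ 2^{-j} k} e^{± i α_m}`, with sign `+` for `k ≥ 0` and `-` for `k < 0`. -/
noncomputable def straightened (j m : ℕ) (k : ℤ) : ℂ :=
  ((1 / Real.sqrt (2 ^ j) : ℝ) : ℂ) * exp (-(I * Real.pi * k / 2 ^ j)) *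
    exp ((if k < 0 then -1 else 1) * I * alpha m)

/-- The modified wave atom `ψ̃^j_m` at the integer frequency `k`: the leftmost wave packet is
straightened at the lowest frequencies and the rightmost one at the highest frequencies. -/
noncomputable def psiTilde {L : ℕ} (T : WaveletTree L) (g : ℝ → ℝ) (j m : ℕ) (k : ℤ) : ℂ :=
  if T.leaves.head? = some (j, m) ∧ |k| ≤ (muZero j m : ℤ) then straightened j m k
  else if T.leaves.getLast? = some (j, m) ∧ ((m * 2 ^ (j - 1) + muZero j m : ℕ) : ℤ) < |k| then
    straightened j m k
  else psiHat g j m (k : ℝ)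

/-- The shifted wave atom `ψ̃^j_{m,n}(k) = e^{-2πi n 2^{-j} k} ψ̃^j_m(k)`. -/
noncomputable def psiTildeShift {L : ℕ} (T : WaveletTree L) (g : ℝ → ℝ) (j m n : ℕ) (k : ℤ) : ℂ :=
  exp (-(I * 2 * Real.pi * n * k / 2 ^ j)) * psiTilde T g j m k

/-- The matrix `C^A`, with `C^A_{m 2^j + n, i} = conj (ψ̃^j_{m,n}(d(i)))` for every leaf `(j, m)`
and `0 ≤ n < 2^j`. -/
noncomputable def coeffMatrix {L : ℕ} (T : WaveletTree L) (g : ℝ → ℝ) :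
    Matrix (Fin (2 ^ L)) (Fin (2 ^ L)) ℂ :=
  Matrix.of fun p i =>
    let j := (T.leafAt p).1
    let m := (T.leafAt p).2
    (starRingEnd ℂ) (psiTildeShift T g j m ((p : ℕ) - m * 2 ^ j) (freqDecode i))

/-- The quantum Fourier transform `Q_L` of size `2^L`. -/
noncomputable def qft (L : ℕ) : Matrix (Fin (2 ^ L)) (Fin (2 ^ L)) ℂ :=
  Matrix.of fun k x =>
    ((1 / Real.sqrt (2 ^ L) : ℝ) : ℂ) * exp (2 * Real.pi * I * (x : ℕ) * (k : ℕ) / 2 ^ L)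

/-- The position of the frequency `k` in the discrete Fourier transform: the residue of `k`
modulo `2 ^ L`, that is `k` for `0 ≤ k < 2^L` and `k + 2^L` for `-2^L ≤ k < 0`. -/
def freqIndex (L : ℕ) (k : ℤ) : Fin (2 ^ L) :=
  ⟨(k % 2 ^ L).toNat, by
    have h : (0 : ℤ) < 2 ^ L := by positivity
    have h₁ := Int.emod_nonneg k h.ne'
    have h₂ := Int.emod_lt_of_pos k h
    zify
    rw [Int.toNat_of_nonneg h₁]
    exact h₂⟩

/-- The matrix of `f ↦ (f̂[d(i)])_i`, where `f̂` is the discrete Fourier transform of `f`,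
continued to negative frequencies by periodicity. -/
noncomputable def fourierDecoded (L : ℕ) : Matrix (Fin (2 ^ L)) (Fin (2 ^ L)) ℂ :=
  Matrix.of fun i x => (qft L).conjTranspose (freqIndex L (freqDecode i)) x

/-- The quantum wave atom transform for the tree `T` and the function `g`: it maps
`∑ k, f[k] |k⟩` to `∑ (j, m, n), (∑ i, C^A_{m 2^j + n, i} f̂[d(i)]) |m 2^j + n⟩`. -/
noncomputable def transform {L : ℕ} (T : WaveletTree L) (g : ℝ → ℝ) :
    Matrix (Fin (2 ^ L)) (Fin (2 ^ L)) ℂ :=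
  coeffMatrix T g * fourierDecoded L

/-- `g_-[j, m, s]`. -/
noncomputable def gMinus (g : ℝ → ℝ) (j m : ℕ) (s : ℤ) : ℂ :=
  (g ((-1) ^ m * (2 * Real.pi * |(s : ℝ)| / 2 ^ j - Real.pi / 2)) : ℝ)

/-- `g_+[j, m, s]`. -/
noncomputable def gPlus (g : ℝ → ℝ) (j m : ℕ) (s : ℤ) : ℂ :=
  I * (if s < 0 then -1 else 1) *
    (g ((-1) ^ (m + 1) * (2 * Real.pi * |(s : ℝ)| / 2 ^ j + Real.pi / 2)) : ℝ)

/-- The leaf `(j, m)`, different from the leftmost leaf, such that `k = m 2^{j-1} + s` with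
`|s| ≤ μ_0(j, m)`, if there is one. -/
def blendingLeaf {L : ℕ} (T : WaveletTree L) (k : ℕ) : Option (ℕ × ℕ) :=
  T.leaves.tail.find? fun q =>
    decide (|(k : ℤ) - ((q.2 * 2 ^ (q.1 - 1) : ℕ) : ℤ)| ≤ (muZero q.1 q.2 : ℤ))

/-- The blending matrix `G^A`. It is block diagonal, the blocks being formed by the indices
`2 k - 1` and `2 k`. If `2 k = m 2^j + 2 s` for a leaf `(j, m)` that is not the leftmost one and
`|s| ≤ μ_0(j, m)`, the block is `g_-[j, m, s]` on and `g_+[j, m, s]` off the diagonal; all other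
blocks are identities. -/
noncomputable def blendingMatrix {L : ℕ} (T : WaveletTree L) (g : ℝ → ℝ) :
    Matrix (Fin (2 ^ L)) (Fin (2 ^ L)) ℂ :=
  Matrix.of fun r c =>
    let k := ((r : ℕ) + 1) / 2
    if k = ((c : ℕ) + 1) / 2 then
      match blendingLeaf T k with
      | some (j, m) =>
        let s : ℤ := (k : ℤ) - ((m * 2 ^ (j - 1) : ℕ) : ℤ)
        if r = c then gMinus g j m s else gPlus g j m s
      | none => if r = c then 1 else 0
    else 0

end WaveAtom

/-! The transform is the coefficient matrix times a decoded Fourier transform, so the point is to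
factor the coefficient matrix C as W R G R with every factor of gate complexity O(L^2)
(`coeffMatrix_factorization`).

W (`leafOp`) is what C would be if every wave atom were straightened, that is, of modulus 2^{-j/2}
on the frequencies stored in the block of its own leaf and zero on all others. It is a direct sum
over the leaves of Fourier matrices of size 2^j, up to phases. The actual wave atoms differ from
this only for |k| in the window of radius `radius r` around `center r`, the left end of a leaf r
that is not the leftmost one. Admissibility makes these windows disjoint and adjacent
(`Neighbours.windows`), and in the window of r only r and its left neighbour q can be nonzero. Now 2
* `center r` is a multiple of 2^j for the level j of r and also for that of q. So the frequencies k
and k - 2 * `center r` have the same shift phases in both leaves, and the straightened amplitudes at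
the two differ, up to conjugation, by a factor i or -i. One of the two frequencies is stored in the
block of r, the other in that of q. Hence each column of C in a window is a combination of two
columns of W; the weights are g_- and g_+, because the profile of q is the mirror image of that of r
(`profile_of_neighbours`; across a change of level this is the stretching equation for g). The
blending matrix G pairs k with -k instead, and the involution R (`reflectBits`), which sends -k to
-(2 * `center r` - k) inside the windows, repairs the pairing. Outside the windows C and W agree and
R and G do nothing.

W transforms all leaves at once, whatever their sizes. Moving the frequency L - j binary places to
the left turns the Fourier transform of size 2^j into the one of size 2^L; its L - j upper output
qubits are then in the state made by a Hadamard gate from |0⟩, and Hadamard gates controlled by the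
level reset them (`ctrlHadamard_fourier`). The phases that are left form a product of one-qubit
phases in the shifted frequency (`straightened_eq_cis`).

The rest is reversible computing: registers are filled, used and uncomputed. The level comes from
the helper operator, shifts by a level-dependent distance are sums against a one-hot code, and the
integer arithmetic in R is addition in the Fourier basis (`comp_affine`). -/

set_option linter.unusedSectionVars false

/-! ### Operators on finite sets of qubits, gates, circuits and ancillas -/

namespace Qubit

open Matrix

/-- Computational basis states of a set `ι` of qubits. -/
abbrev Bits (ι : Type) : Type := ι → Fin 2

/-- Operators on a set `ι` of qubits. -/
abbrev Op (ι : Type) : Type := Matrix (Bits ι) (Bits ι) ℂ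

section Basic

variable {ι κ τ : Type} [Fintype ι] [DecidableEq ι] [Fintype κ] [DecidableEq κ]
  [Fintype τ] [DecidableEq τ]

/-- The basis vector `|x⟩`. -/
noncomputable def ket (x : Bits ι) : Bits ι → ℂ := Pi.single x 1

theorem ket_apply (x y : Bits ι) : ket x y = if y = x then 1 else 0 := by
  simp [ket, Pi.single_apply]

theorem mulVec_ket (M : Op ι) (x : Bits ι) : M *ᵥ ket x = fun y => M y x := by
  ext y; simp [ket]

theorem mulVec_ket_eq_sum (M : Op ι) (x : Bits ι) : M *ᵥ ket x = ∑ y, M y x • ket y := by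
  rw [mulVec_ket]; ext y; simp [ket_apply]

theorem op_ext {M N : Op ι} (h : ∀ x, M *ᵥ ket x = N *ᵥ ket x) : M = N := by
  ext y x
  have := congrFun (h x) y
  simpa [mulVec_ket] using this

theorem vec_eq_sum (v : Bits ι → ℂ) : v = ∑ y, v y • ket y := by
  ext y; simp [ket_apply]

theorem extend_eq (e : κ ↪ ι) {w : Bits κ} {x s : Bits ι} (h₁ : ∀ k, s (e k) = w k)
    (h₂ : ∀ i, (∀ k, e k ≠ i) → s i = x i) : Function.extend e w x = s := by
  ext i
  by_cases h : ∃ k, e k = i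
  · obtain ⟨k, rfl⟩ := h
    rw [e.injective.extend_apply, h₁]
  · rw [Function.extend_apply' _ _ _ h, h₂ i (by simpa using h)]

theorem extend_inl (y : Bits ι) (x : Bits (ι ⊕ κ)) :
    Function.extend (Function.Embedding.inl : ι ↪ ι ⊕ κ) y x = Sum.elim y (x ∘ Sum.inr) := by
  refine extend_eq _ (fun _ => rfl) ?_
  rintro (i | i) h
  exacts [absurd rfl (h i), rfl]

theorem extend_inr (y : Bits κ) (x : Bits (ι ⊕ κ)) :
    Function.extend (Function.Embedding.inr : κ ↪ ι ⊕ κ) y x = Sum.elim (x ∘ Sum.inl) y := by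
  refine extend_eq _ (fun _ => rfl) ?_
  rintro (i | i) h
  exacts [rfl, absurd rfl (h i)]

/-- Place the vector `v` on the qubits in the range of `e`, the others being in state `x`. -/
noncomputable def splice (e : κ ↪ ι) (x : Bits ι) : (Bits κ → ℂ) →ₗ[ℂ] (Bits ι → ℂ) :=
  Fintype.linearCombination ℂ fun w => ket (Function.extend e w x)

theorem splice_apply (e : κ ↪ ι) (x : Bits ι) (v : Bits κ → ℂ) :
    splice e x v = ∑ w, v w • ket (Function.extend e w x) := by
  simp [splice, Fintype.linearCombination_apply]

theorem splice_ket (e : κ ↪ ι) (x : Bits ι) (w : Bits κ) :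
    splice e x (ket w) = ket (Function.extend e w x) := by
  rw [splice_apply, Finset.sum_eq_single w] <;> simp +contextual [ket_apply]

/-- The operator `M` applied to the qubits in the range of `e`. -/
def lift (e : κ ↪ ι) (M : Op κ) : Op ι := Matrix.of fun y x =>
  if ∀ i, (∀ k, e k ≠ i) → y i = x i then M (y ∘ e) (x ∘ e) else 0

theorem lift_mulVec_ket (e : κ ↪ ι) (M : Op κ) (x : Bits ι) :
    lift e M *ᵥ ket x = splice e x (M *ᵥ ket (x ∘ e)) := by
  rw [mulVec_ket, mulVec_ket, splice_apply]
  ext y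
  simp only [lift, Matrix.of_apply, Finset.sum_apply, Pi.smul_apply, ket_apply, smul_eq_mul,
    mul_ite, mul_one, mul_zero]
  split_ifs with h
  · rw [Finset.sum_eq_single (y ∘ e)]
    · exact (if_pos (extend_eq e (fun _ => rfl) h).symm).symm
    · intro w _ hw
      rw [if_neg]
      rintro rfl
      exact hw (Function.extend_comp e.injective w x).symm
    · simp
  · symm
    refine Finset.sum_eq_zero fun w _ => if_neg ?_
    rintro rfl
    exact h fun i hi => Function.extend_apply' _ _ _ (by simpa using hi)

theorem lift_mulVec_splice (e : κ ↪ ι) (M : Op κ) (x : Bits ι) (v : Bits κ → ℂ) :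
    lift e M *ᵥ splice e x v = splice e x (M *ᵥ v) := by
  rw [vec_eq_sum v]
  simp only [map_sum, map_smul, mulVec_sum, mulVec_smul]
  refine Finset.sum_congr rfl fun w _ => ?_
  rw [splice_ket, lift_mulVec_ket, Function.extend_comp e.injective, splice_apply, splice_apply]
  congr 1
  refine Finset.sum_congr rfl fun y _ => ?_
  rw [extend_eq e (s := Function.extend e y x)]
  · exact fun k => e.injective.extend_apply _ _ _
  · intro i hi
    have : ¬ ∃ k, e k = i := by simpa using hi
    rw [Function.extend_apply' _ _ _ this, Function.extend_apply' _ _ _ this]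

theorem lift_mul (e : κ ↪ ι) (M N : Op κ) : lift e (M * N) = lift e M * lift e N := by
  refine op_ext fun x => ?_
  rw [← mulVec_mulVec, lift_mulVec_ket, lift_mulVec_ket, lift_mulVec_splice, mulVec_mulVec]

theorem lift_one (e : κ ↪ ι) : lift e (1 : Op κ) = 1 := by
  refine op_ext fun x => ?_
  rw [lift_mulVec_ket, one_mulVec, one_mulVec, splice_ket]
  congr 1
  exact extend_eq e (fun _ => rfl) fun _ _ => rfl

theorem lift_conjTranspose (e : κ ↪ ι) (M : Op κ) : lift e Mᴴ = (lift e M)ᴴ := by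
  ext y x
  simp only [lift, Matrix.of_apply, conjTranspose_apply]
  by_cases h : ∀ i, (∀ k, e k ≠ i) → y i = x i
  · rw [if_pos h, if_pos fun i hi => (h i hi).symm]
  · rw [if_neg h, if_neg fun h' => h fun i hi => (h' i hi).symm, star_zero]

theorem lift_lift (f : κ ↪ ι) (e : ι ↪ τ) (M : Op κ) :
    lift e (lift f M) = lift (f.trans e) M := by
  refine op_ext fun x => ?_
  rw [lift_mulVec_ket, lift_mulVec_ket, lift_mulVec_ket, splice_apply f, splice_apply (f.trans e)]
  simp only [map_sum, map_smul, splice_ket]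
  refine Finset.sum_congr rfl fun w _ => ?_
  congr 2
  symm
  apply extend_eq
  · intro k
    rw [Function.Embedding.trans_apply, e.injective.extend_apply, f.injective.extend_apply]
  · intro i hi
    by_cases h : ∃ k, e k = i
    · obtain ⟨k, rfl⟩ := h
      rw [e.injective.extend_apply, Function.extend_apply']
      · rfl
      · rintro ⟨l, rfl⟩
        exact hi l rfl
    · rw [Function.extend_apply' _ _ _ h]

/-- A unitary on one or two qubits. -/
def IsGate (M : Op ι) : Prop :=
  ∃ (n : ℕ) (_ : n = 1 ∨ n = 2) (e : Fin n ↪ ι) (u : Op (Fin n)),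
    u ∈ Matrix.unitaryGroup (Bits (Fin n)) ℂ ∧ M = lift e u

theorem IsGate.lift {M : Op κ} (h : IsGate M) (e : κ ↪ ι) : IsGate (lift e M) := by
  obtain ⟨n, hn, f, u, hu, rfl⟩ := h
  exact ⟨n, hn, f.trans e, u, hu, lift_lift _ _ _⟩

theorem IsGate.conjTranspose {M : Op κ} (h : IsGate M) : IsGate Mᴴ := by
  obtain ⟨n, hn, f, u, hu, rfl⟩ := h
  exact ⟨n, hn, f, uᴴ, Unitary.star_mem hu, (lift_conjTranspose _ _).symm⟩

theorem IsGate.unitary {M : Op κ} (h : IsGate M) : Mᴴ * M = 1 := by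
  obtain ⟨n, hn, f, u, hu, rfl⟩ := h
  rw [← lift_conjTranspose, ← lift_mul]
  have : uᴴ * u = 1 := (Matrix.mem_unitaryGroup_iff').1 hu
  rw [this, lift_one]

/-- A product of at most `k` gates. -/
def IsCircuit (U : Op ι) (k : ℕ) : Prop :=
  ∃ l : List (Op ι), l.length ≤ k ∧ (∀ M ∈ l, IsGate M) ∧ l.prod = U

theorem IsCircuit.one : IsCircuit (1 : Op ι) 0 := ⟨[], by simp⟩

theorem IsGate.isCircuit {M : Op ι} (h : IsGate M) : IsCircuit M 1 := ⟨[M], by simpa⟩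

theorem IsCircuit.mul {U V : Op ι} {k l : ℕ} (hU : IsCircuit U k) (hV : IsCircuit V l) :
    IsCircuit (U * V) (k + l) := by
  obtain ⟨a, h₁, h₂, rfl⟩ := hU
  obtain ⟨b, h₃, h₄, rfl⟩ := hV
  refine ⟨a ++ b, by simp; omega, ?_, by simp⟩
  intro M hM
  rcases List.mem_append.1 hM with h | h
  exacts [h₂ M h, h₄ M h]

theorem IsCircuit.mono {U : Op ι} {k l : ℕ} (hU : IsCircuit U k) (h : k ≤ l) :
    IsCircuit U l := by
  obtain ⟨a, h₁, h₂⟩ := hU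
  exact ⟨a, h₁.trans h, h₂⟩

theorem IsCircuit.lift {U : Op κ} {k : ℕ} (hU : IsCircuit U k) (e : κ ↪ ι) :
    IsCircuit (lift e U) k := by
  obtain ⟨a, h₁, h₂, rfl⟩ := hU
  refine ⟨a.map (Qubit.lift e), by simpa, ?_, ?_⟩
  · intro M hM
    obtain ⟨N, hN, rfl⟩ := List.mem_map.1 hM
    exact (h₂ N hN).lift e
  · clear h₁ h₂
    induction a with
    | nil => simp [lift_one]
    | cons M a ih => simp [lift_mul, ih]

theorem IsCircuit.conjTranspose {U : Op κ} {k : ℕ} (hU : IsCircuit U k) :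
    IsCircuit Uᴴ k := by
  obtain ⟨a, h₁, h₂, rfl⟩ := hU
  refine ⟨(a.map Matrix.conjTranspose).reverse, by simpa, ?_, ?_⟩
  · intro M hM
    obtain ⟨N, hN, rfl⟩ := List.mem_map.1 (List.mem_reverse.1 hM)
    exact (h₂ N hN).conjTranspose
  · rw [Matrix.conjTranspose_list_prod]

theorem IsCircuit.unitary {U : Op κ} {k : ℕ} (hU : IsCircuit U k) : Uᴴ * U = 1 := by
  obtain ⟨a, h₁, h₂, rfl⟩ := hU
  clear h₁
  induction a with
  | nil => simp
  | cons M a ih =>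
    have h : Mᴴ * M = 1 := (h₂ M (by simp)).unitary
    have h' := ih fun N hN => h₂ N (by simp [hN])
    rw [List.prod_cons, conjTranspose_mul, Matrix.mul_assoc, ← Matrix.mul_assoc Mᴴ, h,
      Matrix.one_mul, h']

/-- `N` can be implemented by at most `k` gates, with ancilla qubits that start and end in the
state `|0⟩`. -/
def Impl (N : Op ι) (k : ℕ) : Prop :=
  ∃ (α : Type) (_ : Fintype α) (_ : DecidableEq α) (U : Op (ι ⊕ α)), IsCircuit U k ∧
    ∀ x : Bits ι, U *ᵥ ket (Sum.elim x 0) = ∑ y, N y x • ket (Sum.elim y 0)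

theorem Impl.mono {U : Op ι} {k l : ℕ} (hU : Impl U k) (h : k ≤ l) : Impl U l := by
  obtain ⟨α, _, _, U, hU, h'⟩ := hU
  exact ⟨α, _, _, U, hU.mono h, h'⟩

theorem IsCircuit.impl {U : Op ι} {k : ℕ} (hU : IsCircuit U k) : Impl U k := by
  refine ⟨Empty, inferInstance, inferInstance, _, hU.lift Function.Embedding.inl, fun x => ?_⟩
  rw [lift_mulVec_ket]
  simp only [mulVec_ket_eq_sum, map_sum, map_smul, splice_ket]
  refine Finset.sum_congr rfl fun y _ => ?_
  congr 2
  exact extend_eq _ (fun _ => rfl) (by rintro (i | i) h; exacts [absurd rfl (h i), i.elim])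

theorem IsGate.impl {U : Op ι} (hU : IsGate U) : Impl U 1 := hU.isCircuit.impl

theorem Impl.one : Impl (1 : Op ι) 0 := IsCircuit.one.impl

/-- Each circuit receives ancillas of its own, embedded by `e` and `f`; only gates are counted, so
there is no need to share them. The ancillas of the second factor are back at 0 when the first one
acts. -/
theorem Impl.mul {M N : Op ι} {k l : ℕ} (hM : Impl M k) (hN : Impl N l) :
    Impl (M * N) (k + l) := by
  obtain ⟨α, _, _, U, hU, hU'⟩ := hM
  obtain ⟨β, _, _, V, hV, hV'⟩ := hN
  let e : ι ⊕ α ↪ ι ⊕ (α ⊕ β) := (Function.Embedding.refl ι).sumMap Function.Embedding.inl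
  let f : ι ⊕ β ↪ ι ⊕ (α ⊕ β) := (Function.Embedding.refl ι).sumMap Function.Embedding.inr
  have he : ∀ x : Bits ι, (Sum.elim x 0 : Bits (ι ⊕ (α ⊕ β))) ∘ e = Sum.elim x 0 := by
    intro x; ext (i | i) <;> rfl
  have hf : ∀ x : Bits ι, (Sum.elim x 0 : Bits (ι ⊕ (α ⊕ β))) ∘ f = Sum.elim x 0 := by
    intro x; ext (i | i) <;> rfl
  have he' : ∀ x y : Bits ι, Function.extend e (Sum.elim y 0) (Sum.elim x 0) =
      (Sum.elim y 0 : Bits (ι ⊕ (α ⊕ β))) := by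
    intro x y
    refine extend_eq e (by rintro (i | i) <;> rfl) ?_
    rintro (i | i | i) h
    exacts [absurd rfl (h (Sum.inl i)), absurd rfl (h (Sum.inr i)), rfl]
  have hf' : ∀ x y : Bits ι, Function.extend f (Sum.elim y 0) (Sum.elim x 0) =
      (Sum.elim y 0 : Bits (ι ⊕ (α ⊕ β))) := by
    intro x y
    refine extend_eq f (by rintro (i | i) <;> rfl) ?_
    rintro (i | i | i) h
    exacts [absurd rfl (h (Sum.inl i)), rfl, absurd rfl (h (Sum.inr i))]
  refine ⟨α ⊕ β, inferInstance, inferInstance, _, (hU.lift e).mul (hV.lift f), fun x => ?_⟩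
  rw [← mulVec_mulVec, lift_mulVec_ket, hf, hV']
  simp only [map_sum, map_smul, splice_ket, hf', mulVec_sum, mulVec_smul, lift_mulVec_ket, he,
    hU', he', Matrix.mul_apply, Finset.smul_sum, Finset.sum_smul]
  rw [Finset.sum_comm]
  refine Finset.sum_congr rfl fun z _ => Finset.sum_congr rfl fun y _ => ?_
  rw [smul_smul, mul_comm]

theorem Impl.lift {M : Op κ} {k : ℕ} (hM : Impl M k) (e : κ ↪ ι) : Impl (lift e M) k := by
  obtain ⟨α, _, _, U, hU, hU'⟩ := hM
  refine ⟨α, _, _, _, hU.lift (e.sumMap (Function.Embedding.refl α)), fun x => ?_⟩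
  have he : (Sum.elim x 0 : Bits (ι ⊕ α)) ∘ (e.sumMap (Function.Embedding.refl α)) =
    Sum.elim (x ∘ e) 0 := by ext (i | i) <;> rfl
  have h2 : ∀ c : Bits ι → ℂ, ∑ y, c y • ket (Sum.elim y 0 : Bits (ι ⊕ α)) =
      splice Function.Embedding.inl 0 c := by
    intro c
    rw [splice_apply]
    refine Finset.sum_congr rfl fun y _ => ?_
    rw [extend_inl]
    rfl
  have h3 := lift_mulVec_ket e M x
  rw [mulVec_ket] at h3
  rw [lift_mulVec_ket, he, hU', h2 (fun y => Qubit.lift e M y x), h3, mulVec_ket, splice_apply e]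
  simp only [map_sum, map_smul, splice_ket]
  refine Finset.sum_congr rfl fun y _ => ?_
  congr 2
  rw [extend_inl]
  refine extend_eq _ ?_ ?_
  · rintro (i | i)
    · exact e.injective.extend_apply _ _ _
    · rfl
  · rintro (i | i) h
    · refine Function.extend_apply' _ _ _ ?_
      rintro ⟨k, rfl⟩
      exact h (Sum.inl k) rfl
    · rfl

/-- This allows scratch registers: `M` matters only on inputs whose scratch part is 0, provided that
it returns this part to 0. -/
theorem Impl.ancilla {M : Op (ι ⊕ κ)} {N : Op ι} {k : ℕ} (hM : Impl M k)
    (h : ∀ x, M *ᵥ ket (Sum.elim x 0) = ∑ y, N y x • ket (Sum.elim y 0)) : Impl N k := by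
  obtain ⟨α, _, _, U, hU, hU'⟩ := hM
  let e : (ι ⊕ κ) ⊕ α ↪ ι ⊕ (κ ⊕ α) := (Equiv.sumAssoc ι κ α).toEmbedding
  have hs : ∀ (y : Bits ι) (s : Bits (ι ⊕ (κ ⊕ α))),
      Function.extend e (Sum.elim (Sum.elim y 0) 0) s = Sum.elim y 0 := by
    intro y s
    refine extend_eq e (by rintro ((i | i) | i) <;> rfl) ?_
    intro i hi
    exact absurd ((Equiv.sumAssoc ι κ α).apply_symm_apply i) (hi _)
  have h2 : ∀ c : Bits (ι ⊕ κ) → ℂ, ∑ y, c y • ket (Sum.elim y 0 : Bits ((ι ⊕ κ) ⊕ α)) =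
      splice Function.Embedding.inl 0 c := by
    intro c
    rw [splice_apply]
    refine Finset.sum_congr rfl fun y _ => ?_
    rw [extend_inl]
    rfl
  refine ⟨κ ⊕ α, inferInstance, inferInstance, _, hU.lift e, fun x => ?_⟩
  have he : (Sum.elim x 0 : Bits (ι ⊕ (κ ⊕ α))) ∘ e = Sum.elim (Sum.elim x 0) 0 := by
    ext ((i | i) | i) <;> rfl
  have h3 := h x
  rw [mulVec_ket] at h3
  rw [lift_mulVec_ket, he, hU', h2 (fun y => M y (Sum.elim x 0)), h3]
  simp only [map_sum, map_smul, splice_ket]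
  refine Finset.sum_congr rfl fun y _ => ?_
  rw [extend_inl]
  congr 2
  exact hs _ _

theorem sum_elim_injective {y z : Bits ι} {s t : Bits κ} :
    (Sum.elim y s : Bits (ι ⊕ κ)) = Sum.elim z t ↔ y = z ∧ s = t := by
  constructor
  · intro h
    exact ⟨funext fun i => congrFun h (Sum.inl i), funext fun i => congrFun h (Sum.inr i)⟩
  · rintro ⟨rfl, rfl⟩; rfl

/-- The columns of the circuit at ancilla state 0 are those of `M` padded with zeros, so they have
the same inner products, and the circuit is unitary. It follows that unitarity of an implemented
operator never has to be checked by computation. -/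
theorem Impl.unitary {M : Op ι} {k : ℕ} (hM : Impl M k) : Mᴴ * M = 1 := by
  obtain ⟨α, _, _, U, hU, hU'⟩ := hM
  have hcol : ∀ x w, U w (Sum.elim x 0) = ∑ y, M y x * ket (Sum.elim y 0) w := by
    intro x w
    have := congrFun (hU' x) w
    rw [mulVec_ket] at this
    simpa using this
  ext x x'
  have h1 := congrFun (congrFun hU.unitary (Sum.elim x 0)) (Sum.elim x' 0)
  rw [Matrix.mul_apply] at h1
  simp only [conjTranspose_apply, hcol, ket_apply, Matrix.one_apply, sum_elim_injective, and_true]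
    at h1
  rw [Matrix.mul_apply, Matrix.one_apply, ← h1]
  simp only [conjTranspose_apply]
  rw [← (Equiv.sumArrowEquivProdArrow ι α (Fin 2)).symm.sum_comp, Fintype.sum_prod_type]
  refine Finset.sum_congr rfl fun y _ => ?_
  rw [Finset.sum_eq_single 0]
  · have : ∀ z : Bits ι, ((Equiv.sumArrowEquivProdArrow ι α (Fin 2)).symm (y, 0) = Sum.elim z 0) ↔
        y = z := by
      intro z
      rw [show (Equiv.sumArrowEquivProdArrow ι α (Fin 2)).symm (y, 0) = Sum.elim y 0 from rfl,
        sum_elim_injective]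
      simp
    simp [this]
  · intro s _ hs
    have : ∀ z : Bits ι, ¬ ((Equiv.sumArrowEquivProdArrow ι α (Fin 2)).symm (y, s) =
        Sum.elim z 0) := by
      intro z
      rw [show (Equiv.sumArrowEquivProdArrow ι α (Fin 2)).symm (y, s) = Sum.elim y s from rfl,
        sum_elim_injective]
      simp [hs]
    simp [this]
  · simp

/-- Since `M` is unitary, |x⟩|0⟩ is the image under the circuit of (Mᴴ|x⟩)|0⟩, and the reversed
circuit undoes this. -/
theorem Impl.conjTranspose {M : Op ι} {k : ℕ} (hM : Impl M k) : Impl Mᴴ k := by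
  have hu := hM.unitary
  have hu' : M * Mᴴ = 1 := mul_eq_one_comm.1 hu
  obtain ⟨α, _, _, U, hU, hU'⟩ := hM
  refine ⟨α, _, _, _, hU.conjTranspose, fun x => ?_⟩
  have h1 : (ket (Sum.elim x 0) : Bits (ι ⊕ α) → ℂ) =
      U *ᵥ ∑ y, Mᴴ y x • ket (Sum.elim y 0) := by
    simp only [mulVec_sum, mulVec_smul, hU', Finset.smul_sum, smul_smul]
    rw [Finset.sum_comm]
    simp only [← Finset.sum_smul]
    have : ∀ z, ∑ y, Mᴴ y x * M z y = if z = x then 1 else 0 := by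
      intro z
      rw [← Matrix.one_apply, ← hu', Matrix.mul_apply]
      exact Finset.sum_congr rfl fun _ _ => mul_comm _ _
    simp only [this, ite_smul, one_smul, zero_smul, Finset.sum_ite_eq',
      Finset.mem_univ, if_true]
  rw [h1, mulVec_mulVec, hU.unitary, one_mulVec]

end Basic

end Qubit

/-! ### Elementary gates: phases, controlled gates, Toffoli -/

namespace Qubit

open Matrix

section Gates

variable {ι κ τ : Type} [Fintype ι] [DecidableEq ι] [Fintype κ] [DecidableEq κ]
  [Fintype τ] [DecidableEq τ]

/-- The operator that acts as `u x` on the qubit `t`. -/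
def layer (t : ι) (u : Bits ι → Matrix (Fin 2) (Fin 2) ℂ) : Op ι := Matrix.of fun y x =>
  if ∀ i, i ≠ t → y i = x i then u x (y t) (x t) else 0

theorem layer_mul_apply (t : ι) (u : Bits ι → Matrix (Fin 2) (Fin 2) ℂ) (A : Op ι)
    (y x : Bits ι) : (layer t u * A) y x =
      ∑ b, u (Function.update y t b) (y t) b * A (Function.update y t b) x := by
  rw [Matrix.mul_apply]
  symm
  refine Finset.sum_of_injOn (fun b => Function.update y t b) ?_ (by simp) ?_ ?_
  · intro a _ b _ h
    simpa using congrFun h t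
  · intro z _ hz
    rw [layer, Matrix.of_apply, if_neg, zero_mul]
    intro h
    refine hz ⟨z t, by simp, ?_⟩
    ext i
    by_cases hi : i = t
    · subst hi; simp
    · simp [hi, h i hi]
  · intro b _
    rw [layer, Matrix.of_apply, if_pos]
    · simp
    · intro i hi
      simp [hi]

theorem isGate_layer_ctrl {c t : ι} (hct : c ≠ t) {u : Fin 2 → Matrix (Fin 2) (Fin 2) ℂ}
    (hu : ∀ b, (u b)ᴴ * u b = 1) : IsGate (layer t fun x => u (x c)) := by
  let e : Fin 2 ↪ ι := ⟨![c, t], by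
    intro a b
    fin_cases a <;> fin_cases b <;> simp [hct, hct.symm]⟩
  refine ⟨2, Or.inr rfl, e, Matrix.of fun y x => if y 0 = x 0 then u (x 0) (y 1) (x 1) else 0,
    ?_, ?_⟩
  · rw [Matrix.mem_unitaryGroup_iff']
    ext x x'
    rw [Matrix.mul_apply, ← (finTwoArrowEquiv (Fin 2)).symm.sum_comp, Fintype.sum_prod_type]
    simp only [star_apply, of_apply, finTwoArrowEquiv_symm_apply, Matrix.cons_val_zero,
      Matrix.cons_val_one]
    rw [Finset.sum_eq_single (x 0)]
    · by_cases h : x 0 = x' 0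
      · have h1 := congrFun (congrFun (hu (x 0)) (x 1)) (x' 1)
        rw [Matrix.mul_apply] at h1
        simp only [conjTranspose_apply] at h1
        simp only [← h, if_true, h1, Matrix.one_apply]
        congr 1
        refine propext ⟨fun h2 => ?_, fun h2 => by rw [h2]⟩
        ext i
        fin_cases i
        · simp [h]
        · simp [h2]
      · rw [Matrix.one_apply, if_neg (fun h' => h (by rw [h']))]
        simp [h]
    · intro b _ hb
      simp [hb]
    · simp
  · ext y x
    simp only [layer, lift, of_apply, Function.comp]
    have h0 : e 0 = c := rfl
    have h1 : e 1 = t := rfl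
    rw [h0, h1]
    by_cases h : ∀ i, i ≠ t → y i = x i
    · rw [if_pos h, if_pos, if_pos (h c hct)]
      exact fun i hi => h i fun hi' => hi 1 hi'.symm
    · rw [if_neg h]
      by_cases h2 : ∀ i, (∀ k, e k ≠ i) → y i = x i
      · rw [if_pos h2, if_neg]
        intro h3
        refine h fun i hi => ?_
        by_cases hc : i = c
        · rw [hc, h3]
        · refine h2 i fun k => ?_
          fin_cases k
          · exact fun h => hc h.symm
          · exact fun h => hi h.symm
      · rw [if_neg h2]

theorem isGate_layer (t : ι) {u : Matrix (Fin 2) (Fin 2) ℂ}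
    (hu : uᴴ * u = 1) : IsGate (layer t fun _ => u) := by
  let e : Fin 1 ↪ ι := ⟨fun _ => t, Function.injective_of_subsingleton _⟩
  refine ⟨1, Or.inl rfl, e, Matrix.of fun y x => u (y 0) (x 0), ?_, ?_⟩
  · rw [Matrix.mem_unitaryGroup_iff']
    ext x x'
    rw [Matrix.mul_apply, ← (Equiv.funUnique (Fin 1) (Fin 2)).symm.sum_comp]
    have h1 := congrFun (congrFun hu (x 0)) (x' 0)
    rw [Matrix.mul_apply] at h1
    simp only [conjTranspose_apply] at h1
    have h3 : x = x' ↔ x 0 = x' 0 := by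
      refine ⟨fun h => by rw [h], fun h => ?_⟩
      ext i
      rw [Subsingleton.elim i 0, h]
    simp only [star_apply, of_apply, Matrix.one_apply, h3] at h1 ⊢
    rw [← h1]
    rfl
  · ext y x
    simp only [layer, lift, of_apply, Function.comp]
    by_cases h : ∀ i, i ≠ t → y i = x i
    · rw [if_pos h, if_pos fun i hi => h i (hi 0).symm]
      rfl
    · rw [if_neg h, if_neg fun h' => h fun i hi => h' i fun _ => hi.symm]

/-- The operator `|x⟩ ↦ |f x⟩`. -/
def pm (f : Bits ι → Bits ι) : Op ι := Matrix.of fun y x => if y = f x then 1 else 0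

theorem pm_mulVec_ket (f : Bits ι → Bits ι) (x : Bits ι) : pm f *ᵥ ket x = ket (f x) := by
  rw [mulVec_ket]; ext y; simp [pm, ket_apply]

theorem pm_mul (f g : Bits ι → Bits ι) : pm f * pm g = pm (f ∘ g) := by
  refine op_ext fun x => ?_
  rw [← mulVec_mulVec, pm_mulVec_ket, pm_mulVec_ket, pm_mulVec_ket, Function.comp]

theorem pm_id : pm (id : Bits ι → Bits ι) = 1 := by
  refine op_ext fun x => ?_
  rw [pm_mulVec_ket, one_mulVec, id]

/-- The map `f` applied to the bits in the range of `e`. -/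
noncomputable def liftFun (e : κ ↪ ι) (f : Bits κ → Bits κ) (x : Bits ι) : Bits ι :=
  Function.extend e (f (x ∘ e)) x

theorem lift_pm (e : κ ↪ ι) (f : Bits κ → Bits κ) : lift e (pm f) = pm (liftFun e f) := by
  refine op_ext fun x => ?_
  rw [lift_mulVec_ket, pm_mulVec_ket, pm_mulVec_ket, splice_ket, liftFun]

theorem diagonal_mulVec_ket (d : Bits ι → ℂ) (x : Bits ι) :
    diagonal d *ᵥ ket x = d x • ket x := by
  rw [mulVec_ket]
  ext y
  simp only [diagonal_apply, Pi.smul_apply, ket_apply, smul_eq_mul]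
  split_ifs with h <;> simp [h]

theorem Impl.pm_comp {f g : Bits ι → Bits ι} {k l : ℕ} (hf : Impl (pm f) k)
    (hg : Impl (pm g) l) : Impl (pm (f ∘ g)) (k + l) := by
  rw [← pm_mul]; exact hf.mul hg

theorem Impl.pm_lift {f : Bits κ → Bits κ} {k : ℕ} (hf : Impl (pm f) k) (e : κ ↪ ι) :
    Impl (pm (liftFun e f)) k := by
  rw [← lift_pm]; exact hf.lift e

theorem Impl.pm_ancilla {F : Bits (ι ⊕ κ) → Bits (ι ⊕ κ)} {f : Bits ι → Bits ι} {k : ℕ}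
    (hF : Impl (pm F) k) (h : ∀ x, F (Sum.elim x 0) = Sum.elim (f x) 0) : Impl (pm f) k := by
  refine hF.ancilla fun x => ?_
  rw [pm_mulVec_ket, h, Finset.sum_eq_single (f x)] <;> simp +contextual [pm]

theorem Impl.diagonal_mul {d d' : Bits ι → ℂ} {k l : ℕ} (h : Impl (diagonal d) k)
    (h' : Impl (diagonal d') l) : Impl (diagonal fun x => d x * d' x) (k + l) := by
  rw [← diagonal_mul_diagonal]; exact h.mul h'

theorem Impl.diagonal_prod {A : Type} (s : Finset A) {d : A → Bits ι → ℂ} {k : ℕ}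
    (h : ∀ a ∈ s, Impl (diagonal (d a)) k) :
    Impl (diagonal fun x => ∏ a ∈ s, d a x) (s.card * k) := by
  classical
  induction s using Finset.induction_on with
  | empty =>
    simp only [Finset.prod_empty, Finset.card_empty, zero_mul, diagonal_one]
    exact Impl.one
  | insert a s ha ih =>
    simp only [Finset.prod_insert ha, Finset.card_insert_of_notMem ha]
    have := (h a (by simp)).diagonal_mul (ih fun b hb => h b (by simp [hb]))
    exact this.mono (by ring_nf; rfl)

theorem layer_diagonal (t : ι) (φ : Bits ι → Fin 2 → ℂ) :
    layer t (fun x => diagonal (φ x)) = diagonal fun x => φ x (x t) := by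
  ext y x
  simp only [layer, of_apply, diagonal_apply]
  by_cases h : y = x
  · subst h; simp
  · rw [if_neg h]
    split_ifs with h1 h2
    · refine absurd (funext fun i => ?_) h
      by_cases hi : i = t
      · rw [hi, h2]
      · exact h1 i hi
    · rfl
    · rfl

theorem diagonal_unitary {φ : Fin 2 → ℂ} (h : ∀ b, ‖φ b‖ = 1) :
    (diagonal φ)ᴴ * diagonal φ = 1 := by
  rw [diagonal_conjTranspose, diagonal_mul_diagonal, ← diagonal_one]
  congr 1
  ext b
  simp only [Pi.star_apply, RCLike.star_def]
  rw [mul_comm, Complex.mul_conj, Complex.normSq_eq_norm_sq, h]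
  simp

theorem impl_phase (t : ι) {φ : Fin 2 → ℂ} (h : ∀ b, ‖φ b‖ = 1) :
    Impl (diagonal fun x : Bits ι => φ (x t)) 1 := by
  rw [← layer_diagonal t fun _ => φ]
  exact (isGate_layer t (diagonal_unitary h)).impl

theorem impl_ctrlPhase {c t : ι} (hct : c ≠ t) {φ : Fin 2 → Fin 2 → ℂ} (h : ∀ a b, ‖φ a b‖ = 1) :
    Impl (diagonal fun x : Bits ι => φ (x c) (x t)) 1 := by
  rw [← layer_diagonal t fun x => φ (x c)]
  exact (isGate_layer_ctrl (u := fun b => diagonal (φ b)) hct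
    fun b => diagonal_unitary (h b)).impl

theorem flip_unitary (b : Fin 2) : (Matrix.of fun i j : Fin 2 => if i = j + b then (1 : ℂ) else 0)ᴴ *
    (Matrix.of fun i j : Fin 2 => if i = j + b then (1 : ℂ) else 0) = 1 := by
  ext i j
  fin_cases b <;> fin_cases i <;> fin_cases j <;> simp [Matrix.mul_apply]

theorem layer_flip (t : ι) (φ : Bits ι → Fin 2) :
    layer t (fun x => Matrix.of fun i j : Fin 2 => if i = j + φ x then (1 : ℂ) else 0) =
      pm fun x => Function.update x t (x t + φ x) := by
  ext y x
  simp only [layer, of_apply, pm]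
  rw [← ite_and]
  refine if_congr ⟨fun h => ?_, ?_⟩ rfl rfl
  · ext i
    by_cases hi : i = t
    · subst hi; simp [h.2]
    · simp [hi, h.1 i hi]
  · rintro rfl
    simp +contextual

theorem impl_not (t : ι) (b : Fin 2) :
    Impl (pm fun x : Bits ι => Function.update x t (x t + b)) 1 := by
  rw [← layer_flip t fun _ => b]
  exact (isGate_layer t (flip_unitary b)).impl

theorem impl_cnot {c t : ι} (hct : c ≠ t) :
    Impl (pm fun x : Bits ι => Function.update x t (x t + x c)) 1 := by
  rw [← layer_flip t fun x => x c]
  exact (isGate_layer_ctrl (u := fun b => Matrix.of fun i j => if i = j + b then 1 else 0) hct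
    flip_unitary).impl

/-- The Hadamard gate. -/
noncomputable def hadamard : Matrix (Fin 2) (Fin 2) ℂ :=
  Matrix.of fun i j => ((1 / Real.sqrt 2 : ℝ) : ℂ) * if i = 1 ∧ j = 1 then -1 else 1

theorem inv_sqrt_two_mul_self : ((1 / Real.sqrt 2 : ℝ) : ℂ) * ((1 / Real.sqrt 2 : ℝ) : ℂ) = 1 / 2 := by
  rw [← Complex.ofReal_mul, div_mul_div_comm, Real.mul_self_sqrt (by norm_num)]
  norm_num

theorem hadamard_unitary : hadamardᴴ * hadamard = 1 := by
  ext i j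
  have h := inv_sqrt_two_mul_self
  simp only [Matrix.mul_apply, conjTranspose_apply, hadamard, of_apply, Fin.sum_univ_two,
    RCLike.star_def, map_mul, Complex.conj_ofReal]
  generalize ((1 / Real.sqrt 2 : ℝ) : ℂ) = r at h ⊢
  fin_cases i <;> fin_cases j <;> simp <;> first | (ring_nf; done) | linear_combination 2 * h

theorem pm_conj_diagonal {f : Bits ι → Bits ι} (hf : ∀ x, f (f x) = x) (d : Bits ι → ℂ) :
    pm f * (diagonal d * pm f) = diagonal fun x => d (f x) := by
  refine op_ext fun x => ?_
  rw [← mulVec_mulVec, ← mulVec_mulVec, pm_mulVec_ket, diagonal_mulVec_ket, mulVec_smul,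
    pm_mulVec_ket, hf, diagonal_mulVec_ket]

/-- If the qubit t is 1, the three controlled phases multiply to i^(a + b - (a ⊕ b)) = i^(2ab) =
(-1)^(ab). The exponent a ⊕ b is obtained by conjugating a phase on b with a controlled not. -/
theorem impl_ccz {a b t : ι} (hab : a ≠ b) (hat : a ≠ t) (hbt : b ≠ t) :
    Impl (diagonal fun x : Bits ι => if x a = 1 ∧ x b = 1 ∧ x t = 1 then (-1 : ℂ) else 1) 5 := by
  let φ : ℂ → Fin 2 → Fin 2 → ℂ := fun z p q => if p = 1 ∧ q = 1 then z else 1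
  have hφ : ∀ z : ℂ, ‖z‖ = 1 → ∀ p q, ‖φ z p q‖ = 1 := by
    intro z hz p q
    simp only [φ]
    split_ifs <;> simp [hz]
  have h1 := impl_ctrlPhase hbt (hφ Complex.I (by simp))
  have h2 := impl_ctrlPhase hat (hφ Complex.I (by simp))
  have h3 := (impl_cnot hab).mul ((impl_ctrlPhase hbt (hφ (-Complex.I) (by simp))).mul (impl_cnot hab))
  rw [pm_conj_diagonal] at h3
  · have h4 := (h1.diagonal_mul h2).diagonal_mul h3
    convert h4 using 2
    ext x
    simp only [Function.update_self, Function.update_of_ne hbt.symm, φ]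
    generalize x a = p
    generalize x b = q
    generalize x t = r
    fin_cases p <;> fin_cases q <;> fin_cases r <;> simp
  · intro x
    ext i
    by_cases hi : i = b
    · subst hi
      simp only [Function.update_self, Function.update_of_ne hab]
      generalize x a = p
      generalize x i = q
      revert p q
      decide
    · simp [hi]

/-- Hadamard gates on t turn the doubly controlled sign into a doubly controlled flip. -/
theorem impl_toffoli {a b t : ι} (hab : a ≠ b) (hat : a ≠ t) (hbt : b ≠ t) :
    Impl (pm fun x : Bits ι => Function.update x t (x t + x a * x b)) 7 := by
  have hH : Impl (layer t fun _ => hadamard) 1 := (isGate_layer t hadamard_unitary).impl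
  have h := hH.mul ((impl_ccz hab hat hbt).mul hH)
  convert h using 1
  ext y x
  rw [layer_mul_apply]
  simp only [diagonal_mul, layer, of_apply, pm, Function.update_self, Function.update_of_ne hat,
    Function.update_of_ne hbt]
  have hc : ∀ c, (∀ i, i ≠ t → Function.update y t c i = x i) ↔ (∀ i, i ≠ t → y i = x i) :=
    fun c => forall₂_congr fun i hi => by rw [Function.update_of_ne hi]
  simp only [hc]
  by_cases hh : ∀ i, i ≠ t → y i = x i
  · have h1 : (y = Function.update x t (x t + x a * x b)) ↔ y t = x t + x a * x b := by
      constructor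
      · intro h'; rw [h']; simp
      · intro h'; ext i
        by_cases hi : i = t
        · subst hi; simp [h']
        · simp [hi, hh i hi]
    simp only [h1, hh a hat, hh b hbt, hadamard, of_apply, Fin.sum_univ_two]
    rw [if_pos hh, if_pos hh]
    have hr := inv_sqrt_two_mul_self
    generalize ((1 / Real.sqrt 2 : ℝ) : ℂ) = r at hr ⊢
    generalize x a = p
    generalize x b = q
    generalize x t = v
    generalize y t = w
    fin_cases p <;> fin_cases q <;> fin_cases v <;> fin_cases w <;> simp <;>
      first | (ring_nf; done) | linear_combination (-2) * hr
  · rw [if_neg]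
    · simp [hh]
    · rintro rfl
      exact hh fun i hi => by simp [hi]

end Gates

end Qubit

/-! ### Translation to and from the concrete circuit model -/

namespace Qubit

open Matrix

section Bridge

theorem QGate.toMatrix_eq {n : ℕ} (G : QGate n) : G.toMatrix = lift G.wires (G.op : Op _) := by
  ext y x
  simp only [QGate.toMatrix, lift, of_apply]
  by_cases h : ∀ i, (∀ k, G.wires k ≠ i) → y i = x i
  · rw [if_pos h, if_pos h]
  · rw [if_neg h, if_neg h]

theorem isCircuit_toMatrix {n : ℕ} (c : QCircuit n) : IsCircuit c.toMatrix c.length := by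
  induction c with
  | nil => exact IsCircuit.one
  | cons G c ih =>
    have hG : IsGate G.toMatrix := ⟨G.arity, G.arity_eq, G.wires, G.op, G.op.2, QGate.toMatrix_eq G⟩
    exact ih.mul hG.isCircuit

theorem IsCircuit.exists_circuit {n k : ℕ} {U : Op (Fin n)} (h : IsCircuit U k) :
    ∃ c : QCircuit n, c.length ≤ k ∧ c.toMatrix = U := by
  obtain ⟨l, h₁, h₂, rfl⟩ := h
  -- The last factor of a matrix product acts first, whereas a `QCircuit` lists its first gate
  -- first; hence the reversal.
  have : ∀ l : List (Op (Fin n)), (∀ M ∈ l, IsGate M) →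
      ∃ c : QCircuit n, c.length = l.length ∧ c.toMatrix = l.reverse.prod := by
    intro l
    induction l with
    | nil => exact fun _ => ⟨[], rfl, rfl⟩
    | cons M l ih =>
      intro h
      obtain ⟨c, hc, hc'⟩ := ih fun N hN => h N (by simp [hN])
      obtain ⟨a, ha, e, u, hu, rfl⟩ := h M (by simp)
      refine ⟨⟨a, ha, e, ⟨u, hu⟩⟩ :: c, by simp [hc], ?_⟩
      rw [QCircuit.toMatrix, hc', List.reverse_cons, List.prod_append, List.prod_singleton,
        QGate.toMatrix_eq]
  obtain ⟨c, hc, hc'⟩ := this l.reverse (by simpa using h₂)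
  exact ⟨c, by simpa [hc] using h₁, by simpa using hc'⟩

variable {ι κ : Type} [Fintype ι] [DecidableEq ι] [Fintype κ] [DecidableEq κ]

theorem lift_equiv_apply (e : κ ≃ ι) (M : Op κ) (y x : Bits ι) :
    lift e.toEmbedding M y x = M (y ∘ e) (x ∘ e) := by
  rw [lift, of_apply, if_pos]
  · rfl
  · exact fun i hi => absurd (e.apply_symm_apply i) (hi _)

theorem append_comp_symm {n a : ℕ} (y : Bits (Fin n)) (z : Bits (Fin a)) :
    (Sum.elim y z : Bits (Fin n ⊕ Fin a)) ∘ finSumFinEquiv.symm = Fin.append y z := by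
  rw [Equiv.comp_symm_eq]
  ext (i | i) <;> simp

theorem impl_of_implementableWith {n k : ℕ} {M : Op (Fin n)} (h : ImplementableWith M k) :
    Impl M k := by
  obtain ⟨a, c, hc, h⟩ := h
  refine ⟨Fin a, inferInstance, inferInstance, _,
    ((isCircuit_toMatrix c).mono hc).lift finSumFinEquiv.symm.toEmbedding, fun x => ?_⟩
  rw [mulVec_ket]
  ext w
  obtain ⟨⟨y, z⟩, rfl⟩ := (Equiv.sumArrowEquivProdArrow (Fin n) (Fin a) (Fin 2)).symm.surjective w
  rw [lift_equiv_apply]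
  simp only [Equiv.sumArrowEquivProdArrow, Equiv.coe_fn_symm_mk, append_comp_symm]
  rw [h]
  simp only [Finset.sum_apply, Pi.smul_apply, ket_apply, sum_elim_injective, smul_eq_mul]
  by_cases hz : z = 0 <;> simp [hz]

theorem Impl.implementableWith {n k : ℕ} {M : Op (Fin n)} (h : Impl M k) :
    ImplementableWith M k := by
  obtain ⟨α, _, _, U, hU, h⟩ := h
  let f : α ≃ Fin (Fintype.card α) := Fintype.equivFin α
  let e : Fin n ⊕ α ≃ Fin (n + Fintype.card α) :=
    ((Equiv.refl _).sumCongr f).trans finSumFinEquiv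
  obtain ⟨c, hc, hc'⟩ := (hU.lift e.toEmbedding).exists_circuit
  refine ⟨_, c, hc, fun x y z => ?_⟩
  have he : ∀ (y : Bits (Fin n)) z, Fin.append y z ∘ e = Sum.elim y (z ∘ f) := by
    intro y z
    ext (i | i) <;> simp [e]
  have h1 := congrFun (h x) (Sum.elim y (z ∘ f))
  rw [mulVec_ket] at h1
  have h2 : z ∘ f = 0 ↔ z = 0 := by
    constructor
    · intro h
      ext i
      have := congrFun h (f.symm i)
      simpa using congrArg Fin.val this
    · rintro rfl; rfl
  have h3 : ((0 : Bits (Fin (Fintype.card α))) ∘ f) = 0 := rfl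
  rw [hc', lift_equiv_apply, he, he, h3]
  refine h1.trans ?_
  simp only [Finset.sum_apply, Pi.smul_apply, ket_apply, sum_elim_injective, smul_eq_mul, h2]
  by_cases hz : z = 0 <;> simp [hz]

end Bridge

/-! ### Reversible computation of functions on bits -/

section Comp

variable {ι κ τ σ : Type} [Fintype ι] [DecidableEq ι] [Fintype κ] [DecidableEq κ]
  [Fintype τ] [DecidableEq τ] [Fintype σ] [DecidableEq σ]

theorem fin_two_add_self (a : Fin 2) : a + a = 0 := by revert a; decide

theorem bits_add_self (a : Bits ι) : a + a = 0 := funext fun i => fin_two_add_self (a i)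

/-- `(x, y) ↦ (x, y ⊕ f x)`. -/
def xorMap (f : Bits ι → Bits κ) (s : Bits (ι ⊕ κ)) : Bits (ι ⊕ κ) :=
  Sum.elim (s ∘ Sum.inl) (s ∘ Sum.inr + f (s ∘ Sum.inl))

/-- The function `f` on bits can be computed with `k` gates. -/
def Comp (f : Bits ι → Bits κ) (k : ℕ) : Prop := Impl (pm (xorMap f)) k

theorem Comp.mono {f : Bits ι → Bits κ} {k l : ℕ} (h : Comp f k) (hkl : k ≤ l) : Comp f l :=
  Impl.mono h hkl

/-- Add `f` of the bits in the range of `a` to the bits in the range of `b`. -/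
noncomputable def xorInto (a : ι ↪ σ) (b : κ ↪ σ) (f : Bits ι → Bits κ) (s : Bits σ) : Bits σ :=
  Function.extend b (s ∘ b + f (s ∘ a)) s

theorem Comp.impl_xorInto {f : Bits ι → Bits κ} {k : ℕ} (h : Comp f k) (a : ι ↪ σ) (b : κ ↪ σ)
    (hab : ∀ i j, a i ≠ b j) : Impl (pm (xorInto a b f)) k := by
  let e : ι ⊕ κ ↪ σ := ⟨Sum.elim a b, a.injective.sumElim b.injective hab⟩
  convert Impl.pm_lift h e using 2
  ext s : 1
  symm
  refine extend_eq e ?_ ?_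
  · rintro (i | j)
    · refine Function.extend_apply' _ _ _ ?_
      rintro ⟨j, hj⟩
      exact hab i j hj.symm
    · exact b.injective.extend_apply _ _ _
  · intro i hi
    refine Function.extend_apply' _ _ _ ?_
    rintro ⟨j, rfl⟩
    exact hi (Sum.inr j) rfl

theorem Comp.zero : Comp (fun _ : Bits ι => (0 : Bits κ)) 0 := by
  have : xorMap (fun _ : Bits ι => (0 : Bits κ)) = id := by
    ext s (i | i) <;> simp [xorMap]
  rw [Comp, this, pm_id]
  exact Impl.one

theorem Comp.add {f g : Bits ι → Bits κ} {k l : ℕ} (hf : Comp f k) (hg : Comp g l) :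
    Comp (fun x => f x + g x) (k + l) := by
  have : xorMap (fun x => f x + g x) = xorMap g ∘ xorMap f := by
    ext s (i | i)
    · rfl
    · simp [xorMap, add_assoc]
  rw [Comp, this, add_comm]
  exact Impl.pm_comp hg hf

/-- Compute `f` into a scratch register, apply `g` to it, and compute `f` again: adding the same
bits twice modulo 2 clears the register, whence the factor 2. -/
theorem Comp.comp {f : Bits ι → Bits κ} {g : Bits κ → Bits τ} {k l : ℕ} (hg : Comp g l)
    (hf : Comp f k) : Comp (fun x => g (f x)) (2 * k + l) := by
  let a : ι ↪ (ι ⊕ τ) ⊕ κ := Function.Embedding.inl.trans Function.Embedding.inl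
  let b : τ ↪ (ι ⊕ τ) ⊕ κ := Function.Embedding.inr.trans Function.Embedding.inl
  let c : κ ↪ (ι ⊕ τ) ⊕ κ := Function.Embedding.inr
  have h1 := hf.impl_xorInto a c (by simp [a, c])
  have h2 := hg.impl_xorInto c b (by simp [b, c])
  have e1 : ∀ x y z, xorInto a c f (Sum.elim (Sum.elim x y) z) =
      Sum.elim (Sum.elim x y) (z + f x) := by
    intro x y z
    exact extend_inr _ _
  have e2 : ∀ x y z, xorInto c b g (Sum.elim (Sum.elim x y) z) =
      Sum.elim (Sum.elim x (y + g z)) z := by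
    intro x y z
    refine extend_eq b (fun _ => rfl) ?_
    rintro ((i | i) | i) hi
    exacts [rfl, absurd rfl (hi i), rfl]
  refine Impl.mono (Impl.pm_ancilla ((h1.pm_comp h2).pm_comp h1) fun s => ?_)
    (by omega : k + l + k ≤ 2 * k + l)
  have hs : s = Sum.elim (s ∘ Sum.inl) (s ∘ Sum.inr) := (Sum.elim_comp_inl_inr s).symm
  rw [hs]
  simp only [Function.comp_apply, e1, e2]
  rw [zero_add, bits_add_self]
  rfl

theorem Comp.pair {f : Bits ι → Bits κ} {g : Bits ι → Bits τ} {k l : ℕ} (hf : Comp f k)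
    (hg : Comp g l) : Comp (fun x => (Sum.elim (f x) (g x) : Bits (κ ⊕ τ))) (k + l) := by
  let a : ι ↪ ι ⊕ (κ ⊕ τ) := Function.Embedding.inl
  let b : κ ↪ ι ⊕ (κ ⊕ τ) := Function.Embedding.inl.trans Function.Embedding.inr
  let c : τ ↪ ι ⊕ (κ ⊕ τ) := Function.Embedding.inr.trans Function.Embedding.inr
  have h1 := hf.impl_xorInto a b (by simp [a, b])
  have h2 := hg.impl_xorInto a c (by simp [a, c])
  have e1 : ∀ x y z, xorInto a b f (Sum.elim x (Sum.elim y z)) =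
      Sum.elim x (Sum.elim (y + f x) z) := by
    intro x y z
    refine extend_eq b (fun _ => rfl) ?_
    rintro (i | i | i) hi
    exacts [rfl, absurd rfl (hi i), rfl]
  have e2 : ∀ x y z, xorInto a c g (Sum.elim x (Sum.elim y z)) =
      Sum.elim x (Sum.elim y (z + g x)) := by
    intro x y z
    refine extend_eq c (fun _ => rfl) ?_
    rintro (i | i | i) hi
    exacts [rfl, rfl, absurd rfl (hi i)]
  have := h1.pm_comp h2
  unfold Comp
  convert this using 2
  ext s : 1
  obtain ⟨x, w, rfl⟩ : ∃ x w, s = Sum.elim x w := ⟨_, _, (Sum.elim_comp_inl_inr s).symm⟩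
  obtain ⟨y, z, rfl⟩ : ∃ x z, w = Sum.elim x z := ⟨_, _, (Sum.elim_comp_inl_inr w).symm⟩
  rw [Function.comp_apply, e2, e1]
  ext (i | i | i) <;> rfl

theorem Comp.pre {f : Bits κ → Bits τ} {k : ℕ} (hf : Comp f k) (e : κ ↪ ι) :
    Comp (fun x : Bits ι => f (x ∘ e)) k := by
  have := hf.impl_xorInto (σ := ι ⊕ τ) (e.trans Function.Embedding.inl) Function.Embedding.inr (by simp)
  unfold Comp
  convert this using 2
  ext s : 1
  symm
  exact extend_inr _ _

/-- The bit `φ` can be computed with `k` gates. -/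
def CompBit (φ : Bits ι → Fin 2) (k : ℕ) : Prop := Comp (fun x (_ : Unit) => φ x) k

theorem CompBit.mono {φ : Bits ι → Fin 2} {k l : ℕ} (h : CompBit φ k) (hkl : k ≤ l) :
    CompBit φ l := Impl.mono h hkl

theorem Comp.pi {f : Bits ι → Bits κ} {k : ℕ} (h : ∀ t, CompBit (fun x => f x t) k) :
    Comp f (Fintype.card κ * k) := by
  have key : ∀ s : Finset κ, Comp (fun x t => if t ∈ s then f x t else 0) (s.card * k) := by
    intro s
    induction s using Finset.induction_on with
    | empty =>
      simp only [Finset.notMem_empty, if_false, Finset.card_empty, zero_mul]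
      exact Comp.zero
    | insert a s ha ih =>
      let b : Unit ↪ ι ⊕ κ := ⟨fun _ => Sum.inr a, Function.injective_of_subsingleton _⟩
      have h1 := Comp.impl_xorInto (h a) (σ := ι ⊕ κ) Function.Embedding.inl b (by simp [b])
      have := Impl.pm_comp ih h1
      rw [Finset.card_insert_of_notMem ha]
      refine Impl.mono ?_ (show s.card * k + k ≤ (s.card + 1) * k by rw [add_mul, one_mul])
      convert this using 2
      ext x : 1
      have h2 : Qubit.xorInto Function.Embedding.inl b (fun x _ => f x a) x =
          Sum.elim (x ∘ Sum.inl) (x ∘ Sum.inr + fun t => if t = a then f (x ∘ Sum.inl) a else 0) := by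
        refine extend_eq b ?_ ?_
        · intro _; simp [b, Function.comp_def]
        · rintro (i | i) hi
          · rfl
          · have : i ≠ a := fun h' => hi () (by rw [h']; rfl)
            simp [this]
      rw [Function.comp_apply, h2]
      ext (i | i)
      · rfl
      · simp only [xorMap, Finset.mem_insert, Sum.elim_inr, Pi.add_apply, Sum.elim_comp_inr,
          Sum.elim_comp_inl, Function.comp_apply]
        by_cases hi : i = a
        · subst hi; simp [ha]
        · simp [hi]
  simpa using key Finset.univ

theorem CompBit.add {φ ψ : Bits ι → Fin 2} {k l : ℕ} (h : CompBit φ k) (h' : CompBit ψ l) :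
    CompBit (fun x => φ x + ψ x) (k + l) := Comp.add h h'

theorem CompBit.sum {A : Type} (s : Finset A) {φ : A → Bits ι → Fin 2} {k : ℕ}
    (h : ∀ a ∈ s, CompBit (φ a) k) : CompBit (fun x => ∑ a ∈ s, φ a x) (s.card * k) := by
  classical
  induction s using Finset.induction_on with
  | empty =>
    simp only [Finset.sum_empty, Finset.card_empty, zero_mul]
    exact Comp.zero
  | insert a s ha ih =>
    simp only [Finset.sum_insert ha, Finset.card_insert_of_notMem ha]
    exact ((h a (by simp)).add (ih fun b hb => h b (by simp [hb]))).mono (by ring_nf; rfl)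

theorem compBit_of_update {φ : Bits ι → Fin 2} {k : ℕ}
    (h : Impl (pm fun s : Bits (ι ⊕ Unit) =>
      Function.update s (Sum.inr ()) (s (Sum.inr ()) + φ (s ∘ Sum.inl))) k) : CompBit φ k := by
  unfold CompBit Comp
  convert h using 2
  ext s (i | i) <;> simp [xorMap]

theorem CompBit.const (b : Fin 2) : CompBit (fun _ : Bits ι => b) 1 :=
  compBit_of_update (impl_not _ b)

theorem CompBit.bit (a : ι) : CompBit (fun x => x a) 1 :=
  compBit_of_update (impl_cnot (by simp))

theorem CompBit.mul (a b : ι) : CompBit (fun x => x a * x b) 7 := by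
  -- A Toffoli gate needs two distinct control qubits; for a = b the product is the bit itself.
  by_cases h : a = b
  · subst h
    have : (fun x : Bits ι => x a * x a) = fun x => x a := by
      ext x
      generalize x a = p
      revert p; decide
    rw [this]
    exact (CompBit.bit a).mono (by norm_num)
  · exact compBit_of_update (impl_toffoli (by simpa using h) (by simp) (by simp))

theorem Comp.reindex (s : κ → ι) : Comp (fun x t => x (s t)) (Fintype.card κ) := by
  have := Comp.pi (f := fun (x : Bits ι) t => x (s t)) (fun t => CompBit.bit (s t))
  simpa using this

/-- With one scratch register: (x, 0), then (x, f x), then (x + g (f x), f x) = (0, f x), then (f x,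
f x) and (f x, 0). The inverse `g` serves to erase the input. -/
theorem Comp.impl_pm {f g : Bits ι → Bits ι} {k l : ℕ} (hf : Comp f k) (hg : Comp g l)
    (h : ∀ x, g (f x) = x) : Impl (pm f) (k + l + 2 * Fintype.card ι) := by
  have hid : Comp (fun x : Bits ι => x) (Fintype.card ι) := Comp.reindex id
  let a : ι ↪ ι ⊕ ι := Function.Embedding.inl
  let b : ι ↪ ι ⊕ ι := Function.Embedding.inr
  have h1 := hf.impl_xorInto a b (by simp [a, b])
  have h2 := hg.impl_xorInto b a (by simp [a, b])
  have h3 := hid.impl_xorInto b a (by simp [a, b])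
  have h4 := hid.impl_xorInto a b (by simp [a, b])
  have e1 : ∀ (f : Bits ι → Bits ι) x y, Qubit.xorInto a b f (Sum.elim x y) = Sum.elim x (y + f x) := by
    intro f x y
    exact extend_inr _ _
  have e2 : ∀ (f : Bits ι → Bits ι) x y, Qubit.xorInto b a f (Sum.elim x y) = Sum.elim (x + f y) y := by
    intro f x y
    exact extend_inl _ _
  refine Impl.mono (Impl.pm_ancilla (h4.pm_comp (h3.pm_comp (h2.pm_comp h1))) fun x => ?_)
    (by omega : Fintype.card ι + (Fintype.card ι + (l + k)) ≤ k + l + 2 * Fintype.card ι)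
  simp only [Function.comp_apply, e1, e2, zero_add, h, bits_add_self]

end Comp

end Qubit

/-! ### Operators selected by a control register -/

namespace Qubit

open Matrix

section Mux

variable {ι κ ζ : Type} [Fintype ι] [DecidableEq ι] [Fintype κ] [DecidableEq κ]
  [Fintype ζ] [DecidableEq ζ]

/-- Apply an operator to the second register that is selected by the first one. -/
def mux (Q : Bits κ → Op ζ) : Op (κ ⊕ ζ) := Matrix.of fun y x =>
  if y ∘ Sum.inl = x ∘ Sum.inl then Q (x ∘ Sum.inl) (y ∘ Sum.inr) (x ∘ Sum.inr) else 0

theorem mux_mulVec_ket (Q : Bits κ → Op ζ) (c : Bits κ) (z : Bits ζ) :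
    mux Q *ᵥ ket (Sum.elim c z) = ∑ w, Q c w z • ket (Sum.elim c w) := by
  rw [mulVec_ket]
  ext y
  obtain ⟨a, b, rfl⟩ : ∃ a b, y = Sum.elim a b := ⟨_, _, (Sum.elim_comp_inl_inr y).symm⟩
  simp only [mux, of_apply, Sum.elim_comp_inl, Sum.elim_comp_inr, Finset.sum_apply, Pi.smul_apply,
    ket_apply, sum_elim_injective, smul_eq_mul]
  by_cases h : a = c <;> simp [h]

/-- The selecting value `f x` is computed into scratch. A multiplexed operator does not change its
control register, so the value can be erased afterwards. -/
theorem Impl.mux_comp {Q : Bits κ → Op ζ} {f : Bits ι → Bits κ} {k l : ℕ} (hQ : Impl (mux Q) l)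
    (hf : Comp f k) : Impl (mux fun x => Q (f x)) (2 * k + l) := by
  let a : ι ↪ (ι ⊕ ζ) ⊕ κ := Function.Embedding.inl.trans Function.Embedding.inl
  let c : κ ↪ (ι ⊕ ζ) ⊕ κ := Function.Embedding.inr
  let e : κ ⊕ ζ ↪ (ι ⊕ ζ) ⊕ κ := ⟨Sum.elim Sum.inr (Sum.inl ∘ Sum.inr), by
    rintro (i | i) (j | j) h <;> simp_all⟩
  have h1 := hf.impl_xorInto a c (by simp [a, c])
  have h2 := hQ.lift e
  have e1 : ∀ x y z, xorInto a c f (Sum.elim (Sum.elim x y) z) =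
      Sum.elim (Sum.elim x y) (z + f x) := by
    intro x y z
    exact extend_inr _ _
  refine Impl.mono (Impl.ancilla (h1.mul (h2.mul h1)) fun s => ?_)
    (by omega : k + (l + k) ≤ 2 * k + l)
  obtain ⟨x, y, rfl⟩ : ∃ x y, s = Sum.elim x y := ⟨_, _, (Sum.elim_comp_inl_inr s).symm⟩
  have e2 : ∀ z, (Sum.elim (Sum.elim x y) z : Bits ((ι ⊕ ζ) ⊕ κ)) ∘ e = Sum.elim z y := by
    intro z; ext (i | i) <;> rfl
  have e3 : ∀ z w, Function.extend e (Sum.elim z w) (Sum.elim (Sum.elim x y) z) =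
      Sum.elim (Sum.elim x w) z := by
    intro z w
    refine extend_eq e (by rintro (i | i) <;> rfl) ?_
    rintro ((i | i) | i) hi
    exacts [rfl, absurd rfl (hi (Sum.inr i)), rfl]
  rw [← mulVec_mulVec, ← mulVec_mulVec, pm_mulVec_ket, e1, zero_add, lift_mulVec_ket, e2,
    mux_mulVec_ket]
  simp only [map_sum, map_smul, splice_ket, e3, mulVec_sum, mulVec_smul, pm_mulVec_ket, e1,
    bits_add_self]
  have := mux_mulVec_ket (fun x => Q (f x)) x y
  rw [mulVec_ket] at this
  have h2 : ∀ v : Bits (ι ⊕ ζ) → ℂ, ∑ y, v y • ket (Sum.elim y 0 : Bits ((ι ⊕ ζ) ⊕ κ)) =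
      splice Function.Embedding.inl 0 v := by
    intro c
    rw [splice_apply]
    refine Finset.sum_congr rfl fun y _ => ?_
    rw [extend_inl]
    rfl
  rw [h2 (fun w => mux (fun x => Q (f x)) w (Sum.elim x y)), this]
  simp only [map_sum, map_smul, splice_ket, extend_inl]
  rfl

/-- Apply `u i (c i)` to the qubit `i`, for all `i`. -/
def ctrlTensor (u : ζ → Fin 2 → Matrix (Fin 2) (Fin 2) ℂ) (c : Bits ζ) : Op ζ :=
  Matrix.of fun y x => ∏ i, u i (c i) (y i) (x i)

/-- Control bit i acts on target i only, so one two-qubit gate per target suffices; the induction is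
over the set of targets already treated. -/
theorem impl_mux_ctrlTensor {u : ζ → Fin 2 → Matrix (Fin 2) (Fin 2) ℂ}
    (hu : ∀ i b, (u i b)ᴴ * u i b = 1) : Impl (mux (ctrlTensor u)) (Fintype.card ζ) := by
  have key : ∀ s : Finset ζ, Impl (Matrix.of fun y x : Bits (ζ ⊕ ζ) =>
      if y ∘ Sum.inl = x ∘ Sum.inl ∧ ∀ i, i ∉ s → y (Sum.inr i) = x (Sum.inr i) then
        ∏ i ∈ s, u i (x (Sum.inl i)) (y (Sum.inr i)) (x (Sum.inr i)) else 0) s.card := by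
    intro s
    induction s using Finset.induction_on with
    | empty =>
      rw [Finset.card_empty]
      convert Impl.one (ι := ζ ⊕ ζ) using 1
      ext y x
      simp only [of_apply, Matrix.one_apply, Finset.notMem_empty, not_false_eq_true, true_imp_iff,
        Finset.prod_empty]
      refine if_congr ⟨fun h => ?_, ?_⟩ rfl rfl
      · ext (i | i)
        · rw [show y (Sum.inl i) = x (Sum.inl i) from congrFun h.1 i]
        · rw [h.2 i]
      · rintro rfl; simp
    | insert a s ha ih =>
      have h1 : Impl (layer (Sum.inr a) fun x : Bits (ζ ⊕ ζ) => u a (x (Sum.inl a))) 1 :=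
        (isGate_layer_ctrl (by simp) (hu a)).impl
      have h2 := h1.mul ih
      rw [Finset.card_insert_of_notMem ha, add_comm]
      convert h2 using 1
      ext y x
      rw [layer_mul_apply]
      simp only [of_apply]
      rw [Finset.sum_eq_single (x (Sum.inr a))]
      · have hc : (Function.update y (Sum.inr a) (x (Sum.inr a)) ∘ Sum.inl = x ∘ Sum.inl ∧
            ∀ i, i ∉ s → Function.update y (Sum.inr a) (x (Sum.inr a)) (Sum.inr i) = x (Sum.inr i)) ↔
            (y ∘ Sum.inl = x ∘ Sum.inl ∧ ∀ i, i ∉ insert a s → y (Sum.inr i) = x (Sum.inr i)) := by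
          refine and_congr (Eq.congr_left (funext fun i => by simp)) (forall_congr' fun i => ?_)
          by_cases hi : i = a
          · subst hi; simp
          · simp [hi]
        rw [if_congr hc rfl rfl]
        by_cases h : y ∘ Sum.inl = x ∘ Sum.inl ∧ ∀ i, i ∉ insert a s → y (Sum.inr i) = x (Sum.inr i)
        · rw [if_pos h, if_pos h, Finset.prod_insert ha]
          have h3 : y (Sum.inl a) = x (Sum.inl a) := congrFun h.1 a
          congr 1
          · rw [Function.update_of_ne (by simp), h3]
          · refine Finset.prod_congr rfl fun i hi => ?_
            rw [Function.update_of_ne]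
            rintro h
            exact ha (Sum.inr_injective h ▸ hi)
        · rw [if_neg h, if_neg h, mul_zero]
      · intro b _ hb
        rw [if_neg, mul_zero]
        rintro ⟨-, h⟩
        exact hb (by simpa using h a ha)
      · simp
  have := key Finset.univ
  rw [Finset.card_univ] at this
  convert this using 1
  ext y x
  simp [mux, ctrlTensor]

end Mux

/-- `e^{2 π i t}`. -/
noncomputable def cis (t : ℝ) : ℂ := Complex.exp (2 * Real.pi * t * Complex.I)

theorem cis_add (s t : ℝ) : cis (s + t) = cis s * cis t := by
  rw [cis, cis, cis, ← Complex.exp_add]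
  congr 1
  push_cast
  ring

theorem cis_zero : cis 0 = 1 := by simp [cis]

theorem cis_sum {A : Type} (s : Finset A) (f : A → ℝ) : cis (∑ a ∈ s, f a) = ∏ a ∈ s, cis (f a) := by
  classical
  induction s using Finset.induction_on with
  | empty => simp [cis_zero]
  | insert a s ha ih => rw [Finset.sum_insert ha, Finset.prod_insert ha, cis_add, ih]

theorem cis_int (n : ℤ) : cis n = 1 := by
  rw [cis, Complex.exp_eq_one_iff]
  exact ⟨n, by push_cast; ring⟩

theorem cis_eq_of_sub_int {s t : ℝ} (n : ℤ) (h : s = t + n) : cis s = cis t := by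
  rw [h, cis_add, cis_int, mul_one]

theorem norm_cis (t : ℝ) : ‖cis t‖ = 1 := by
  rw [cis, show (2 * Real.pi * t * Complex.I : ℂ) = ((2 * Real.pi * t : ℝ) : ℂ) * Complex.I by
    push_cast; ring]
  exact Complex.norm_exp_ofReal_mul_I _

theorem cis_half : cis (1 / 2) = -1 := by
  rw [cis, show (2 * Real.pi * ((1 / 2 : ℝ) : ℂ) * Complex.I : ℂ) = Real.pi * Complex.I by
    push_cast; ring, Complex.exp_pi_mul_I]

/-! ### The quantum Fourier transform -/

section QFT

/-- The number with the binary digits `x`. -/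
def val {n : ℕ} (x : Bits (Fin n)) : ℕ := (finFunctionFinEquiv x : Fin (2 ^ n))

theorem val_eq {n : ℕ} (x : Bits (Fin n)) : val x = ∑ i, (x i : ℕ) * 2 ^ (i : ℕ) :=
  finFunctionFinEquiv_apply x

theorem val_lt {n : ℕ} (x : Bits (Fin n)) : val x < 2 ^ n := Fin.is_lt _

/-- The quantum Fourier transform. -/
noncomputable def fourier (n : ℕ) : Op (Fin n) := Matrix.of fun y x =>
  ((1 / Real.sqrt 2 : ℝ) : ℂ) ^ n * cis (val y * val x / 2 ^ n)

theorem hadamard_eq (a b : Fin 2) :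
    hadamard a b = ((1 / Real.sqrt 2 : ℝ) : ℂ) * cis ((a : ℕ) * (b : ℕ) / 2) := by
  rw [hadamard, of_apply]
  fin_cases a <;> fin_cases b <;> simp [cis_zero]
  rw [← one_div 2, cis_half]
  ring

/-- The operator of the last `n - t` steps of the circuit for the quantum Fourier transform. -/
noncomputable def fourierPart (n t : ℕ) : Op (Fin n) := Matrix.of fun y x =>
  if ∀ a : Fin n, (a : ℕ) < t → y a = x a then
    ∏ r : Fin n, if t ≤ (r : ℕ) then ((1 / Real.sqrt 2 : ℝ) : ℂ) *
      cis ((y r : ℕ) * (∑ a : Fin n, if (a : ℕ) ≤ r then (x a : ℝ) * 2 ^ (a : ℕ) else 0) / 2 ^ ((r : ℕ) + 1))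
      else 1
  else 0

theorem fourierPart_self (n : ℕ) : fourierPart n n = 1 := by
  ext y x
  simp only [fourierPart, of_apply, Matrix.one_apply, Fin.is_lt, true_imp_iff]
  refine if_congr ⟨fun h => funext h, fun h => by simp [h]⟩ ?_ rfl
  exact Finset.prod_eq_one fun r _ => if_neg (by simp)

/-- Qubits are treated from the most significant one downwards, so when t is treated the qubits a <
t still hold input digits and can control the phases. The term a = t of the phase, y t * x t / 2,
comes from the Hadamard gate itself. -/
theorem fourierPart_step {n : ℕ} (t : Fin n) : fourierPart n t =
    diagonal (fun y : Bits (Fin n) => ∏ a ∈ Finset.univ.filter (· < t),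
      cis ((y t : ℕ) * ((y a : ℝ) * 2 ^ (a : ℕ)) / 2 ^ ((t : ℕ) + 1))) *
    (layer t (fun _ => hadamard) * fourierPart n (t + 1)) := by
  ext y x
  rw [diagonal_mul, layer_mul_apply, Finset.sum_eq_single (x t)]
  · simp only [fourierPart, of_apply]
    have hc : (∀ a : Fin n, (a : ℕ) < t + 1 → Function.update y t (x t) a = x a) ↔
        (∀ a : Fin n, (a : ℕ) < t → y a = x a) := by
      refine forall_congr' fun a => ?_
      by_cases ha : a = t
      · subst ha; simp
      · have : (a : ℕ) ≠ t := fun h => ha (Fin.ext h)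
        rw [Function.update_of_ne ha, show (a : ℕ) < t + 1 ↔ (a : ℕ) < t by omega]
    rw [if_congr hc rfl rfl]
    by_cases h : ∀ a : Fin n, (a : ℕ) < t → y a = x a
    · rw [if_pos h, if_pos h, ← mul_assoc, ← Finset.mul_prod_erase _ _ (Finset.mem_univ t), if_pos le_rfl,
        ← Finset.mul_prod_erase _ (fun r : Fin n => if (t : ℕ) + 1 ≤ r then _ else _) (Finset.mem_univ t),
        if_neg (by omega), one_mul]
      congr 1
      · rw [hadamard_eq, ← cis_sum, mul_left_comm, ← cis_add]
        congr 2
        rw [← Finset.sum_filter]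
        have hs : Finset.univ.filter (fun a : Fin n => (a : ℕ) ≤ t) =
            insert t (Finset.univ.filter (· < t)) := by
          ext a
          simp only [Finset.mem_filter, Finset.mem_univ, true_and, Finset.mem_insert]
          rw [Fin.ext_iff, Fin.lt_def]; omega
        rw [hs, Finset.sum_insert (by simp), mul_add, add_div, add_comm, Finset.mul_sum,
          Finset.sum_div]
        congr 1
        · refine Finset.sum_congr rfl fun a ha => ?_
          rw [h a (by simpa using ha)]
        · rw [pow_succ]
          field_simp
      · refine Finset.prod_congr rfl fun r hr => ?_
        have hr' : r ≠ t := Finset.ne_of_mem_erase hr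
        have : (r : ℕ) ≠ t := fun h => hr' (Fin.ext h)
        rw [Function.update_of_ne hr']
        exact if_congr (by omega) rfl rfl
    · rw [if_neg h, if_neg h]
      simp
  · intro b _ hb
    simp only [fourierPart, of_apply]
    rw [if_neg, mul_zero]
    intro h
    exact hb (by simpa using h t (by omega))
  · simp

theorem impl_fourierPhases {n : ℕ} (t : Fin n) :
    Impl (diagonal (fun y : Bits (Fin n) => ∏ a ∈ Finset.univ.filter (· < t),
      cis ((y t : ℕ) * ((y a : ℝ) * 2 ^ (a : ℕ)) / 2 ^ ((t : ℕ) + 1)))) n := by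
  have h : ∀ a ∈ Finset.univ.filter (· < t), Impl (diagonal fun y : Bits (Fin n) =>
      cis ((y t : ℕ) * ((y a : ℝ) * 2 ^ (a : ℕ)) / 2 ^ ((t : ℕ) + 1))) 1 := by
    intro a ha
    have hat : a ≠ t := (Finset.mem_filter.1 ha).2.ne
    let φ : Fin 2 → Fin 2 → ℂ :=
      fun p q => cis ((q : ℕ) * ((p : ℝ) * 2 ^ (a : ℕ)) / 2 ^ ((t : ℕ) + 1))
    have hφ : ∀ p q, ‖φ p q‖ = 1 := fun p q => norm_cis _
    have h := impl_ctrlPhase hat hφ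
    simp only [φ] at h
    exact h
  have h3 : (Finset.univ.filter (· < t)).card ≤ n := by
    simpa using Finset.card_le_univ (Finset.univ.filter (· < t))
  exact (Impl.diagonal_prod _ h).mono (by rwa [mul_one])

theorem impl_fourierPart_step {n k : ℕ} (t : Fin n) (h : Impl (fourierPart n (t + 1)) k) :
    Impl (fourierPart n t) (n + (1 + k)) := by
  rw [fourierPart_step]
  exact Impl.mul (impl_fourierPhases t) (Impl.mul (isGate_layer t hadamard_unitary).impl h)

theorem impl_fourierPart (n k : ℕ) (hk : k ≤ n) : Impl (fourierPart n (n - k)) (k * (n + 1)) := by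
  induction k with
  | zero => simpa [fourierPart_self] using Impl.one
  | succ k ih =>
    have h1 : n - (k + 1) + 1 = n - k := by omega
    have h := impl_fourierPart_step (⟨n - (k + 1), by omega⟩ : Fin n) (k := k * (n + 1))
      (by simp only [h1]; exact ih (by omega))
    exact h.mono (by ring_nf; rfl)

/-- The output appears with its digits reversed. The input digits a > r, absent from the phase of
qubit r, would contribute only integers to the exponent. -/
theorem fourierPart_zero {n : ℕ} (y x : Bits (Fin n)) :
    fourierPart n 0 y x = fourier n (y ∘ Fin.rev) x := by
  simp only [fourierPart, fourier, of_apply, Nat.not_lt_zero, false_imp_iff, implies_true, if_true,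
    Nat.zero_le]
  rw [Finset.prod_mul_distrib, Finset.prod_const, Finset.card_univ, Fintype.card_fin]
  congr 1
  have h1 : ((val (y ∘ Fin.rev) : ℕ) : ℝ) / 2 ^ n = ∑ r : Fin n, ((y r : ℕ) : ℝ) / 2 ^ ((r : ℕ) + 1) := by
    rw [val_eq, ← Equiv.sum_comp Fin.revPerm]
    push_cast
    rw [Finset.sum_div]
    refine Finset.sum_congr rfl fun r _ => ?_
    simp only [Function.comp, Fin.revPerm_apply, Fin.rev_rev, Fin.val_rev]
    rw [div_eq_div_iff (by positivity) (by positivity), mul_assoc, ← pow_add]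
    congr 2
    omega
  rw [mul_div_right_comm, h1, Finset.sum_mul, cis_sum]
  refine Finset.prod_congr rfl fun r _ => ?_
  symm
  refine cis_eq_of_sub_int ((y r : ℕ) * ∑ a : Fin n, if (a : ℕ) ≤ r then 0 else (x a : ℕ) * 2 ^ ((a : ℕ) - (r + 1))) ?_
  rw [val_eq]
  push_cast
  rw [div_mul_eq_mul_div, mul_div_assoc, mul_div_assoc, ← mul_add, Finset.sum_div, Finset.sum_div,
    ← Finset.sum_add_distrib]
  congr 1
  refine Finset.sum_congr rfl fun a _ => ?_
  split_ifs with h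
  · simp
  · rw [zero_div, zero_add, div_eq_iff (by positivity), mul_assoc, ← pow_add]
    congr 2
    omega

theorem impl_fourier (n : ℕ) : Impl (fourier n) (n ^ 2 + 5 * n) := by
  have h1 : Impl (pm fun x : Bits (Fin n) => x ∘ Fin.rev) (n + n + 2 * n) := by
    have h : Comp (fun x : Bits (Fin n) => x ∘ Fin.rev) n := by
      have := Comp.reindex (ι := Fin n) (κ := Fin n) Fin.rev
      rw [Fintype.card_fin] at this
      exact this
    simpa using h.impl_pm h fun x => by ext i; simp
  have h2 := impl_fourierPart n n le_rfl
  rw [Nat.sub_self] at h2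
  refine Impl.mono ?_ (by nlinarith : (n + n + 2 * n) + n * (n + 1) ≤ n ^ 2 + 5 * n)
  convert h1.mul h2 using 1
  ext y x
  rw [Matrix.mul_apply, Finset.sum_eq_single (y ∘ Fin.rev)]
  · rw [fourierPart_zero, pm, of_apply, if_pos, one_mul]
    · congr 1; ext i; simp
    · ext i; simp
  · intro z _ hz
    rw [pm, of_apply, if_neg, zero_mul]
    rintro rfl
    exact hz (by ext i; simp)
  · simp

end QFT

end Qubit

/-! ### Affine integer arithmetic by addition in the Fourier basis -/

namespace Qubit

open Matrix

section Adder

variable {ι : Type} [Fintype ι] [DecidableEq ι]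

/-- The binary digits of `z` modulo `2 ^ M`. -/
def bitsOf (M : ℕ) (z : ℤ) : Bits (Fin M) := finFunctionFinEquiv.symm (WaveAtom.freqIndex M z)

theorem val_bitsOf (M : ℕ) (z : ℤ) : (val (bitsOf M z) : ℤ) = z % 2 ^ M := by
  rw [val, bitsOf, Equiv.apply_symm_apply, WaveAtom.freqIndex]
  exact Int.toNat_of_nonneg (Int.emod_nonneg z (by positivity))

theorem val_injective {M : ℕ} : Function.Injective (val : Bits (Fin M) → ℕ) := fun _ _ h =>
  finFunctionFinEquiv.injective (Fin.ext h)

theorem eq_bitsOf {M : ℕ} {x : Bits (Fin M)} {z : ℤ} (h : (val x : ℤ) = z % 2 ^ M) :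
    bitsOf M z = x := by
  apply val_injective
  have := val_bitsOf M z
  omega

theorem bitsOf_val {M : ℕ} (x : Bits (Fin M)) : bitsOf M (val x) = x :=
  eq_bitsOf (Int.emod_eq_of_lt (by positivity) (by exact_mod_cast val_lt x)).symm

/-- An affine function of bits. -/
def affine (w : ι → ℤ) (c : ℤ) (x : Bits ι) : ℤ := c + ∑ a, w a * (x a : ℕ)

/-- `(x, y) ↦ (x, y + c + ∑ a, w a * x a)`, modulo `2 ^ M`. -/
def addMap (M : ℕ) (w : ι → ℤ) (c : ℤ) (s : Bits (ι ⊕ Fin M)) : Bits (ι ⊕ Fin M) :=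
  Sum.elim (s ∘ Sum.inl) (bitsOf M (val (s ∘ Sum.inr) + affine w c (s ∘ Sum.inl)))

/-- The exponent is linear in the digits of the second register and affine in the bits of the first,
so it is a sum of terms in at most one digit and one bit. -/
theorem impl_addPhases (M : ℕ) (w : ι → ℤ) (c : ℤ) :
    Impl (diagonal fun s : Bits (ι ⊕ Fin M) =>
      cis (val (s ∘ Sum.inr) * affine w c (s ∘ Sum.inl) / 2 ^ M))
      (M + Fintype.card ι * M) := by
  have h1 : ∀ r ∈ (Finset.univ : Finset (Fin M)), Impl (diagonal fun s : Bits (ι ⊕ Fin M) =>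
      cis (c * ((s (Sum.inr r) : ℕ) * 2 ^ (r : ℕ)) / 2 ^ M)) 1 := by
    intro r _
    let φ : Fin 2 → ℂ := fun p => cis (c * ((p : ℕ) * 2 ^ (r : ℕ)) / 2 ^ M)
    have hφ : ∀ p, ‖φ p‖ = 1 := fun p => norm_cis _
    have h := impl_phase (Sum.inr r : ι ⊕ Fin M) hφ
    simp only [φ] at h
    exact h
  have h2 : ∀ q ∈ (Finset.univ : Finset (ι × Fin M)), Impl (diagonal fun s : Bits (ι ⊕ Fin M) =>
      cis (w q.1 * (s (Sum.inl q.1) : ℕ) * ((s (Sum.inr q.2) : ℕ) * 2 ^ (q.2 : ℕ)) / 2 ^ M)) 1 := by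
    intro q _
    let φ : Fin 2 → Fin 2 → ℂ :=
      fun p p' => cis (w q.1 * (p : ℕ) * ((p' : ℕ) * 2 ^ (q.2 : ℕ)) / 2 ^ M)
    have hφ : ∀ p p', ‖φ p p'‖ = 1 := fun p p' => norm_cis _
    have hne : (Sum.inl q.1 : ι ⊕ Fin M) ≠ Sum.inr q.2 := by simp
    have h := impl_ctrlPhase hne hφ
    simp only [φ] at h
    exact h
  have h := (Impl.diagonal_prod _ h1).diagonal_mul (Impl.diagonal_prod _ h2)
  rw [Finset.card_univ, Finset.card_univ, Fintype.card_fin, Fintype.card_prod, Fintype.card_fin,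
    mul_one, mul_one] at h
  convert h using 3 with s
  rw [← cis_sum, ← cis_sum, ← cis_add]
  congr 1
  rw [val_eq, affine, Fintype.sum_prod_type]
  push_cast
  rw [mul_add, add_div, Finset.sum_mul_sum, Finset.sum_comm, Finset.sum_mul, Finset.sum_div]
  congr 1
  · refine Finset.sum_congr rfl fun r _ => ?_
    simp only [Function.comp]
    ring
  · simp only [Finset.sum_div]
    refine Finset.sum_congr rfl fun a _ => Finset.sum_congr rfl fun r _ => ?_
    simp only [Function.comp]
    ring

/-- The Fourier transform diagonalizes translations modulo 2^M. The identity `key` says that phases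
after the transform equal a translation before it; multiplying by the adjoint transform leaves the
translation. -/
theorem impl_addMap (M : ℕ) (w : ι → ℤ) (c : ℤ) :
    Impl (pm (addMap M w c)) (2 * (M ^ 2 + 5 * M) + (M + Fintype.card ι * M)) := by
  have hF := (impl_fourier M).lift (Function.Embedding.inr : Fin M ↪ ι ⊕ Fin M)
  have hu : (lift (Function.Embedding.inr : Fin M ↪ ι ⊕ Fin M) (fourier M))ᴴ *
      lift (Function.Embedding.inr : Fin M ↪ ι ⊕ Fin M) (fourier M) = 1 := hF.unitary
  have h := hF.conjTranspose.mul ((impl_addPhases M w c).mul hF)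
  refine Impl.mono ?_ (show (M ^ 2 + 5 * M) + ((M + Fintype.card ι * M) + (M ^ 2 + 5 * M)) ≤ _ by
    omega)
  convert h using 1
  have key : diagonal (fun s : Bits (ι ⊕ Fin M) =>
      cis (val (s ∘ Sum.inr) * affine w c (s ∘ Sum.inl) / 2 ^ M)) *
      lift (Function.Embedding.inr : Fin M ↪ ι ⊕ Fin M) (fourier M) =
      lift (Function.Embedding.inr : Fin M ↪ ι ⊕ Fin M) (fourier M) * pm (addMap M w c) := by
    refine op_ext fun s => ?_
    obtain ⟨x, y, rfl⟩ : ∃ x y, s = Sum.elim x y := ⟨_, _, (Sum.elim_comp_inl_inr s).symm⟩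
    rw [← mulVec_mulVec, ← mulVec_mulVec, pm_mulVec_ket, lift_mulVec_ket, lift_mulVec_ket,
      mulVec_ket, mulVec_ket, splice_apply, splice_apply]
    simp only [mulVec_sum, mulVec_smul, extend_inr, diagonal_mulVec_ket, addMap,
      Sum.elim_comp_inl, Sum.elim_comp_inr, smul_smul]
    refine Finset.sum_congr rfl fun k _ => ?_
    congr 1
    rw [fourier, of_apply, of_apply, mul_assoc, ← cis_add]
    congr 1
    change cis (val k * val y / 2 ^ M + _) = cis (val k * val (bitsOf M (val y + affine w c x)) / 2 ^ M)
    have h1 := val_bitsOf M (val y + affine w c x)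
    have h2 := Int.emod_add_mul_ediv (val y + affine w c x) (2 ^ M)
    rw [← h1] at h2
    refine cis_eq_of_sub_int (val k * ((val y + affine w c x) / 2 ^ M)) ?_
    have h3 : ((val (bitsOf M (val y + affine w c x)) : ℝ) + 2 ^ M *
      (((val y + affine w c x) / 2 ^ M : ℤ) : ℝ)) = val y + affine w c x := by exact_mod_cast h2
    rw [Int.cast_mul, Int.cast_natCast]
    field_simp
    linear_combination (-(val k : ℝ)) * h3
  rw [key, ← Matrix.mul_assoc, hu, Matrix.one_mul]

/-- Add the value to a scratch register holding 0, copy it to the output, then subtract it from the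
scratch register. -/
theorem comp_affine (M : ℕ) (w : ι → ℤ) (c : ℤ) :
    Comp (fun x : Bits ι => bitsOf M (affine w c x))
      (4 * (M ^ 2 + 5 * M) + 2 * (M + Fintype.card ι * M) + M) := by
  let e : ι ⊕ Fin M ↪ (ι ⊕ Fin M) ⊕ Fin M := ⟨Sum.elim (Sum.inl ∘ Sum.inl) Sum.inr, by
    rintro (i | i) (j | j) h <;> simp_all⟩
  have h1 := (impl_addMap M w c).pm_lift e
  have h3 := (impl_addMap M (fun a => - w a) (-c)).pm_lift e
  have hid : Comp (fun x : Bits (Fin M) => x) M := by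
    simpa using Comp.reindex (id : Fin M → Fin M)
  have h2 := hid.impl_xorInto (Function.Embedding.inr : _ ↪ (ι ⊕ Fin M) ⊕ Fin M)
    (Function.Embedding.inr.trans Function.Embedding.inl) (by simp)
  refine Impl.mono (Impl.pm_ancilla (h3.pm_comp (h2.pm_comp h1)) fun s => ?_) (show
    (2 * (M ^ 2 + 5 * M) + (M + Fintype.card ι * M)) + (M +
      (2 * (M ^ 2 + 5 * M) + (M + Fintype.card ι * M))) ≤ _ by omega)
  obtain ⟨x, y, rfl⟩ : ∃ x y, s = Sum.elim x y := ⟨_, _, (Sum.elim_comp_inl_inr s).symm⟩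
  have e2 : ∀ y z, (Sum.elim (Sum.elim x y) z : Bits ((ι ⊕ Fin M) ⊕ Fin M)) ∘ e = Sum.elim x z := by
    intro y z; ext (i | i) <;> rfl
  have e1 : ∀ w c y z, liftFun e (addMap M w c) (Sum.elim (Sum.elim x y) z) =
      Sum.elim (Sum.elim x y) (bitsOf M (val z + affine w c x)) := by
    intro w c y z
    rw [liftFun, e2, addMap]
    refine extend_eq e (by rintro (i | i) <;> rfl) ?_
    rintro ((i | i) | i) hi
    exacts [rfl, rfl, absurd rfl (hi (Sum.inr i))]
  have e3 : ∀ y z, xorInto Function.Embedding.inr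
      (Function.Embedding.inr.trans Function.Embedding.inl) (fun x => x)
      (Sum.elim (Sum.elim x y) z : Bits ((ι ⊕ Fin M) ⊕ Fin M)) = Sum.elim (Sum.elim x (y + z)) z := by
    intro y z
    refine extend_eq _ (fun _ => rfl) ?_
    rintro ((i | i) | i) hi
    exacts [rfl, absurd rfl (hi i), rfl]
  simp only [Function.comp_apply, e1, e3]
  have hv0 : val (0 : Bits (Fin M)) = 0 := by rw [val_eq]; simp
  have hneg : affine (fun a => -w a) (-c) x = - affine w c x := by
    simp only [affine, neg_mul, Finset.sum_neg_distrib]; ring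
  have h0 : bitsOf M (val (bitsOf M (val (0 : Bits (Fin M)) + affine w c x)) +
      affine (fun a => -w a) (-c) x) = 0 := by
    refine eq_bitsOf ?_
    rw [hv0, val_bitsOf, hneg, Nat.cast_zero, zero_add, Int.emod_add_emod, add_neg_cancel,
      Int.zero_emod]
  rw [h0, hv0, Nat.cast_zero, zero_add]
  simp only [xorMap, Sum.elim_comp_inl, Sum.elim_comp_inr]

end Adder

theorem sqrt_two_pow (L : ℕ) : Real.sqrt (2 ^ L) = Real.sqrt 2 ^ L := by
  rw [Real.sqrt_eq_iff_eq_sq (by positivity) (by positivity), ← pow_mul, mul_comm, pow_mul,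
    Real.sq_sqrt (by norm_num)]

theorem onQubits_qft (L : ℕ) : onQubits (WaveAtom.qft L) = fourier L := by
  ext y x
  simp only [onQubits, WaveAtom.qft, fourier, submatrix_apply, of_apply, cis]
  congr 1
  · rw [← Complex.ofReal_pow, div_pow, one_pow]
    congr 2
    exact sqrt_two_pow L
  · congr 1
    change 2 * Real.pi * Complex.I * (val x) * (val y) / 2 ^ L = _
    push_cast
    ring

end Qubit

/-! ### Frequency decoding in binary digits -/

namespace Qubit

open Matrix

section Digits

variable {n : ℕ}

theorem digit_eq (x : Bits (Fin n)) (i : Fin n) : (x i : ℕ) = val x / 2 ^ (i : ℕ) % 2 := by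
  conv_lhs => rw [← finFunctionFinEquiv.symm_apply_apply x]
  rfl

theorem testBit_val (x : Bits (Fin n)) (k : ℕ) :
    (val x).testBit k = if h : k < n then decide (x ⟨k, h⟩ = 1) else false := by
  split_ifs with h
  · rw [Nat.testBit_eq_decide_div_mod_eq]
    have := digit_eq x ⟨k, h⟩
    simp only at this
    rw [← this]
    congr 1
    rw [Fin.ext_iff]; rfl
  · exact Nat.testBit_lt_two_pow ((val_lt x).trans_le (Nat.pow_le_pow_right (by norm_num) (by omega)))

theorem fin_two_ext {a b : Fin 2} (h : a = 1 ↔ b = 1) : a = b := by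
  revert a b; decide

theorem val_shift (s : ℕ) (x : Bits (Fin n)) :
    val (fun t : Fin n => if s ≤ (t : ℕ) then x ⟨t - s, by omega⟩ else 0) =
      2 ^ s * val x % 2 ^ n := by
  refine Nat.eq_of_testBit_eq fun k => ?_
  rw [Nat.testBit_mod_two_pow, Nat.testBit_two_pow_mul, testBit_val, testBit_val]
  by_cases h1 : k < n
  · by_cases h2 : s ≤ k
    · have h3 : k - s < n := by omega
      simp [h1, h2, h3]
    · simp [h1, h2]
  · simp [h1]

theorem val_low (j : ℕ) (x : Bits (Fin n)) :
    val (fun t : Fin n => if (t : ℕ) < j then x t else 0) = val x % 2 ^ j := by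
  refine Nat.eq_of_testBit_eq fun k => ?_
  rw [Nat.testBit_mod_two_pow, testBit_val, testBit_val]
  by_cases h1 : k < n <;> by_cases h2 : k < j <;> simp [h1, h2]

theorem div_two_pow_eq {j : ℕ} {x y : Bits (Fin n)} (h : ∀ i : Fin n, j ≤ (i : ℕ) → x i = y i) :
    val x / 2 ^ j = val y / 2 ^ j := by
  refine Nat.eq_of_testBit_eq fun k => ?_
  rw [Nat.testBit_div_two_pow, Nat.testBit_div_two_pow, testBit_val, testBit_val]
  by_cases h1 : k + j < n
  · simp [h1, h ⟨k + j, h1⟩ (by simp)]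
  · simp [h1]

/-- The index of a frequency, computed on binary digits. -/
def decodeBits (x : Bits (Fin n)) : Bits (Fin n) := fun k =>
  if h : (k : ℕ) + 1 < n then x ⟨k + 1, h⟩ + x ⟨0, k.pos⟩ else x ⟨0, k.pos⟩

/-- The inverse of `decodeBits`. -/
def encodeBits (r : Bits (Fin n)) : Bits (Fin n) := fun k =>
  if (k : ℕ) = 0 then r ⟨n - 1, Nat.sub_lt k.pos one_pos⟩
  else r ⟨k - 1, (Nat.sub_le _ _).trans_lt k.isLt⟩ + r ⟨n - 1, Nat.sub_lt k.pos one_pos⟩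

theorem encodeBits_decodeBits (x : Bits (Fin n)) : encodeBits (decodeBits x) = x := by
  ext k
  have hk := k.isLt
  have h2 : ¬ (n - 1 + 1 < n) := by omega
  simp only [encodeBits, decodeBits, h2, dif_neg, not_false_eq_true]
  by_cases h : (k : ℕ) = 0
  · rw [if_pos h]
    congr 2; exact Fin.ext h.symm
  · have h3 : (k : ℕ) - 1 + 1 < n := by omega
    rw [if_neg h, dif_pos h3, add_assoc, fin_two_add_self, add_zero]
    congr 2; apply Fin.ext; simp only; omega

theorem decodeBits_encodeBits (x : Bits (Fin n)) : decodeBits (encodeBits x) = x := by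
  ext k
  have hk := k.isLt
  simp only [encodeBits, decodeBits]
  by_cases h : (k : ℕ) + 1 < n
  · rw [dif_pos h]
    simp only [Nat.add_eq_zero_iff, one_ne_zero, and_false, if_false, if_true, Nat.add_sub_cancel,
      add_assoc, fin_two_add_self, add_zero]
  · rw [dif_neg h]
    simp only [if_true]
    congr 2; apply Fin.ext; simp only; omega

/-- The digit `x 0` is the sign. With q the number formed by the other digits, the frequency is q if
`x 0` = 0 and -(q + 1) otherwise; in two's complement -(q + 1) is the digitwise complement of q,
which explains the addition of `x 0` to every digit. -/
theorem val_decodeBits (x : Bits (Fin n)) :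
    (val (decodeBits x) : ℤ) = WaveAtom.freqDecode (val x) % 2 ^ n := by
  rcases n with _ | n
  · simp [val_eq]
  · have h1 : val x = (x 0 : ℕ) + 2 * ∑ k : Fin n, (x k.succ : ℕ) * 2 ^ (k : ℕ) := by
      rw [val_eq, Fin.sum_univ_succ, Finset.mul_sum]
      simp only [Fin.val_zero, pow_zero, mul_one, Fin.val_succ]
      congr 1
      exact Finset.sum_congr rfl fun k _ => by ring
    have h2 : val (decodeBits x) =
        ∑ k : Fin n, ((x k.succ + x 0 : Fin 2) : ℕ) * 2 ^ (k : ℕ) + (x 0 : ℕ) * 2 ^ n := by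
      rw [val_eq, Fin.sum_univ_castSucc]
      congr 1
      · refine Finset.sum_congr rfl fun k _ => ?_
        simp only [decodeBits, Fin.val_castSucc]
        rw [dif_pos (by omega)]
        rfl
      · simp only [decodeBits, Fin.val_last]
        rw [dif_neg (by omega)]
        rfl
    have hlt := val_lt (decodeBits x)
    set q := ∑ k : Fin n, (x k.succ : ℕ) * 2 ^ (k : ℕ) with hq
    rw [WaveAtom.freqDecode, h1]
    rcases (by omega : (x 0 : ℕ) = 0 ∨ (x 0 : ℕ) = 1) with h0 | h0
    · have hx : x 0 = 0 := Fin.ext h0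
      simp only [hx, add_zero] at h2
      rw [h0, if_pos (by simp)]
      have h3 : (0 + 2 * q) / 2 = q := by omega
      have h4 : val (decodeBits x) = q := by rw [h2]; simp [hq]
      rw [h3, ← h4]
      exact (Int.emod_eq_of_lt (by positivity) (by exact_mod_cast hlt)).symm
    · have hx : x 0 = 1 := Fin.ext h0
      simp only [hx] at h2
      rw [h0, if_neg (by simp [parity_simps])]
      have h3 : (1 + 2 * q + 1) / 2 = q + 1 := by omega
      have h5 : ∑ k : Fin n, ((x k.succ + 1 : Fin 2) : ℕ) * 2 ^ (k : ℕ) + q = 2 ^ n - 1 := by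
        rw [hq, ← Finset.sum_add_distrib]
        have : ∀ k : Fin n, ((x k.succ + 1 : Fin 2) : ℕ) * 2 ^ (k : ℕ) + (x k.succ : ℕ) * 2 ^ (k : ℕ) =
            2 ^ (k : ℕ) := by
          intro k
          generalize x k.succ = a
          fin_cases a <;> simp
        simp only [this]
        rw [Fin.sum_univ_eq_sum_range (fun k => 2 ^ k) n, Nat.geomSum_eq (by norm_num)]
        simp
      have hp : 0 < 2 ^ n := by positivity
      have h6 : val (decodeBits x) + (q + 1) = 2 ^ (n + 1) := by
        rw [h2, pow_succ]
        simp only [Fin.val_one, one_mul] 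
        omega
      rw [h3]
      have h7 : (-((q + 1 : ℕ) : ℤ)) = val (decodeBits x) - 2 ^ (n + 1) := by
        have : ((val (decodeBits x) + (q + 1) : ℕ) : ℤ) = 2 ^ (n + 1) := by rw [h6]; push_cast; rfl
        push_cast at this ⊢
        linarith
      rw [h7, Int.sub_emod_right]
      exact (Int.emod_eq_of_lt (by positivity) (by exact_mod_cast hlt)).symm

theorem decodeBits_eq (x : Bits (Fin n)) :
    decodeBits x = bitsOf n (WaveAtom.freqDecode (val x)) := (eq_bitsOf (val_decodeBits x)).symm

theorem comp_decodeBits : Comp (decodeBits (n := n)) (2 * n) := by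
  have h : ∀ k : Fin n, CompBit (fun x => decodeBits x k) 2 := by
    intro k
    unfold decodeBits
    split_ifs
    · exact (CompBit.bit _).add (CompBit.bit _)
    · exact (CompBit.bit _).mono (by norm_num)
  have := Comp.pi h
  rwa [Fintype.card_fin, mul_comm] at this

theorem comp_encodeBits : Comp (encodeBits (n := n)) (2 * n) := by
  have h : ∀ k : Fin n, CompBit (fun x => encodeBits x k) 2 := by
    intro k
    unfold encodeBits
    split_ifs
    · exact (CompBit.bit _).mono (by norm_num)
    · exact (CompBit.bit _).add (CompBit.bit _)
  have := Comp.pi h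
  rwa [Fintype.card_fin, mul_comm] at this

theorem impl_encodeBits : Impl (pm (encodeBits (n := n))) (6 * n) := by
  have := comp_encodeBits.impl_pm comp_decodeBits (decodeBits_encodeBits (n := n))
  rw [Fintype.card_fin] at this
  exact this.mono (by omega)

end Digits

/-- The matrix of the decoded Fourier transform. -/
theorem impl_fourierDecoded (L : ℕ) :
    Impl (onQubits (WaveAtom.fourierDecoded L)) (L ^ 2 + 11 * L) := by
  have h1 := (impl_encodeBits (n := L)).mul (impl_fourier L).conjTranspose
  refine Impl.mono ?_ (by omega : 6 * L + (L ^ 2 + 5 * L) ≤ L ^ 2 + 11 * L)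
  convert h1 using 1
  ext y x
  -- Row y of the product is row `decodeBits y` of the adjoint Fourier matrix, because `encodeBits`
  -- inverts `decodeBits`.
  rw [Matrix.mul_apply, Finset.sum_eq_single (decodeBits y)]
  · rw [pm, of_apply, if_pos (encodeBits_decodeBits y).symm, one_mul, ← onQubits_qft, onQubits,
      onQubits, submatrix_apply, WaveAtom.fourierDecoded, of_apply, conjTranspose_submatrix,
      submatrix_apply, decodeBits_eq, bitsOf, Equiv.apply_symm_apply]
    rfl
  · intro z _ hz
    rw [pm, of_apply, if_neg, zero_mul]
    rintro rfl
    exact hz (decodeBits_encodeBits z).symm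
  · simp

end Qubit

/-! ### Levels of leaves -/

namespace WaveletTree

theorem level_bounds {j : ℕ} (T : WaveletTree j) (m : ℕ) (q : ℕ × ℕ) (hq : q ∈ T.leavesFrom m) :
    1 ≤ q.1 ∧ q.1 ≤ j := by
  induction T generalizing m with
  | leaf hj =>
    simp only [leavesFrom, List.mem_singleton] at hq
    subst hq
    exact ⟨hj, le_rfl⟩
  | @node j l r ihl ihr =>
    simp only [leavesFrom, List.mem_append] at hq
    rcases hq with hq | hq
    · exact ⟨(ihl _ hq).1, (ihl _ hq).2.trans (Nat.le_succ j)⟩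
    · exact ⟨(ihr _ hq).1, (ihr _ hq).2.trans (Nat.le_succ j)⟩

variable {L : ℕ} (T : WaveletTree L)

theorem leafAt_div {p : ℕ} (hp : p < 2 ^ L) : p / 2 ^ (T.leafAt p).1 = (T.leafAt p).2 := by
  obtain ⟨-, h1, h2⟩ := T.leafAt_spec p hp
  exact Nat.div_eq_of_lt_le h1 h2

theorem leafAt_eq_of_div {q : ℕ × ℕ} (hq : q ∈ T.leaves) {p : ℕ} (h : p / 2 ^ q.1 = q.2) :
    T.leafAt p = q := by
  refine leafFrom_eq T 0 q hq p ?_ ?_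
  · rw [← h]; exact Nat.div_mul_le_self p _
  · rw [← h]
    exact Nat.lt_mul_of_div_lt (Nat.lt_succ_self _) (by positivity)

/-- The helper operator provides the comparisons with the levels 1, …, L - 1 only. The missing one,
with L, does not depend on the index: either the root is the only leaf or no leaf has level L. -/
theorem root_level : (∀ p, p < 2 ^ L → L ≤ (T.leafAt p).1) ∨
    (∀ p, p < 2 ^ L → ¬ L ≤ (T.leafAt p).1) := by
  cases T with
  | leaf hj => exact Or.inl fun p _ => le_rfl
  | @node j l r =>
    refine Or.inr fun p hp => ?_
    have h := ((node l r).leafAt_spec p hp).1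
    simp only [leaves, leavesFrom, List.mem_append] at h
    rcases h with h | h
    · have := (level_bounds _ _ _ h).2
      omega
    · have := (level_bounds _ _ _ h).2
      omega

end WaveletTree

/-! ### Level, offset and shifted frequency as functions on bits -/

namespace Qubit

open Matrix

section Level

variable {L : ℕ} (T : WaveletTree L)

/-- The leaf whose block contains the index with binary digits `x`. -/
def leafOf (x : Bits (Fin L)) : ℕ × ℕ := T.leafAt (val x)

theorem leafOf_mem (x : Bits (Fin L)) : leafOf T x ∈ T.leaves := (T.leafAt_spec _ (val_lt x)).1

theorem one_le_level (x : Bits (Fin L)) : 1 ≤ (leafOf T x).1 :=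
  (WaveletTree.level_bounds T 0 _ (leafOf_mem T x)).1

theorem level_le (x : Bits (Fin L)) : (leafOf T x).1 ≤ L :=
  (WaveletTree.level_bounds T 0 _ (leafOf_mem T x)).2

theorem val_div_level (x : Bits (Fin L)) : val x / 2 ^ (leafOf T x).1 = (leafOf T x).2 :=
  T.leafAt_div (val_lt x)

/-- Blocks of leaves are dyadic intervals, so the digits from the level upwards determine the leaf.
This is why the level can be recomputed from `highBits` once the low digits have been erased or
transformed. -/
theorem leafOf_eq_of_high {x y : Bits (Fin L)}
    (h : ∀ i : Fin L, (leafOf T x).1 ≤ (i : ℕ) → y i = x i) : leafOf T y = leafOf T x := by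
  refine T.leafAt_eq_of_div (leafOf_mem T x) ?_
  rw [div_two_pow_eq h, val_div_level]

/-- The unary digits of the level. -/
def unaryLevel (x : Bits (Fin L)) : Bits (Fin L) := fun i => if (i : ℕ) < (leafOf T x).1 then 1 else 0

/-- The one-hot encoding of the level. -/
def oneHotLevel (x : Bits (Fin L)) : Bits (Fin L) :=
  fun i => if (i : ℕ) + 1 = (leafOf T x).1 then 1 else 0

/-- Both encodings of the level. -/
def levelBits (x : Bits (Fin L)) : Bits (Fin L ⊕ Fin L) :=
  Sum.elim (unaryLevel T x) (oneHotLevel T x)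

theorem comp_helper {k : ℕ} (h : ImplementableWith T.helperOperator k) :
    Comp (fun (x : Bits (Fin L)) (i : Fin (L - 1)) => T.helper ((i : ℕ) + 1) (val x)) k := by
  have h1 : Impl (pm T.helperMap) k := impl_of_implementableWith h
  have h2 := h1.pm_lift (finSumFinEquiv (m := L) (n := L - 1)).symm.toEmbedding
  unfold Comp
  convert h2 using 2
  ext s : 1
  obtain ⟨x, y, rfl⟩ : ∃ x y, s = Sum.elim x y := ⟨_, _, (Sum.elim_comp_inl_inr s).symm⟩
  symm
  refine extend_eq _ ?_ ?_
  · intro i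
    change xorMap _ (Sum.elim x y) (finSumFinEquiv.symm i) =
      T.helperMap ((Sum.elim x y) ∘ finSumFinEquiv.symm) i
    rw [append_comp_symm, WaveletTree.helperMap]
    simp only [Fin.append_left, Fin.append_right]
    rw [← append_comp_symm]
    rfl
  · intro i hi
    exact absurd (finSumFinEquiv.symm.apply_symm_apply i) (hi _)

theorem comp_unaryLevel {k : ℕ} (h : ImplementableWith T.helperOperator k) :
    Comp (unaryLevel T) (2 * k + L) := by
  obtain ⟨c, hc⟩ : ∃ c : Fin 2, ∀ x : Bits (Fin L), (if L ≤ (leafOf T x).1 then 1 else 0) = c := by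
    rcases T.root_level with h | h
    · exact ⟨1, fun x => if_pos (h _ (val_lt x))⟩
    · exact ⟨0, fun x => if_neg (h _ (val_lt x))⟩
  let g : Bits (Fin (L - 1)) → Bits (Fin L) := fun y i =>
    if h : (i : ℕ) < L - 1 then y ⟨i, h⟩ else c
  have hg : Comp g L := by
    have : ∀ i, CompBit (fun y => g y i) 1 := by
      intro i
      simp only [g]
      split_ifs
      · exact CompBit.bit _
      · exact CompBit.const _
    simpa using Comp.pi this
  convert hg.comp (comp_helper T h) using 1
  ext x i
  have hl : (T.leafAt (val x)).1 = (leafOf T x).1 := rfl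
  simp only [g, unaryLevel, WaveletTree.helper, hl]
  split_ifs with h1 h2 h3
  · rfl
  · exact absurd h1 h3
  · rw [← hc x, if_pos]
    omega
  · omega
  · rfl
  · rw [← hc x, if_neg]
    omega

theorem comp_levelBits {k : ℕ} (h : ImplementableWith T.helperOperator k) :
    Comp (levelBits T) (4 * k + 5 * L) := by
  let g : Bits (Fin L) → Bits (Fin L) := fun u i =>
    u i + if h : (i : ℕ) + 1 < L then u ⟨i + 1, h⟩ else 0
  have hg : Comp g (L * 2) := by
    have : ∀ i, CompBit (fun y => g y i) 2 := by
      intro i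
      simp only [g]
      split_ifs
      · exact (CompBit.bit _).add (CompBit.bit _)
      · exact (CompBit.bit _).add (CompBit.const _)
    simpa using Comp.pi this
  have hid : Comp (fun x : Bits (Fin L) => x) L := by
    simpa using Comp.reindex (id : Fin L → Fin L)
  have h1 := (hid.pair hg).comp (comp_unaryLevel T h)
  refine (Comp.mono ?_ (by omega : 2 * (2 * k + L) + (L + L * 2) ≤ 4 * k + 5 * L))
  convert h1 using 1
  ext x : 1
  rw [levelBits]
  congr 1
  ext i
  have h2 := level_le T x
  simp only [g, oneHotLevel, unaryLevel]
  split_ifs <;> first | rfl | omega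

/-- The digits of an index above the level of its leaf. -/
def highBits (x : Bits (Fin L)) : Bits (Fin L) := fun i => x i + unaryLevel T x i * x i

/-- The digits of an index below the level of its leaf. -/
def lowBits (x : Bits (Fin L)) : Bits (Fin L) := fun i => unaryLevel T x i * x i

theorem lowBits_apply (x : Bits (Fin L)) (i : Fin L) :
    lowBits T x i = if (i : ℕ) < (leafOf T x).1 then x i else 0 := by
  simp only [lowBits, unaryLevel]
  split_ifs <;> simp

theorem highBits_apply (x : Bits (Fin L)) (i : Fin L) :
    highBits T x i = if (i : ℕ) < (leafOf T x).1 then 0 else x i := by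
  simp only [highBits, unaryLevel]
  split_ifs <;> simp [fin_two_add_self]

theorem val_lowBits (x : Bits (Fin L)) : val (lowBits T x) = val x % 2 ^ (leafOf T x).1 := by
  rw [← val_low]
  congr 1
  ext i
  rw [lowBits_apply]

theorem leafOf_highBits (x : Bits (Fin L)) : leafOf T (highBits T x) = leafOf T x :=
  leafOf_eq_of_high T fun i hi => by rw [highBits_apply, if_neg (by omega)]

/-- The frequency, shifted to the left so that the period of the leaf becomes `2 ^ L`. -/
def shiftBits (x : Bits (Fin L)) : Bits (Fin L) := fun t =>
  ∑ i : Fin L, if h : L - 1 - (i : ℕ) ≤ t then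
    oneHotLevel T x i * decodeBits x ⟨t - (L - 1 - i), by omega⟩ else 0

/-- A sum against the one-hot code is a case distinction on the level that a circuit can evaluate.
Shifts by a level-dependent distance thereby cost a quadratic number of gates. -/
theorem sum_oneHot (x : Bits (Fin L)) (f : Fin L → Fin 2) (i : Fin L)
    (hi : (i : ℕ) + 1 = (leafOf T x).1) (hf : ∀ k, k ≠ i → oneHotLevel T x k = 0 → f k = 0) :
    ∑ k, f k = f i := by
  refine Finset.sum_eq_single i (fun k _ hk => hf k hk ?_) (by simp)
  rw [oneHotLevel, if_neg]
  rw [← hi]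
  intro h
  exact hk (Fin.ext (by omega))

theorem shiftBits_apply (x : Bits (Fin L)) (t : Fin L) : shiftBits T x t =
    if L - (leafOf T x).1 ≤ t then decodeBits x ⟨t - (L - (leafOf T x).1), by omega⟩ else 0 := by
  have h1 := one_le_level T x
  have h2 := level_le T x
  let i : Fin L := ⟨(leafOf T x).1 - 1, by omega⟩
  have hi : (i : ℕ) + 1 = (leafOf T x).1 := by simp only [i]; omega
  rw [shiftBits, sum_oneHot T x _ i hi]
  · have h3 : L - 1 - (i : ℕ) = L - (leafOf T x).1 := by omega
    have h4 : oneHotLevel T x i = 1 := if_pos hi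
    simp only [h3, h4, one_mul]
    split_ifs <;> rfl
  · intro k _ hk
    simp [hk]

theorem val_shiftBits (x : Bits (Fin L)) : (val (shiftBits T x) : ℤ) =
    2 ^ (L - (leafOf T x).1) * WaveAtom.freqDecode (val x) % 2 ^ L := by
  have h : shiftBits T x = fun t : Fin L => if L - (leafOf T x).1 ≤ (t : ℕ) then
      decodeBits x ⟨t - (L - (leafOf T x).1), by omega⟩ else 0 := by
    ext t; rw [shiftBits_apply]
  rw [h, val_shift]
  push_cast
  rw [val_decodeBits, Int.mul_emod, Int.emod_emod_of_dvd _ (dvd_refl _), ← Int.mul_emod]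

/-- Recover an index from its high bits and its shifted frequency. -/
def recoverBits (y : Bits (Fin L ⊕ Fin L)) : Bits (Fin L) := fun k =>
  let M := y ∘ Sum.inl
  let Z := y ∘ Sum.inr
  let s := Z ⟨L - 1, Nat.sub_lt k.pos one_pos⟩ +
    ∑ i : Fin L, if h : (i : ℕ) + 1 < L then oneHotLevel T M i * M ⟨i + 1, h⟩ else 0
  M k + if (k : ℕ) = 0 then s else ∑ i : Fin L, if h : (k : ℕ) ≤ i then
    oneHotLevel T M i * Z ⟨k - 1 + (L - 1 - i), by omega⟩ + oneHotLevel T M i * s else 0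

theorem recoverBits_eq (x : Bits (Fin L)) :
    recoverBits T (Sum.elim (highBits T x) (shiftBits T x)) = x := by
  ext k
  have h1 := one_le_level T x
  have h2 := level_le T x
  have hk := k.isLt
  let i : Fin L := ⟨(leafOf T x).1 - 1, by omega⟩
  have hi : (i : ℕ) + 1 = (leafOf T x).1 := by simp only [i]; omega
  have hlev : oneHotLevel T (highBits T x) = oneHotLevel T x :=
    funext fun i => by rw [oneHotLevel, oneHotLevel, leafOf_highBits]
  have h4 : oneHotLevel T x i = 1 := if_pos hi
  -- The top digit of the shifted frequency is digit j - 1 of the decoded one, where j is the level: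
  -- x_j + x_0 for j < L and x_0 for j = L. Since x_j is a high digit, the sign digit x_0 can be
  -- solved for, and then every other low digit.
  have hs : shiftBits T x ⟨L - 1, Nat.sub_lt k.pos one_pos⟩ +
      (∑ i : Fin L, if h : (i : ℕ) + 1 < L then oneHotLevel T x i * highBits T x ⟨i + 1, h⟩ else 0)
      = x ⟨0, k.pos⟩ := by
    rw [sum_oneHot T x _ i hi]
    · rw [shiftBits_apply, if_pos (by simp only; omega), decodeBits, h4]
      simp only
      by_cases hL : (i : ℕ) + 1 < L
      · rw [dif_pos hL, dif_pos (by omega), highBits_apply, if_neg (by simp only; omega), one_mul,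
          add_comm, ← add_assoc]
        have : x ⟨i + 1, hL⟩ = x ⟨L - 1 - (L - (leafOf T x).1) + 1, by omega⟩ := by
          congr 1; apply Fin.ext; simp only; omega
        rw [this, fin_two_add_self, zero_add]
      · rw [dif_neg hL, dif_neg (by omega), add_zero]
    · intro k _ hk
      simp [hk]
  simp only [recoverBits, Sum.elim_comp_inl, Sum.elim_comp_inr, hlev, hs]
  by_cases hk0 : (k : ℕ) = 0
  · rw [if_pos hk0, highBits_apply, if_pos (by omega), zero_add]
    congr 2; exact Fin.ext hk0.symm
  · rw [if_neg hk0, sum_oneHot T x _ i hi, highBits_apply]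
    · simp only [h4, one_mul]
      by_cases hki : (k : ℕ) ≤ i
      · rw [dif_pos hki, if_pos (by omega), zero_add, shiftBits_apply, if_pos (by simp only; omega),
          decodeBits, dif_pos (by simp only; omega)]
        rw [add_assoc, fin_two_add_self, add_zero]
        congr 2; apply Fin.ext; simp only; omega
      · rw [dif_neg hki, if_neg (by omega), add_zero]
    · intro k _ hk
      simp [hk]

theorem comp_highLow {k : ℕ} (h : ImplementableWith T.helperOperator k) :
    Comp (fun x => (Sum.elim (highBits T x) (lowBits T x) : Bits (Fin L ⊕ Fin L)))
      (8 * k + 27 * L) := by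
  have hid : Comp (fun x : Bits (Fin L) => x) L := by
    simpa using Comp.reindex (id : Fin L → Fin L)
  let g : Bits (Fin L ⊕ (Fin L ⊕ Fin L)) → Bits (Fin L ⊕ Fin L) := fun y =>
    Sum.elim (fun i => y (Sum.inl i) + y (Sum.inr (Sum.inl i)) * y (Sum.inl i))
      (fun i => y (Sum.inr (Sum.inl i)) * y (Sum.inl i))
  have hg1 : Comp (fun (y : Bits (Fin L ⊕ (Fin L ⊕ Fin L))) (i : Fin L) =>
      y (Sum.inl i) + y (Sum.inr (Sum.inl i)) * y (Sum.inl i)) (L * 8) := by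
    simpa using Comp.pi (f := fun (y : Bits (Fin L ⊕ (Fin L ⊕ Fin L))) (i : Fin L) =>
      y (Sum.inl i) + y (Sum.inr (Sum.inl i)) * y (Sum.inl i))
      fun i => (CompBit.bit _).add (CompBit.mul _ _)
  have hg2 : Comp (fun (y : Bits (Fin L ⊕ (Fin L ⊕ Fin L))) (i : Fin L) =>
      y (Sum.inr (Sum.inl i)) * y (Sum.inl i)) (L * 7) := by
    simpa using Comp.pi (f := fun (y : Bits (Fin L ⊕ (Fin L ⊕ Fin L))) (i : Fin L) =>
      y (Sum.inr (Sum.inl i)) * y (Sum.inl i)) fun i => CompBit.mul _ _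
  exact ((hg1.pair hg2).comp (hid.pair (comp_levelBits T h))).mono (by omega)

theorem comp_shiftBits {k : ℕ} (h : ImplementableWith T.helperOperator k) :
    Comp (shiftBits T) (8 * k + 14 * L + 7 * L ^ 2) := by
  let g : Bits (Fin L ⊕ (Fin L ⊕ Fin L)) → Bits (Fin L) := fun y t =>
    ∑ i : Fin L, if h : L - 1 - (i : ℕ) ≤ t then
      y (Sum.inr (Sum.inr i)) * y (Sum.inl ⟨t - (L - 1 - i), by omega⟩) else 0
  have hg : Comp g (L * (L * 7)) := by
    have : ∀ t, CompBit (fun y => g y t) (L * 7) := by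
      intro t
      have := CompBit.sum (Finset.univ : Finset (Fin L)) (k := 7)
        (φ := fun i (y : Bits (Fin L ⊕ (Fin L ⊕ Fin L))) => if h : L - 1 - (i : ℕ) ≤ t then
          y (Sum.inr (Sum.inr i)) * y (Sum.inl ⟨t - (L - 1 - i), by omega⟩) else 0) (by
        intro i _
        split_ifs
        · exact CompBit.mul _ _
        · exact (CompBit.const _).mono (by norm_num))
      rwa [Finset.card_univ, Fintype.card_fin] at this
    simpa only [Fintype.card_fin] using Comp.pi this
  exact (hg.comp (comp_decodeBits.pair (comp_levelBits T h))).mono (by nlinarith)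

theorem comp_recoverBits {k : ℕ} (h : ImplementableWith T.helperOperator k) :
    Comp (recoverBits T) (16 * k + 100 * L + 30 * L ^ 2 + 10) := by
  have hlev := (comp_levelBits T h).pre (Function.Embedding.inl : Fin L ↪ Fin L ⊕ Fin L)
  have hid : Comp (fun x : Bits (Fin L ⊕ Fin L) => x) (L + L) := by
    simpa using Comp.reindex (id : Fin L ⊕ Fin L → Fin L ⊕ Fin L)
  have h1 := hid.pair hlev
  let κ : Type := (Fin L ⊕ Fin L) ⊕ (Fin L ⊕ Fin L)
  -- The recovered sign digit is stored on a wire of its own, because every product with it below is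
  -- a Toffoli gate that needs a control qubit.
  let sbit : Bits κ → Fin 2 := fun c =>
    if hL : 0 < L then c (Sum.inl (Sum.inr ⟨L - 1, Nat.sub_lt hL one_pos⟩)) +
      ∑ i : Fin L, if h : (i : ℕ) + 1 < L then
        c (Sum.inr (Sum.inr i)) * c (Sum.inl (Sum.inl ⟨i + 1, h⟩)) else 0 else 0
  have hs : CompBit sbit (1 + L * 7) := by
    simp only [sbit]
    split_ifs with hL
    · refine (CompBit.bit _).add ?_
      have := CompBit.sum (Finset.univ : Finset (Fin L)) (k := 7)
        (φ := fun i (c : Bits κ) => if h : (i : ℕ) + 1 < L then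
          c (Sum.inr (Sum.inr i)) * c (Sum.inl (Sum.inl ⟨i + 1, h⟩)) else 0) (by
        intro i _
        split_ifs
        · exact CompBit.mul _ _
        · exact (CompBit.const _).mono (by norm_num))
      rwa [Finset.card_univ, Fintype.card_fin] at this
    · exact (CompBit.const _).mono (by omega)
  have hid' : Comp (fun x : Bits κ => x) (4 * L) :=
    (Comp.reindex (id : κ → κ)).mono (by simp [κ]; omega)
  have h2 := (Comp.pair hid' hs).comp h1
  let g : Bits (κ ⊕ Unit) → Bits (Fin L) := fun c k =>
    c (Sum.inl (Sum.inl (Sum.inl k))) + if (k : ℕ) = 0 then c (Sum.inr ()) else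
      ∑ i : Fin L, if h : (k : ℕ) ≤ i then
        c (Sum.inl (Sum.inr (Sum.inr i))) *
          c (Sum.inl (Sum.inl (Sum.inr ⟨k - 1 + (L - 1 - i), by omega⟩))) +
        c (Sum.inl (Sum.inr (Sum.inr i))) * c (Sum.inr ()) else 0
  have hg : Comp g (L * (1 + (1 + L * 14))) := by
    have : ∀ k, CompBit (fun c => g c k) (1 + (1 + L * 14)) := by
      intro k
      refine (CompBit.bit _).add ?_
      split_ifs with hk
      · exact (CompBit.bit _).mono (by omega)
      · have := CompBit.sum (Finset.univ : Finset (Fin L)) (k := 14)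
          (φ := fun i (c : Bits (κ ⊕ Unit)) => if h : (k : ℕ) ≤ i then
            c (Sum.inl (Sum.inr (Sum.inr i))) *
              c (Sum.inl (Sum.inl (Sum.inr ⟨k - 1 + (L - 1 - i), by omega⟩))) +
            c (Sum.inl (Sum.inr (Sum.inr i))) * c (Sum.inr ()) else 0) (by
          intro i _
          split_ifs
          · exact (CompBit.mul _ _).add (CompBit.mul _ _)
          · exact (CompBit.const _).mono (by norm_num))
        rw [Finset.card_univ, Fintype.card_fin] at this
        exact this.mono (by omega)
    simpa only [Fintype.card_fin] using Comp.pi this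
  refine Comp.mono ?_ (show 2 * (2 * (L + L + (4 * k + 5 * L)) + (4 * L + (1 + L * 7))) +
    L * (1 + (1 + L * 14)) ≤ _ by nlinarith)
  convert hg.comp h2 using 1
  ext y k : 2
  simp only [g, sbit, recoverBits, dif_pos k.pos]
  rfl

end Level

end Qubit

/-! ### The Fourier transforms of all leaves in one circuit -/

namespace Qubit

open Matrix

section LeafTransform

variable {κ ζ : Type} [Fintype κ] [DecidableEq κ] [Fintype ζ] [DecidableEq ζ]

theorem mux_mul_lift (Q : Bits κ → Op ζ) (F : Op ζ) :
    mux Q * lift (Function.Embedding.inr : ζ ↪ κ ⊕ ζ) F = mux fun c => Q c * F := by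
  refine op_ext fun s => ?_
  obtain ⟨c, z, rfl⟩ : ∃ x y, s = Sum.elim x y := ⟨_, _, (Sum.elim_comp_inl_inr s).symm⟩
  rw [← mulVec_mulVec, lift_mulVec_ket, mulVec_ket, splice_apply, mux_mulVec_ket]
  simp only [extend_inr, mulVec_sum, mulVec_smul, Sum.elim_comp_inl,
    mux_mulVec_ket, Matrix.mul_apply, Finset.smul_sum, Finset.sum_smul]
  rw [Finset.sum_comm]
  refine Finset.sum_congr rfl fun y _ => Finset.sum_congr rfl fun w _ => ?_
  rw [smul_smul, mul_comm]
  rfl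

variable {L : ℕ} (T : WaveletTree L)

/-- A phase that depends on the qubit `t` only. -/
noncomputable def bitPhase (t : Fin L) (b : Fin 2) : ℂ :=
  if (t : ℕ) + 1 = L then cis (-(1 / 8)) else cis ((b : ℕ) * 2 ^ (t : ℕ) / 2 ^ (L + 1))

theorem norm_bitPhase (t : Fin L) (b : Fin 2) : ‖bitPhase t b‖ = 1 := by
  unfold bitPhase
  split_ifs <;> exact norm_cis _

/-- The product of the phases of all qubits. -/
noncomputable def totalPhase (x : Bits (Fin L)) : ℂ := ∏ t, bitPhase t (x t)

theorem impl_totalPhase : Impl (diagonal (totalPhase (L := L))) L := by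
  have h := Impl.diagonal_prod (ι := Fin L) (Finset.univ : Finset (Fin L))
    (fun t _ => impl_phase t (norm_bitPhase t))
  rw [Finset.card_univ, Fintype.card_fin, mul_one] at h
  exact h

/-- Hadamard gates, to be applied to the qubits with control bit `0`. -/
noncomputable def ctrlHadamard (_ : Fin L) (c : Fin 2) : Matrix (Fin 2) (Fin 2) ℂ :=
  if c = 1 then 1 else hadamard

theorem ctrlHadamard_unitary (i : Fin L) (c : Fin 2) :
    (ctrlHadamard i c)ᴴ * ctrlHadamard i c = 1 := by
  unfold ctrlHadamard
  split_ifs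
  · simp
  · exact hadamard_unitary

/-- The Fourier matrix factors over the output digits. As `val x` is a multiple of 2^(L - j), the
phase of each digit i ≥ j is trivial, so that this qubit is in the state (|0⟩ + |1⟩)/√2 and a
Hadamard gate returns it to |0⟩. The digits below j carry the transform of size 2^j with
normalization 2^(-j/2). -/
theorem ctrlHadamard_fourier {j : ℕ} (hj : j ≤ L) (c z x : Bits (Fin L))
    (hc : ∀ i, c i = if (i : ℕ) < j then 1 else 0) (hx : 2 ^ (L - j) ∣ val x) :
    (ctrlTensor ctrlHadamard c * fourier L) z x =
      if ∀ i : Fin L, j ≤ (i : ℕ) → z i = 0 then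
        ((1 / Real.sqrt 2 : ℝ) : ℂ) ^ j * cis (val z * val x / 2 ^ L) else 0 := by
  have hcis : ∀ w : Bits (Fin L), cis (val w * val x / 2 ^ L) =
      ∏ i, cis ((w i : ℕ) * 2 ^ (i : ℕ) * val x / 2 ^ L) := by
    intro w
    rw [← cis_sum, val_eq w]
    congr 1
    push_cast
    rw [Finset.sum_mul, Finset.sum_div]
  have h1 : (ctrlTensor ctrlHadamard c * fourier L) z x = ∏ i, ∑ b : Fin 2,
      ctrlHadamard i (c i) (z i) b * (((1 / Real.sqrt 2 : ℝ) : ℂ) *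
        cis ((b : ℕ) * 2 ^ (i : ℕ) * val x / 2 ^ L)) := by
    rw [Finset.prod_univ_sum, Fintype.piFinset_univ, Matrix.mul_apply]
    refine Finset.sum_congr rfl fun w _ => ?_
    rw [ctrlTensor, of_apply, fourier, of_apply, hcis, Finset.prod_mul_distrib,
      Finset.prod_mul_distrib, Finset.prod_const, Finset.card_univ, Fintype.card_fin]
  have h2 : ∀ i : Fin L, ∑ b : Fin 2,
      ctrlHadamard i (c i) (z i) b * (((1 / Real.sqrt 2 : ℝ) : ℂ) *
        cis ((b : ℕ) * 2 ^ (i : ℕ) * val x / 2 ^ L)) =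
      if (i : ℕ) < j then ((1 / Real.sqrt 2 : ℝ) : ℂ) *
        cis ((z i : ℕ) * 2 ^ (i : ℕ) * val x / 2 ^ L) else if z i = 0 then 1 else 0 := by
    intro i
    rw [hc i]
    by_cases hi : (i : ℕ) < j
    · simp only [if_pos hi, ctrlHadamard, if_true, Matrix.one_apply, ite_mul, one_mul, zero_mul,
        Finset.sum_ite_eq, Finset.mem_univ]
    · have h3 : ∀ b : Fin 2, cis ((b : ℕ) * 2 ^ (i : ℕ) * val x / 2 ^ L) = 1 := by
        intro b
        obtain ⟨q, hq⟩ := hx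
        rw [hq, cis_eq_of_sub_int (t := 0) ((b : ℕ) * 2 ^ ((i : ℕ) - j) * q : ℕ), cis_zero]
        have h4 : (2 : ℝ) ^ (i : ℕ) * 2 ^ (L - j) = 2 ^ ((i : ℕ) - j) * 2 ^ L := by
          rw [← pow_add, ← pow_add]; congr 1; omega
        push_cast
        rw [zero_add, div_eq_iff (by positivity)]
        linear_combination ((b : ℕ) : ℝ) * q * h4
      have hr := inv_sqrt_two_mul_self
      simp only [if_neg hi, ctrlHadamard, h3, hadamard, Fin.sum_univ_two]
      generalize ((1 / Real.sqrt 2 : ℝ) : ℂ) = r at hr ⊢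
      generalize z i = a
      fin_cases a
      · simp
        linear_combination 2 * hr
      · simp
  rw [h1, Finset.prod_congr rfl fun i _ => h2 i]
  split_ifs with hz
  · have h5 : ∀ i : Fin L, (if (i : ℕ) < j then ((1 / Real.sqrt 2 : ℝ) : ℂ) *
        cis ((z i : ℕ) * 2 ^ (i : ℕ) * val x / 2 ^ L) else if z i = 0 then 1 else 0) =
        (if (i : ℕ) < j then ((1 / Real.sqrt 2 : ℝ) : ℂ) else 1) *
        cis ((z i : ℕ) * 2 ^ (i : ℕ) * val x / 2 ^ L) := by
      intro i
      by_cases hi : (i : ℕ) < j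
      · simp [hi]
      · simp [hi, hz i (by omega), cis_zero]
    rw [Finset.prod_congr rfl fun i _ => h5 i, Finset.prod_mul_distrib, ← hcis, ← Finset.prod_filter,
      Finset.prod_const]
    congr 2
    rw [Fin.card_filter_val_lt]
    omega
  · push Not at hz
    obtain ⟨i, hi, hzi⟩ := hz
    refine Finset.prod_eq_zero (Finset.mem_univ i) ?_
    rw [if_neg (by omega), if_neg hzi]

/-- The Fourier transforms of all leaves, up to phases. -/
noncomputable def leafOp : Op (Fin L) := Matrix.of fun y x =>
  if leafOf T y = leafOf T x then ((1 / Real.sqrt 2 : ℝ) : ℂ) ^ (leafOf T x).1 *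
    cis (val (lowBits T y) * val (shiftBits T x) / 2 ^ L) * totalPhase (shiftBits T x) else 0

theorem high_eq_of_leafOf_eq {x y : Bits (Fin L)} (h : leafOf T y = leafOf T x) (i : Fin L)
    (hi : (leafOf T x).1 ≤ (i : ℕ)) : y i = x i := by
  have h1 := val_div_level T x
  have h2 := val_div_level T y
  rw [h, ← h1] at h2
  have h3 := congrArg (fun n => n.testBit ((i : ℕ) - (leafOf T x).1)) h2
  simp only [Nat.testBit_div_two_pow, testBit_val, Nat.sub_add_cancel hi, i.isLt, dif_pos] at h3
  exact fin_two_ext (by simpa using h3)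

theorem two_pow_dvd_val_shiftBits (x : Bits (Fin L)) :
    2 ^ (L - (leafOf T x).1) ∣ val (shiftBits T x) := by
  have h := val_shiftBits T x
  have h1 : (2 ^ (L - (leafOf T x).1) : ℤ) ∣ val (shiftBits T x) := by
    rw [h, Int.emod_def]
    refine dvd_sub (dvd_mul_right _ _) (Dvd.dvd.mul_right (pow_dvd_pow _ (by omega)) _)
  exact_mod_cast h1

/-- Write h for the high digits of p and s for its shifted frequency. The registers run through (p,
0, 0), (p, h, s), (0, h, s), then a superposition of (0, h, z) with z < 2^j, then (h + z, h, z) and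
(h + z, 0, 0). Erasing p uses `recoverBits`; the last step works because h and z are the high and
low digits of h + z. The level is read off from h during the transform. -/
theorem impl_leafOp {k : ℕ} (h : ImplementableWith T.helperOperator k) :
    Impl (leafOp T) (52 * k + 207 * L + 38 * L ^ 2 + 10) := by
  have hhl := comp_highLow T h
  have hhigh : Comp (highBits T) (2 * (8 * k + 27 * L) + L) := by
    have := (Comp.reindex (ι := Fin L ⊕ Fin L) (κ := Fin L) Sum.inl).comp hhl
    rwa [Fintype.card_fin] at this
  have h1 : Impl (pm _) _ := hhigh.pair (comp_shiftBits T h)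
  have h2 := (comp_recoverBits T h).impl_xorInto (σ := Fin L ⊕ (Fin L ⊕ Fin L))
    Function.Embedding.inr Function.Embedding.inl (by simp)
  have h3 := ((impl_fourier L).mul impl_totalPhase).lift
    (Function.Embedding.inr : Fin L ↪ Fin L ⊕ Fin L)
  have h4 := (impl_mux_ctrlTensor (ctrlHadamard_unitary (L := L))).mux_comp (comp_unaryLevel T h)
  have h5 := (h4.mul h3).lift (Function.Embedding.inr : Fin L ⊕ Fin L ↪ Fin L ⊕ (Fin L ⊕ Fin L))
  rw [mux_mul_lift] at h5
  have h6' : Comp (fun y : Bits (Fin L ⊕ Fin L) => (fun i => y (Sum.inl i)) + fun i => y (Sum.inr i))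
      (L + L) := by
    simpa only [Fintype.card_fin] using
      (Comp.reindex (ι := Fin L ⊕ Fin L) (κ := Fin L) Sum.inl).add (Comp.reindex Sum.inr)
  have h6 := h6'.impl_xorInto (σ := Fin L ⊕ (Fin L ⊕ Fin L))
    Function.Embedding.inr Function.Embedding.inl (by simp)
  have h7 : Impl (pm _) _ := hhl
  refine Impl.mono (Impl.ancilla (h7.mul (h6.mul (h5.mul (h2.mul h1)))) fun p => ?_) ?_
  · have e1 : ∀ f : Bits (Fin L ⊕ Fin L) → Bits (Fin L), ∀ x y, xorInto (σ := Fin L ⊕ (Fin L ⊕ Fin L))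
        Function.Embedding.inr Function.Embedding.inl f (Sum.elim x y) = Sum.elim (x + f y) y :=
      fun f x y => extend_inl _ _
    have e2 : ∀ f : Bits (Fin L) → Bits (Fin L ⊕ Fin L), ∀ x y,
        xorMap f (Sum.elim x y) = Sum.elim x (y + f x) := fun f x y => rfl
    have e3 : ∀ (x : Bits (Fin L)) (y : Bits (Fin L ⊕ Fin L)),
        Sum.elim x y ∘ (Function.Embedding.inr : Fin L ⊕ Fin L ↪ Fin L ⊕ (Fin L ⊕ Fin L)) = y :=
      fun x y => rfl
    rw [← mulVec_mulVec, ← mulVec_mulVec, ← mulVec_mulVec, ← mulVec_mulVec, pm_mulVec_ket, e2,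
      pm_mulVec_ket, e1, lift_mulVec_ket, e3, zero_add, recoverBits_eq,
      bits_add_self, mux_mulVec_ket]
    simp only [map_sum, map_smul, splice_ket, extend_inr, Sum.elim_comp_inl, mulVec_sum,
      mulVec_smul, pm_mulVec_ket, e1, e2]
    -- The outputs q are parametrized by q = h + z, which is the state reached by the circuit.
    rw [← Equiv.sum_comp (Equiv.addLeft (highBits T p)) fun q =>
      leafOp T q p • ket (Sum.elim q (0 : Bits (Fin L ⊕ Fin L)))]
    refine Finset.sum_congr rfl fun z _ => ?_
    have hj := level_le T p
    have hamp := ctrlHadamard_fourier hj (unaryLevel T (highBits T p)) z (shiftBits T p)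
      (fun i => by rw [unaryLevel, leafOf_highBits]) (two_pow_dvd_val_shiftBits T p)
    rw [← Matrix.mul_assoc, Matrix.mul_diagonal, hamp]
    simp only [Equiv.coe_addLeft]
    by_cases hz : ∀ i : Fin L, (leafOf T p).1 ≤ (i : ℕ) → z i = 0
    · rw [if_pos hz]
      have hleaf : leafOf T (highBits T p + z) = leafOf T p :=
        leafOf_eq_of_high T fun i hi => by
          rw [Pi.add_apply, hz i hi, highBits_apply, if_neg (by omega), add_zero]
      have hlow : lowBits T (highBits T p + z) = z := by
        ext i
        rw [lowBits_apply, hleaf]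
        split_ifs with hi
        · rw [Pi.add_apply, highBits_apply, if_pos hi, zero_add]
        · rw [hz i (by omega)]
      have hhi : highBits T (highBits T p + z) = highBits T p := by
        ext i
        rw [highBits_apply, hleaf, highBits_apply]
        split_ifs with hi
        · rfl
        · rw [Pi.add_apply, highBits_apply, if_neg hi, hz i (by omega), add_zero]
      rw [leafOp, of_apply, if_pos hleaf, hlow]
      congr 2
      change Sum.elim (0 + (highBits T p + z)) (Sum.elim (highBits T p) z +
        Sum.elim (highBits T (0 + (highBits T p + z))) (lowBits T (0 + (highBits T p + z)))) = _
      rw [zero_add, hhi, hlow, bits_add_self]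
    · rw [if_neg hz, zero_mul, zero_smul, leafOp, of_apply, if_neg, zero_smul]
      intro hleaf
      refine hz fun i hi => ?_
      have h := high_eq_of_leafOf_eq T hleaf i hi
      rw [Pi.add_apply, highBits_apply, if_neg (by omega)] at h
      simpa using h
  · rw [Fintype.card_fin]
    nlinarith

end LeafTransform

end Qubit

/-! ### Computing the reflection of negative frequencies -/

namespace Qubit

open Matrix

section Sign

theorem bitsOf_sign {M : ℕ} {z : ℤ} (h1 : -2 ^ M ≤ z) (h2 : z < 2 ^ M) :
    bitsOf (M + 1) z (Fin.last M) = if z < 0 then 1 else 0 := by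
  have hd := digit_eq (bitsOf (M + 1) z) (Fin.last M)
  have hv := val_bitsOf (M + 1) z
  rw [Fin.val_last] at hd
  rw [pow_succ] at hv
  have hp : (0 : ℤ) < 2 ^ M := by positivity
  apply Fin.ext
  rw [hd]
  split_ifs with hz
  · have h3 : z % (2 ^ M * 2) = z + 2 ^ M * 2 := by
      rw [← Int.add_emod_right, Int.emod_eq_of_lt] <;> linarith
    have h4 : val (bitsOf (M + 1) z) / 2 ^ M = 1 := by
      apply Nat.div_eq_of_lt_le
      · zify; rw [hv, h3]; linarith
      · zify; rw [hv, h3]; linarith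
    rw [h4]; rfl
  · have h3 : z % (2 ^ M * 2) = z := Int.emod_eq_of_lt (by linarith) (by linarith)
    have h4 : val (bitsOf (M + 1) z) / 2 ^ M = 0 := by
      apply Nat.div_eq_of_lt
      zify; rw [hv, h3]; linarith
    rw [h4]; rfl

theorem val_bitsOf_add (L : ℕ) (z : ℤ) : val (bitsOf L z) = val (bitsOf (L + 2) z) % 2 ^ L := by
  zify
  rw [val_bitsOf, val_bitsOf, Int.emod_emod_of_dvd _ (pow_dvd_pow _ (by omega))]

theorem bitsOf_castLE (L : ℕ) (z : ℤ) (k : Fin L) :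
    bitsOf (L + 2) z ⟨k, by omega⟩ = bitsOf L z k := by
  have h := congrArg (fun n => n.testBit k) (val_bitsOf_add L z)
  simp only [Nat.testBit_mod_two_pow, testBit_val, k.isLt, dif_pos,
    (by omega : (k : ℕ) < L + 2), decide_true, Bool.true_and] at h
  exact (fin_two_ext (by simpa using h)).symm

/-- In two's complement with two spare digits, the range test is the vanishing of the two top
digits; `mirror_bounds` shows that two are enough. -/
theorem bitsOf_in_range {L : ℕ} {z : ℤ} (h1 : -2 ^ (L + 1) ≤ z) (h2 : z < 2 ^ (L + 1)) :
    (bitsOf (L + 2) z ⟨L, by omega⟩ = 0 ∧ bitsOf (L + 2) z ⟨L + 1, by omega⟩ = 0) ↔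
      0 ≤ z ∧ z < 2 ^ L := by
  have hs := bitsOf_sign (M := L + 1) h1 h2
  have hl : (Fin.last (L + 1)) = ⟨L + 1, by omega⟩ := rfl
  rw [hl] at hs
  rw [hs]
  by_cases hz : z < 0
  · rw [if_pos hz]
    constructor
    · rintro ⟨-, h⟩; exact absurd h (by decide)
    · rintro ⟨h, -⟩; omega
  · rw [if_neg hz]
    have hd := digit_eq (bitsOf (L + 2) z) ⟨L, by omega⟩
    have hv := val_bitsOf (L + 2) z
    simp only at hd
    have hp : (0 : ℤ) < 2 ^ L := by positivity
    rw [Int.emod_eq_of_lt (by omega) (by rw [pow_succ] at h2 ⊢; rw [pow_succ]; linarith)] at hv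
    simp only [Fin.ext_iff, hd]
    rw [pow_succ] at h2
    constructor
    · rintro ⟨h, -⟩
      refine ⟨by omega, ?_⟩
      by_contra hlt
      have h4 : val (bitsOf (L + 2) z) / 2 ^ L = 1 := by
        apply Nat.div_eq_of_lt_le
        · zify; rw [hv]; linarith
        · zify; rw [hv]; linarith
      rw [h4] at h
      exact absurd h (by decide)
    · rintro ⟨-, h⟩
      have h4 : val (bitsOf (L + 2) z) / 2 ^ L = 0 := by
        apply Nat.div_eq_of_lt
        zify; rw [hv]; linarith
      rw [h4]
      simp

end Sign

section Reflection

variable {L : ℕ} (T : WaveletTree L)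

/-- Whether the position `p` is in the window around the left end of its leaf. -/
def inLeftWindow (p : ℕ) : Prop :=
  3 * (p % 2 ^ (T.leafAt p).1 + 1) + 2 ^ (T.leafAt p).1 * ((T.leafAt p).2 % 2) <
    2 ^ ((T.leafAt p).1 + 1)

instance (p : ℕ) : Decidable (inLeftWindow T p) := inferInstanceAs (Decidable (_ < _))

/-- The mirror image of the position `p` in the nearest end of its leaf, as an integer. -/
def mirror (p : ℕ) : ℤ :=
  (p : ℤ) - 2 * (p % 2 ^ (T.leafAt p).1 : ℕ) - 2 +
    if inLeftWindow T p then 0 else 2 ^ ((T.leafAt p).1 + 1)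

/-- The reflection of all negative frequencies at the ends of the leaves. -/
def reflectBits (x : Bits (Fin L)) : Bits (Fin L) :=
  if val x % 2 = 1 ∧ 0 ≤ mirror T (val x) ∧ mirror T (val x) < 2 ^ L then
    bitsOf L (mirror T (val x)) else x

theorem sum_oneHotLevel (x : Bits (Fin L)) (w : Fin L → ℤ) :
    ∑ i, w i * (oneHotLevel T x i : ℕ) = w ⟨(leafOf T x).1 - 1, by
      have := one_le_level T x; have := level_le T x; omega⟩ := by
  have h1 := one_le_level T x
  rw [Finset.sum_eq_single ⟨(leafOf T x).1 - 1, by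
      have := one_le_level T x; have := level_le T x; omega⟩]
  · rw [oneHotLevel, if_pos (by simp only; omega)]
    simp
  · intro i _ hi
    rw [oneHotLevel, if_neg]
    · simp
    · intro h
      exact hi (Fin.ext (by simp only; omega))
  · simp

theorem sum_val (x : Bits (Fin L)) (c : ℤ) :
    ∑ i : Fin L, c * 2 ^ (i : ℕ) * (x i : ℕ) = c * val x := by
  rw [val_eq]
  push_cast
  rw [Finset.mul_sum]
  exact Finset.sum_congr rfl fun i _ => by ring

/-- The parity of the leaf at the level of the leaf. -/
def parityBits (x : Bits (Fin L)) : Bits (Fin L) := fun i =>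
  if h : (i : ℕ) + 1 < L then oneHotLevel T x i * x ⟨i + 1, h⟩ else 0

/-- The parity of the leaf (j, m) is digit j of the index, or 0 for j = L, where m = 0. Stored at
the one-hot position of the level, it makes 2^j * (m mod 2) a linear function of bits. -/
theorem sum_parityBits (x : Bits (Fin L)) :
    ∑ i : Fin L, (2 : ℤ) ^ ((i : ℕ) + 1) * (parityBits T x i : ℕ) =
      2 ^ (leafOf T x).1 * ((leafOf T x).2 % 2 : ℕ) := by
  have h1 := one_le_level T x
  have h2 := level_le T x
  have h3 := val_div_level T x
  have h4 : ∀ i : Fin L, (2 : ℤ) ^ ((i : ℕ) + 1) * (parityBits T x i : ℕ) =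
      (2 ^ ((i : ℕ) + 1) * if h : (i : ℕ) + 1 < L then ((x ⟨i + 1, h⟩ : ℕ) : ℤ) else 0) *
        (oneHotLevel T x i : ℕ) := by
    intro i
    rw [parityBits, oneHotLevel]
    split_ifs <;> simp
  rw [Finset.sum_congr rfl fun i _ => h4 i, sum_oneHotLevel]
  simp only [Nat.sub_add_cancel h1]
  congr 1
  split_ifs with h
  · rw [digit_eq]
    simp only [h3]
  · have : (leafOf T x).1 = L := by omega
    rw [this, Nat.div_eq_of_lt (val_lt x)] at h3
    rw [← h3]; rfl

/-- The number whose sign decides on which side the leaf is reflected. -/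
def windowInt (x : Bits (Fin L)) : ℤ :=
  3 * (val (lowBits T x) + 1) + 2 ^ (leafOf T x).1 * ((leafOf T x).2 % 2 : ℕ) -
    2 ^ ((leafOf T x).1 + 1)

theorem windowInt_neg_iff (x : Bits (Fin L)) : windowInt T x < 0 ↔ inLeftWindow T (val x) := by
  rw [windowInt, val_lowBits, inLeftWindow, sub_neg]
  exact_mod_cast Iff.rfl

theorem windowInt_bounds (x : Bits (Fin L)) :
    -2 ^ (L + 2) ≤ windowInt T x ∧ windowInt T x < 2 ^ (L + 2) := by
  have h1 : (2 : ℤ) ^ (leafOf T x).1 ≤ 2 ^ L := pow_le_pow_right₀ (by norm_num) (level_le T x)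
  have h2 : val (lowBits T x) + 1 ≤ 2 ^ (leafOf T x).1 := by
    rw [val_lowBits]
    exact Nat.mod_lt _ (by positivity)
  have h3 : (val (lowBits T x) : ℤ) + 1 ≤ 2 ^ (leafOf T x).1 := by exact_mod_cast h2
  have h4 : (((leafOf T x).2 % 2 : ℕ) : ℤ) ≤ 1 := by omega
  have h5 : (0 : ℤ) ≤ ((leafOf T x).2 % 2 : ℕ) := by positivity
  have h6 : (0 : ℤ) < 2 ^ (leafOf T x).1 := by positivity
  have h7 := mul_le_mul_of_nonneg_left h4 h6.le
  have h8 := mul_nonneg h6.le h5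
  rw [windowInt, pow_succ, pow_succ, pow_succ]
  constructor <;> nlinarith

/-- The bit that decides on which side the leaf is reflected. -/
def windowBit (x : Bits (Fin L)) : Fin 2 := if inLeftWindow T (val x) then 1 else 0

/-- This form is affine in bits: the case distinction has become a product with `windowBit`, and
multiplying the one-hot code by this bit keeps it linear. -/
theorem mirror_eq (x : Bits (Fin L)) : mirror T (val x) =
    -2 + (val x + (-2 * val (lowBits T x) + (2 ^ ((leafOf T x).1 + 1) +
      -2 ^ ((leafOf T x).1 + 1) * (windowBit T x : ℕ)))) := by
  rw [val_lowBits, mirror, windowBit]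
  change (val x : ℤ) - 2 * ((val x % 2 ^ (leafOf T x).1 : ℕ) : ℤ) - 2 +
    (if inLeftWindow T (val x) then 0 else 2 ^ ((leafOf T x).1 + 1)) = _
  split_ifs <;> simp <;> ring

theorem mirror_bounds (x : Bits (Fin L)) :
    -2 ^ (L + 1) ≤ mirror T (val x) ∧ mirror T (val x) < 2 ^ (L + 1) := by
  have h1 : 2 ^ (leafOf T x).1 ≤ 2 ^ L := pow_le_pow_right₀ (by norm_num) (level_le T x)
  have h2 : val (lowBits T x) < 2 ^ (leafOf T x).1 := by
    rw [val_lowBits]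
    exact Nat.mod_lt _ (by positivity)
  have h3 : val x + 2 ^ (leafOf T x).1 ≤ 2 ^ L + val (lowBits T x) := by
    have h4 := Nat.div_add_mod (val x) (2 ^ (leafOf T x).1)
    rw [val_lowBits]
    have h5 : 2 ^ L = 2 ^ (leafOf T x).1 * 2 ^ (L - (leafOf T x).1) := by
      rw [← pow_add]; congr 1; have := level_le T x; omega
    have h6 : val x / 2 ^ (leafOf T x).1 < 2 ^ (L - (leafOf T x).1) := by
      rw [Nat.div_lt_iff_lt_mul (by positivity), mul_comm, ← h5]; exact val_lt x
    nlinarith [Nat.mul_le_mul_left (2 ^ (leafOf T x).1) h6]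
  have h7 : val (lowBits T x) ≤ val x := by rw [val_lowBits]; exact Nat.mod_le _ _
  have h8 : 2 ≤ 2 ^ (leafOf T x).1 := by
    calc 2 = 2 ^ 1 := rfl
      _ ≤ _ := pow_le_pow_right₀ (by norm_num) (one_le_level T x)
  rw [mirror_eq, windowBit]
  zify at h1 h2 h3 h7 h8
  rw [pow_succ, pow_succ]
  split_ifs <;> simp <;> constructor <;> linarith

theorem comp_affine_le {ι : Type} [Fintype ι] [DecidableEq ι] {M : ℕ} (w : ι → ℤ) (c : ℤ)
    (h : Fintype.card ι ≤ 5 * L) (hM : M ≤ L + 3) :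
    Comp (fun x : Bits ι => bitsOf M (affine w c x)) (40 * (L + 3) ^ 2) := by
  refine (comp_affine M w c).mono ?_
  have h1 : Fintype.card ι * M ≤ 5 * L * (L + 3) := Nat.mul_le_mul h hM
  have h2 : M ^ 2 ≤ (L + 3) ^ 2 := Nat.pow_le_pow_left hM 2
  nlinarith

theorem comp_id {ι : Type} [Fintype ι] [DecidableEq ι] :
    Comp (fun x : Bits ι => x) (Fintype.card ι) :=
  Comp.reindex (id : ι → ι)

theorem comp_lowBits {k : ℕ} (h : ImplementableWith T.helperOperator k) :
    Comp (lowBits T) (16 * k + 55 * L) := by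
  have := (Comp.reindex (ι := Fin L ⊕ Fin L) (κ := Fin L) Sum.inr).comp (comp_highLow T h)
  rw [Fintype.card_fin] at this
  exact this.mono (by omega)

theorem comp_oneHotLevel {k : ℕ} (h : ImplementableWith T.helperOperator k) :
    Comp (oneHotLevel T) (8 * k + 11 * L) := by
  have := (Comp.reindex (ι := Fin L ⊕ Fin L) (κ := Fin L) Sum.inr).comp (comp_levelBits T h)
  rw [Fintype.card_fin] at this
  exact this.mono (by omega)

theorem comp_parityBits {k : ℕ} (h : ImplementableWith T.helperOperator k) :
    Comp (parityBits T) (16 * k + 40 * L) := by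
  have hid : Comp (fun x : Bits (Fin L) => x) L := by simpa using comp_id (ι := Fin L)
  have hone := comp_oneHotLevel T h
  let g : Bits (Fin L ⊕ Fin L) → Bits (Fin L) := fun y i =>
    if h : (i : ℕ) + 1 < L then y (Sum.inr i) * y (Sum.inl ⟨i + 1, h⟩) else 0
  have hg : Comp g (L * 7) := by
    have : ∀ i, CompBit (fun y => g y i) 7 := by
      intro i
      simp only [g]
      split_ifs
      · exact CompBit.mul _ _
      · exact (CompBit.const _).mono (by norm_num)
    simpa only [Fintype.card_fin] using Comp.pi this
  exact (hg.comp (hid.pair hone)).mono (by omega)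

/-- The window condition says that `windowInt` is negative. This integer is affine in the low
digits, the one-hot level and the parity digits, and its sign is the top digit of its two's
complement with L + 3 digits. -/
theorem comp_windowBit {k : ℕ} (h : ImplementableWith T.helperOperator k) :
    CompBit (windowBit T) (200 * k + 1000 * (L + 3) ^ 2) := by
  have hS : L ≤ (L + 3) ^ 2 := by nlinarith
  have hS' : 9 ≤ (L + 3) ^ 2 := by nlinarith
  have hS2 : L * 22 ≤ 22 * (L + 3) ^ 2 := by nlinarith
  have haff : ∀ {ι : Type} [Fintype ι] [DecidableEq ι] {M : ℕ} (w : ι → ℤ) (c : ℤ),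
      Fintype.card ι ≤ 5 * L → M ≤ L + 3 → Comp (fun x : Bits ι => bitsOf M (affine w c x))
        (40 * (L + 3) ^ 2) := fun w c => comp_affine_le w c
  generalize (L + 3) ^ 2 = S at *
  have hlow := comp_lowBits T h
  have hone := comp_oneHotLevel T h
  have hpar := comp_parityBits T h
  let w : Fin L ⊕ (Fin L ⊕ Fin L) → ℤ := Sum.elim (fun i => 3 * 2 ^ (i : ℕ))
    (Sum.elim (fun i => - 2 ^ ((i : ℕ) + 2)) (fun i => 2 ^ ((i : ℕ) + 1)))
  have h1 := (haff (M := L + 3) w 3 (by simp; omega) le_rfl).comp (hlow.pair (hone.pair hpar))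
  have h2 := (CompBit.bit (Fin.last (L + 2))).comp h1
  refine Comp.mono ?_ (by omega : 2 * (2 * (16 * k + 55 * L + (8 * k + 11 * L +
    (16 * k + 40 * L))) + 40 * S) + 1 ≤ 200 * k + 1000 * S)
  · convert h2 using 1
    ext x : 2
    have h3 : affine w 3 (Sum.elim (lowBits T x) (Sum.elim (oneHotLevel T x) (parityBits T x))) =
        windowInt T x := by
      have h4 := one_le_level T x
      simp only [affine, w, Fintype.sum_sum_type, Sum.elim_inl, Sum.elim_inr]
      rw [sum_val, sum_oneHotLevel, sum_parityBits, windowInt]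
      simp only
      rw [show (leafOf T x).1 - 1 + 2 = (leafOf T x).1 + 1 by omega]
      ring
    rw [h3]
    refine Eq.trans ?_ (bitsOf_sign (windowInt_bounds T x).1 (windowInt_bounds T x).2).symm
    rw [windowBit]
    exact if_congr (windowInt_neg_iff T x).symm rfl rfl

theorem comp_mirror {k : ℕ} (h : ImplementableWith T.helperOperator k) :
    Comp (fun x : Bits (Fin L) => bitsOf (L + 2) (mirror T (val x))) (1000 * k + 5000 * (L + 3) ^ 2) := by
  have hS : L ≤ (L + 3) ^ 2 := by nlinarith
  have hS' : 9 ≤ (L + 3) ^ 2 := by nlinarith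
  have hS2 : L * 22 ≤ 22 * (L + 3) ^ 2 := by nlinarith
  have haff : ∀ {ι : Type} [Fintype ι] [DecidableEq ι] {M : ℕ} (w : ι → ℤ) (c : ℤ),
      Fintype.card ι ≤ 5 * L → M ≤ L + 3 → Comp (fun x : Bits ι => bitsOf M (affine w c x))
        (40 * (L + 3) ^ 2) := fun w c => comp_affine_le w c
  have hwin := comp_windowBit T h
  generalize (L + 3) ^ 2 = S at *
  have hid : Comp (fun x : Bits (Fin L) => x) L := by simpa using comp_id (ι := Fin L)
  have hlow := comp_lowBits T h
  have hone := comp_oneHotLevel T h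
  have hv : Comp (fun (y : Bits (Fin L ⊕ Unit)) (i : Fin L) => y (Sum.inl i) * y (Sum.inr ()))
      (L * 7) := by
    simpa only [Fintype.card_fin] using Comp.pi (f := fun (y : Bits (Fin L ⊕ Unit)) (i : Fin L) =>
      y (Sum.inl i) * y (Sum.inr ())) fun i => CompBit.mul _ _
  have hv' := hv.comp (hone.pair hwin)
  let w : Fin L ⊕ (Fin L ⊕ (Fin L ⊕ Fin L)) → ℤ := Sum.elim (fun i => 1 * 2 ^ (i : ℕ))
    (Sum.elim (fun i => - 2 * 2 ^ (i : ℕ)) (Sum.elim (fun i => 2 ^ ((i : ℕ) + 2))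
      (fun i => - 2 ^ ((i : ℕ) + 2))))
  have h1 := (haff (M := L + 2) w (-2) (by simp; omega) (by omega)).comp
    (hid.pair (hlow.pair (hone.pair hv')))
  refine Comp.mono ?_ (by omega : 2 * (L + (16 * k + 55 * L + (8 * k + 11 * L + (2 * (8 * k + 11 * L + (200 * k + 1000 * S)) + L * 7)))) + 40 * S ≤ 1000 * k + 5000 * S)
  convert h1 using 1
  ext x : 1
  congr 1
  have h4 := one_le_level T x
  simp only [affine, w, Fintype.sum_sum_type, Sum.elim_inl, Sum.elim_inr]
  have h5 : ∑ i : Fin L, -(2 : ℤ) ^ ((i : ℕ) + 2) * ((oneHotLevel T x i * windowBit T x : Fin 2) : ℕ) =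
      -2 ^ ((leafOf T x).1 + 1) * (windowBit T x : ℕ) := by
    have : ∀ i : Fin L, -(2 : ℤ) ^ ((i : ℕ) + 2) * ((oneHotLevel T x i * windowBit T x : Fin 2) : ℕ) =
        (-(2 : ℤ) ^ ((i : ℕ) + 2) * (windowBit T x : ℕ)) * (oneHotLevel T x i : ℕ) := by
      intro i
      generalize oneHotLevel T x i = a
      generalize windowBit T x = b
      fin_cases a <;> fin_cases b <;> simp
    rw [Finset.sum_congr rfl fun i _ => this i, sum_oneHotLevel]
    simp only
    rw [show (leafOf T x).1 - 1 + 2 = (leafOf T x).1 + 1 by omega]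
  rw [h5, sum_val, sum_val, sum_oneHotLevel, mirror_eq]
  simp only
  rw [show (leafOf T x).1 - 1 + 2 = (leafOf T x).1 + 1 by omega]
  ring

theorem comp_reflectBits {k : ℕ} (h : ImplementableWith T.helperOperator k) :
    Comp (reflectBits T) (20000 * k + 100000 * (L + 3) ^ 2) := by
  have hS : L ≤ (L + 3) ^ 2 := by nlinarith
  have hS' : 9 ≤ (L + 3) ^ 2 := by nlinarith
  have hS2 : L * 22 ≤ 22 * (L + 3) ^ 2 := by nlinarith
  have hmir := comp_mirror T h
  generalize (L + 3) ^ 2 = S at *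
  have hid : Comp (fun x : Bits (Fin L) => x) L := by simpa using comp_id (ι := Fin L)
  -- Modulo 2 this is (1 + a)(1 + b) for the top digits a and b: it is 1 exactly if both vanish, the
  -- range test for `mirror`.
  let u : Bits (Fin (L + 2)) → Fin 2 := fun y => 1 + (y ⟨L, by omega⟩ +
    (y ⟨L + 1, by omega⟩ + y ⟨L, by omega⟩ * y ⟨L + 1, by omega⟩))
  have hu : CompBit u (1 + (1 + (1 + 7))) :=
    (CompBit.const 1).add ((CompBit.bit _).add ((CompBit.bit _).add (CompBit.mul _ _)))
  have hflag := Comp.comp hu hmir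
  have h1 := hid.pair (hmir.pair hflag)
  let κ : Type := Fin L ⊕ (Fin (L + 2) ⊕ Unit)
  let f : Bits κ → Fin 2 := fun c =>
    if hL : 0 < L then c (Sum.inl ⟨0, hL⟩) * c (Sum.inr (Sum.inr ())) else 0
  have hf : CompBit f 7 := by
    simp only [f]
    split_ifs
    · exact CompBit.mul _ _
    · exact (CompBit.const _).mono (by norm_num)
  have hidκ : Comp (fun x : Bits κ => x) (2 * L + 3) :=
    (Comp.reindex (id : κ → κ)).mono (by simp [κ]; omega)
  have h2 := (Comp.pair hidκ hf).comp h1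
  -- The digit x + f * (y + x) equals the mirrored digit y if the flag f is set and x otherwise.
  let g : Bits (κ ⊕ Unit) → Bits (Fin L) := fun c i => c (Sum.inl (Sum.inl i)) +
    (c (Sum.inr ()) * c (Sum.inl (Sum.inr (Sum.inl ⟨i, by omega⟩))) +
      c (Sum.inr ()) * c (Sum.inl (Sum.inl i)))
  have hg : Comp g (L * (1 + (7 + 7))) := by
    simpa only [Fintype.card_fin] using Comp.pi (f := g) fun i =>
      (CompBit.bit _).add ((CompBit.mul _ _).add (CompBit.mul _ _))
  refine Comp.mono (l := 20000 * k + 100000 * S) ?_ (show 2 * (2 * (L + (1000 * k + 5000 * S +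
    (2 * (1000 * k + 5000 * S) + (1 + (1 + (1 + 7)))))) + (2 * L + 3 + 7)) + L * (1 + (7 + 7)) ≤ _ by
    omega)
  convert hg.comp h2 using 1
  ext x i : 2
  simp only [g, f, u, dif_pos i.pos, Sum.elim_inl, Sum.elim_inr, bitsOf_castLE]
  have hr := bitsOf_in_range (mirror_bounds T x).1 (mirror_bounds T x).2
  have hx := digit_eq x ⟨0, i.pos⟩
  simp only [pow_zero, Nat.div_one] at hx
  rw [reflectBits, if_congr (and_congr (show val x % 2 = 1 ↔
    ((x ⟨0, i.pos⟩ : ℕ) = 1) by rw [hx]) hr.symm) rfl rfl]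
  generalize bitsOf (L + 2) (mirror T (val x)) ⟨L, _⟩ = a
  generalize bitsOf (L + 2) (mirror T (val x)) ⟨L + 1, _⟩ = b
  generalize x ⟨0, i.pos⟩ = c
  generalize bitsOf L (mirror T (val x)) = y
  have hi : (if (c : ℕ) = 1 ∧ a = 0 ∧ b = 0 then y else x) i =
      if (c : ℕ) = 1 ∧ a = 0 ∧ b = 0 then y i else x i := by split_ifs <;> rfl
  rw [hi]
  generalize x i = p
  generalize y i = q
  clear hr hx hi
  revert a b c p q
  decide

end Reflection

end Qubit

/-! ### Neighbouring leaves and the tiling of the frequencies by windows -/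

theorem List.IsChain.exists_next {α : Type*} {R : α → α → Prop} {l : List α} (h : l.IsChain R)
    {a : α} (ha : a ∈ l) : l.getLast? = some a ∨ ∃ b ∈ l, R a b := by
  induction l with
  | nil => simp at ha
  | cons x t ih =>
    cases t with
    | nil => simp at ha; simp [ha]
    | cons y t =>
      rw [List.isChain_cons_cons] at h
      rw [List.getLast?_cons_cons]
      rcases List.mem_cons.mp ha with rfl | ha
      · exact Or.inr ⟨y, by simp, h.1⟩
      · rcases ih h.2 ha with h' | ⟨b, hb, hab⟩
        · exact Or.inl h'
        · exact Or.inr ⟨b, List.mem_cons_of_mem _ hb, hab⟩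

theorem List.IsChain.exists_prev {α : Type*} {R : α → α → Prop} {l : List α} (h : l.IsChain R)
    {a : α} (ha : a ∈ l.tail) : ∃ b ∈ l, R b a := by
  induction l with
  | nil => simp at ha
  | cons x t ih =>
    cases t with
    | nil => simp at ha
    | cons y t =>
      rw [List.isChain_cons_cons] at h
      rcases List.mem_cons.mp ha with rfl | ha
      · exact ⟨x, by simp, h.1⟩
      · obtain ⟨b, hb, hab⟩ := ih h.2 ha
        exact ⟨b, List.mem_cons_of_mem _ hb, hab⟩

namespace WaveletTree

theorem leavesFrom_ne_nil {j : ℕ} (T : WaveletTree j) (m : ℕ) : T.leavesFrom m ≠ [] := by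
  induction T generalizing m with
  | leaf hj => simp [leavesFrom]
  | node l r ihl ihr => simp [leavesFrom, ihl]

theorem leavesFrom_head {j : ℕ} (T : WaveletTree j) (m : ℕ) (q : ℕ × ℕ)
    (h : (T.leavesFrom m).head? = some q) : q.2 * 2 ^ q.1 = m * 2 ^ j := by
  induction T generalizing m with
  | leaf hj => simp [leavesFrom] at h; simp [← h]
  | @node j l r ihl ihr =>
    rw [leavesFrom, List.head?_append_of_ne_nil _ (leavesFrom_ne_nil l _)] at h
    rw [ihl _ h]
    ring

theorem leavesFrom_getLast {j : ℕ} (T : WaveletTree j) (m : ℕ) (q : ℕ × ℕ)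
    (h : (T.leavesFrom m).getLast? = some q) : (q.2 + 1) * 2 ^ q.1 = (m + 1) * 2 ^ j := by
  induction T generalizing m with
  | leaf hj => simp [leavesFrom] at h; simp [← h]
  | @node j l r ihl ihr =>
    rw [leavesFrom, List.getLast?_append_of_ne_nil _ (leavesFrom_ne_nil r _)] at h
    rw [ihr _ h]
    ring

theorem leavesFrom_isChain {j : ℕ} (T : WaveletTree j) (m : ℕ) :
    (T.leavesFrom m).IsChain fun q r => (q.2 + 1) * 2 ^ q.1 = r.2 * 2 ^ r.1 := by
  induction T generalizing m with
  | leaf hj => simp [leavesFrom]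
  | @node j l r ihl ihr =>
    rw [leavesFrom, List.isChain_append]
    refine ⟨ihl _, ihr _, fun x hx y hy => ?_⟩
    rw [leavesFrom_getLast _ _ _ hx, leavesFrom_head _ _ _ hy]

/-- Neighbouring leaves of a wave atom admissible tree. -/
structure Neighbours (q r : ℕ × ℕ) : Prop where
  ends : (q.2 + 1) * 2 ^ q.1 = r.2 * 2 ^ r.1
  level : |(q.1 : ℤ) - (r.1 : ℤ)| ≤ 1
  up : r.1 = q.1 + 1 → Odd q.2 ∧ Odd r.2
  down : q.1 = r.1 + 1 → Even q.2 ∧ Even r.2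

variable {L : ℕ} {T : WaveletTree L}

theorem neighbours_isChain (h : T.WaveAtomAdmissible) : T.leaves.IsChain Neighbours := by
  have h1 := leavesFrom_isChain T 0
  rw [List.isChain_iff_getElem] at h1 ⊢
  unfold WaveAtomAdmissible at h
  rw [List.isChain_iff_getElem] at h
  exact fun i hi => ⟨h1 i hi, (h i hi).1, (h i hi).2.1, (h i hi).2.2⟩

theorem leaf_ext {q r : ℕ × ℕ} (hq : q ∈ T.leaves) (hr : r ∈ T.leaves) {p : ℕ}
    (hq1 : q.2 * 2 ^ q.1 ≤ p) (hq2 : p < (q.2 + 1) * 2 ^ q.1)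
    (hr1 : r.2 * 2 ^ r.1 ≤ p) (hr2 : p < (r.2 + 1) * 2 ^ r.1) : q = r := by
  rw [← leafFrom_eq T 0 q hq p hq1 hq2, ← leafFrom_eq T 0 r hr p hr1 hr2]

theorem exists_mem_head : ∃ q, T.leaves.head? = some q := by
  obtain ⟨a, t, h⟩ := List.exists_cons_of_ne_nil (leavesFrom_ne_nil T 0)
  exact ⟨a, by rw [leaves, h]; rfl⟩

theorem head_iff {q : ℕ × ℕ} : T.leaves.head? = some q ↔ q ∈ T.leaves ∧ q.2 = 0 := by
  constructor
  · intro h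
    refine ⟨List.mem_of_mem_head? h, ?_⟩
    have := leavesFrom_head T 0 q h
    simpa using this
  · rintro ⟨h1, h2⟩
    obtain ⟨r, hr⟩ := exists_mem_head (T := T)
    have h3 : r.2 = 0 := by simpa using leavesFrom_head T 0 r hr
    rw [hr, leaf_ext h1 (List.mem_of_mem_head? hr) (p := 0)]
    all_goals simp [h2, h3]

theorem getLast_iff {q : ℕ × ℕ} :
    T.leaves.getLast? = some q ↔ q ∈ T.leaves ∧ (q.2 + 1) * 2 ^ q.1 = 2 ^ L := by
  constructor
  · intro h
    refine ⟨List.mem_of_mem_getLast? h, ?_⟩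
    simpa using leavesFrom_getLast T 0 q h
  · rintro ⟨h1, h2⟩
    have hr := List.getLast?_eq_getLast_of_ne_nil (leavesFrom_ne_nil T 0)
    set r := (T.leavesFrom 0).getLast (leavesFrom_ne_nil T 0)
    have h3 : (r.2 + 1) * 2 ^ r.1 = 2 ^ L := by simpa using leavesFrom_getLast T 0 r hr
    have h4 : 0 < 2 ^ L := by positivity
    have h5 : 0 < 2 ^ q.1 := by positivity
    have h6 : 0 < 2 ^ r.1 := by positivity
    rw [leaves, hr, leaf_ext h1 (List.mem_of_mem_getLast? hr) (p := 2 ^ L - 1)]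
    · rw [add_one_mul] at h2; omega
    · omega
    · rw [add_one_mul] at h3; omega
    · omega

theorem Neighbours.ne_zero {q r : ℕ × ℕ} (h : Neighbours q r) : r.2 ≠ 0 := by
  intro h0
  have h1 := h.ends
  rw [h0, zero_mul] at h1
  have : 0 < (q.2 + 1) * 2 ^ q.1 := by positivity
  omega

theorem mem_tail_iff (h : T.WaveAtomAdmissible) {r : ℕ × ℕ} :
    r ∈ T.leaves.tail ↔ r ∈ T.leaves ∧ r.2 ≠ 0 := by
  constructor
  · intro hr
    obtain ⟨b, -, hb⟩ := (neighbours_isChain h).exists_prev hr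
    exact ⟨List.mem_of_mem_tail hr, hb.ne_zero⟩
  · rintro ⟨h1, h2⟩
    obtain ⟨a, t, ht⟩ := List.exists_cons_of_ne_nil (leavesFrom_ne_nil T 0)
    rw [leaves, ht] at h1 ⊢
    rcases List.mem_cons.mp h1 with rfl | h1
    · refine absurd ?_ h2
      exact (head_iff.mp (show T.leaves.head? = some r by rw [leaves, ht]; rfl)).2
    · exact h1

theorem exists_prev (h : T.WaveAtomAdmissible) {r : ℕ × ℕ} (hr : r ∈ T.leaves) (h0 : r.2 ≠ 0) :
    ∃ q ∈ T.leaves, Neighbours q r :=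
  (neighbours_isChain h).exists_prev ((mem_tail_iff h).mpr ⟨hr, h0⟩)

theorem exists_next (h : T.WaveAtomAdmissible) {q : ℕ × ℕ} (hq : q ∈ T.leaves) :
    T.leaves.getLast? = some q ∨ ∃ r ∈ T.leaves, Neighbours q r :=
  (neighbours_isChain h).exists_next hq

theorem one_le_of_mem {q : ℕ × ℕ} (hq : q ∈ T.leaves) : 1 ≤ q.1 := (level_bounds T 0 q hq).1

/-- The frequency at the left end of a leaf. -/
def center (q : ℕ × ℕ) : ℤ := ((q.2 * 2 ^ (q.1 - 1) : ℕ) : ℤ)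

/-- The radius of the blending window around the left end of a leaf. -/
def radius (q : ℕ × ℕ) : ℤ := (WaveAtom.muZero q.1 q.2 : ℤ)

theorem two_mul_center {q : ℕ × ℕ} (hq : 1 ≤ q.1) : 2 * center q = q.2 * 2 ^ q.1 := by
  obtain ⟨j, m⟩ := q
  obtain ⟨i, rfl⟩ : ∃ i, j = i + 1 := ⟨j - 1, by simp only at hq; omega⟩
  simp only [center, Nat.add_sub_cancel]
  push_cast
  ring

theorem center_nonneg (q : ℕ × ℕ) : 0 ≤ center q := by unfold center; positivity

theorem radius_nonneg (q : ℕ × ℕ) : 0 ≤ radius q := by unfold radius; positivity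

theorem two_pow_mod_three (j : ℕ) : 2 ^ j % 3 = 1 ∧ 2 ^ (j + 1) % 3 = 2 ∨
    2 ^ j % 3 = 2 ∧ 2 ^ (j + 1) % 3 = 1 := by
  induction j with
  | zero => simp
  | succ j ih =>
    rw [pow_succ 2 (j + 1)]
    omega

theorem radius_even {j m : ℕ} (hm : Even m) : radius (j, m) = ((2 ^ j / 3 : ℕ) : ℤ) := by
  rw [radius, WaveAtom.muZero, Nat.even_iff.mp hm, Nat.sub_zero]

theorem radius_odd {j m : ℕ} (hm : Odd m) : radius (j, m) = ((2 ^ (j - 1) / 3 : ℕ) : ℤ) := by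
  rw [radius, WaveAtom.muZero, Nat.odd_iff.mp hm]

/-- The radius is the integer part of a power of 2 divided by 3. Such a quotient is never an
integer, so the bound becomes a strict inequality in which the parity of the leaf enters linearly.
-/
theorem le_radius_iff {q : ℕ × ℕ} (hq : 1 ≤ q.1) (s : ℤ) :
    s ≤ radius q ↔ 6 * s + 2 ^ q.1 * (q.2 % 2 : ℕ) < 2 ^ (q.1 + 1) := by
  obtain ⟨j, m⟩ := q
  obtain ⟨i, rfl⟩ : ∃ i, j = i + 1 := ⟨j - 1, by simp only at hq; omega⟩
  have h := two_pow_mod_three i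
  simp only
  have e2 : (2 : ℤ) ^ (i + 1) = 2 * (2 ^ i : ℕ) := by push_cast; ring
  have e3 : (2 : ℤ) ^ (i + 1 + 1) = 4 * (2 ^ i : ℕ) := by push_cast; ring
  rcases Nat.even_or_odd m with hm | hm
  · rw [radius_even hm, Nat.even_iff.mp hm, e2, e3]
    rw [pow_succ] at h ⊢
    generalize 2 ^ i = x at *
    push_cast
    omega
  · rw [radius_odd hm, Nat.odd_iff.mp hm, e2, e3, Nat.add_sub_cancel]
    rw [pow_succ] at h
    generalize 2 ^ i = x at *
    push_cast
    omega

theorem center_add_radius_lt {q : ℕ × ℕ} (hq : 1 ≤ q.1) :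
    2 * (center q + radius q) < (q.2 + 1) * 2 ^ q.1 := by
  have h1 := (le_radius_iff hq (radius q)).mp le_rfl
  have h2 := two_mul_center hq
  have h3 : (0 : ℤ) ≤ 2 ^ q.1 * (q.2 % 2 : ℕ) := by positivity
  rw [pow_succ] at h1
  have h4 := radius_nonneg q
  nlinarith

theorem Neighbours.ends_int {q r : ℕ × ℕ} (h : Neighbours q r) :
    ((q.2 : ℤ) + 1) * 2 ^ q.1 = r.2 * 2 ^ r.1 := by exact_mod_cast h.ends

/-- The parities and levels of neighbouring leaves. -/
theorem Neighbours.cases {q r : ℕ × ℕ} (h : Neighbours q r) :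
    (r.1 = q.1 ∧ r.2 = q.2 + 1) ∨ (r.1 = q.1 + 1 ∧ Odd q.2 ∧ Odd r.2) ∨
      (q.1 = r.1 + 1 ∧ Even q.2 ∧ Even r.2) := by
  have h1 := abs_le.mp h.level
  rcases (by omega : r.1 = q.1 ∨ r.1 = q.1 + 1 ∨ q.1 = r.1 + 1) with h2 | h2 | h2
  · refine Or.inl ⟨h2, ?_⟩
    have := h.ends
    rw [h2] at this
    exact (Nat.eq_of_mul_eq_mul_right (by positivity) this).symm
  · exact Or.inr (Or.inl ⟨h2, h.up h2⟩)
  · exact Or.inr (Or.inr ⟨h2, h.down h2⟩)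

/-- The claim is `radius q` + `radius r` + 1 = 2^(j - 1) for the level j of q. In each admissible
case the two radii are the integer parts of 2^i / 3 and 2^(i + 1) / 3 with i + 1 = j; these powers
have residues 1 and 2 modulo 3 in some order, so the radii add up to (2^i + 2^(i + 1) - 3) / 3 = 2^i
- 1. The parity conditions of admissibility are what selects consecutive powers. -/
theorem Neighbours.windows {q r : ℕ × ℕ} (h : Neighbours q r) (hq : 1 ≤ q.1) (hr : 1 ≤ r.1) :
    center q + radius q + 1 = center r - radius r := by
  have h1 := two_mul_center hq
  have h2 := two_mul_center hr
  have h3 := h.ends_int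
  suffices h4 : 2 * (radius q + radius r + 1) = 2 ^ q.1 by linarith
  obtain ⟨j, m⟩ := q
  obtain ⟨j', m'⟩ := r
  obtain ⟨i, rfl⟩ : ∃ i, j = i + 1 := ⟨j - 1, by simp only at hq; omega⟩
  have h5 := two_pow_mod_three i
  have e : (2 : ℤ) ^ (i + 1) = 2 * (2 ^ i : ℕ) := by push_cast; ring
  have e' : (2 : ℕ) ^ (i + 1) = 2 * 2 ^ i := by ring
  simp only [e]
  rw [e'] at h5
  rcases h.cases with ⟨h6, h7⟩ | ⟨h6, h7, h8⟩ | ⟨h6, h7, h8⟩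
  · simp only at h6 h7
    subst h6 h7
    rcases Nat.even_or_odd m with hm | hm
    · rw [radius_even hm, radius_odd hm.add_one, e', Nat.add_sub_cancel]
      omega
    · rw [radius_odd hm, radius_even hm.add_one, e', Nat.add_sub_cancel]
      omega
  · simp only at h6 h7 h8
    subst h6
    rw [radius_odd h7, radius_odd h8, Nat.add_sub_cancel, Nat.add_sub_cancel, e']
    omega
  · simp only at h6 h7 h8
    obtain rfl : i = j' := by omega
    rw [radius_even h7, radius_even h8, e']
    omega

theorem leaf_lt_of_lt {q r : ℕ × ℕ} (hq : q ∈ T.leaves) (hr : r ∈ T.leaves)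
    (h : q.2 * 2 ^ q.1 < r.2 * 2 ^ r.1) : (q.2 + 1) * 2 ^ q.1 ≤ r.2 * 2 ^ r.1 := by
  by_contra hlt
  push Not at hlt
  have : q = r := leaf_ext hq hr h.le hlt le_rfl (by rw [add_one_mul]; simp)
  rw [this] at h
  exact lt_irrefl _ h

/-- The window of r begins directly after that of its left neighbour p, so q needs to be compared
with p only. If q is not p itself, it ends at or before `center p`. -/
theorem windows_disjoint (h : T.WaveAtomAdmissible) {q r : ℕ × ℕ} (hq : q ∈ T.leaves)
    (hr : r ∈ T.leaves) (hlt : q.2 * 2 ^ q.1 < r.2 * 2 ^ r.1) :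
    center q + radius q < center r - radius r := by
  have h0 : r.2 ≠ 0 := by
    rintro h0
    rw [h0, zero_mul] at hlt
    omega
  obtain ⟨p, hp, hpr⟩ := exists_prev h hr h0
  rw [← hpr.windows (one_le_of_mem hp) (one_le_of_mem hr)]
  rcases lt_trichotomy (q.2 * 2 ^ q.1) (p.2 * 2 ^ p.1) with h1 | h1 | h1
  · have h2 := leaf_lt_of_lt hq hp h1
    have h3 := center_add_radius_lt (one_le_of_mem hq)
    have h4 := two_mul_center (one_le_of_mem hp)
    zify at h2
    have := radius_nonneg p
    linarith
  · have : q = p := leaf_ext hq hp le_rfl (by rw [add_one_mul]; simp) h1.ge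
      (by rw [h1, add_one_mul]; simp)
    rw [this]
    omega
  · have h2 := leaf_lt_of_lt hp hq h1
    rw [hpr.ends] at h2
    omega

/-- `k` is in the blending window of the leaf `r`. -/
def InWindow (T : WaveletTree L) (r : ℕ × ℕ) (k : ℤ) : Prop :=
  r ∈ T.leaves ∧ r.2 ≠ 0 ∧ |k - center r| ≤ radius r

/-- `k` is a low frequency of the leftmost leaf, where it is straightened. -/
def InLowest (T : WaveletTree L) (q : ℕ × ℕ) (k : ℤ) : Prop :=
  q ∈ T.leaves ∧ q.2 = 0 ∧ k ≤ radius q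

/-- `k` is a high frequency of the rightmost leaf, where it is straightened. -/
def InHighest (T : WaveletTree L) (q : ℕ × ℕ) (k : ℤ) : Prop :=
  q ∈ T.leaves ∧ (q.2 + 1) * 2 ^ q.1 = 2 ^ L ∧ center q + radius q < k

theorem center_eq_zero {q : ℕ × ℕ} (h : q.2 = 0) : center q = 0 := by simp [center, h]

theorem eq_of_windows (h : T.WaveAtomAdmissible) {q r : ℕ × ℕ} (hq : q ∈ T.leaves)
    (hr : r ∈ T.leaves) {k : ℤ} (hq1 : center q - radius q ≤ k) (hq2 : k ≤ center q + radius q)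
    (hr1 : center r - radius r ≤ k) (hr2 : k ≤ center r + radius r) : q = r := by
  rcases lt_trichotomy (q.2 * 2 ^ q.1) (r.2 * 2 ^ r.1) with h1 | h1 | h1
  · have := windows_disjoint h hq hr h1
    omega
  · exact leaf_ext hq hr le_rfl (by rw [add_one_mul]; simp) h1.ge
      (by rw [h1, add_one_mul]; simp)
  · have := windows_disjoint h hr hq h1
    omega

theorem InWindow.bounds {r : ℕ × ℕ} {k : ℤ} (h : InWindow T r k) :
    center r - radius r ≤ k ∧ k ≤ center r + radius r := by
  have := abs_le.mp h.2.2
  constructor <;> linarith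

theorem InWindow.unique (h : T.WaveAtomAdmissible) {q r : ℕ × ℕ} {k : ℤ} (hq : InWindow T q k)
    (hr : InWindow T r k) : q = r :=
  eq_of_windows h hq.1 hr.1 hq.bounds.1 hq.bounds.2 hr.bounds.1 hr.bounds.2

theorem InWindow.not_inLowest (h : T.WaveAtomAdmissible) {q r : ℕ × ℕ} {k : ℤ}
    (hr : InWindow T r k) (hq : InLowest T q k) : False := by
  have h1 : q.2 * 2 ^ q.1 < r.2 * 2 ^ r.1 := by
    rw [hq.2.1, zero_mul]
    have := Nat.pos_of_ne_zero hr.2.1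
    positivity
  have h2 := windows_disjoint h hq.1 hr.1 h1
  have h3 := hr.bounds
  have h4 := center_eq_zero hq.2.1
  have h5 := hq.2.2
  omega

theorem InHighest.le_of_mem (h : T.WaveAtomAdmissible) {q r : ℕ × ℕ} {k : ℤ}
    (hq : InHighest T q k) (hr : r ∈ T.leaves) : center r + radius r < k := by
  rcases lt_trichotomy (q.2 * 2 ^ q.1) (r.2 * 2 ^ r.1) with h1 | h1 | h1
  · have h2 := leaf_lt_of_lt hq.1 hr h1
    rw [hq.2.1] at h2
    have h3 := (leavesFrom_range T 0 r hr).2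
    rw [zero_add, one_mul, add_one_mul] at h3
    have : 0 < 2 ^ r.1 := by positivity
    omega
  · have : q = r := leaf_ext hq.1 hr le_rfl (by rw [add_one_mul]; simp) h1.ge
      (by rw [h1, add_one_mul]; simp)
    rw [← this]
    exact hq.2.2
  · have h2 := windows_disjoint h hr hq.1 h1
    have h3 := hq.2.2
    have := radius_nonneg q
    omega

theorem InHighest.unique {q r : ℕ × ℕ} {k l : ℤ} (hq : InHighest T q k) (hr : InHighest T r l) :
    q = r := by
  have h1 := getLast_iff.mpr ⟨hq.1, hq.2.1⟩
  rw [getLast_iff.mpr ⟨hr.1, hr.2.1⟩] at h1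
  exact (Option.some.inj h1).symm

theorem InLowest.unique {q r : ℕ × ℕ} {k l : ℤ} (hq : InLowest T q k) (hr : InLowest T r l) :
    q = r := by
  have h1 := head_iff.mpr ⟨hq.1, hq.2.1⟩
  rw [head_iff.mpr ⟨hr.1, hr.2.1⟩] at h1
  exact (Option.some.inj h1).symm

/-- The windows of q and of its right neighbour are adjacent, so together they cover the stretch in
which the profile of q can be nonzero. At the two ends of the tree the straightened ranges take the
place of a window. -/
theorem location_of_leaf (h : T.WaveAtomAdmissible) {q : ℕ × ℕ} (hq : q ∈ T.leaves) {k : ℤ}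
    (h1 : center q - radius q ≤ k)
    (h2 : ∀ r ∈ T.leaves, Neighbours q r → k ≤ center r + radius r) :
    InLowest T q k ∨ InHighest T q k ∨ InWindow T q k ∨ ∃ r, Neighbours q r ∧ InWindow T r k := by
  by_cases hk : k ≤ center q + radius q
  · by_cases h0 : q.2 = 0
    · exact Or.inl ⟨hq, h0, by rw [center_eq_zero h0] at hk; omega⟩
    · exact Or.inr (Or.inr (Or.inl ⟨hq, h0, by rw [abs_le]; constructor <;> linarith⟩))
  · rcases exists_next h hq with h3 | ⟨r, hr, hqr⟩
    · exact Or.inr (Or.inl ⟨hq, (getLast_iff.mp h3).2, by omega⟩)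
    · refine Or.inr (Or.inr (Or.inr ⟨r, hqr, hr, hqr.ne_zero, ?_⟩))
      have h4 := hqr.windows (one_le_of_mem hq) (one_le_of_mem hr)
      have h5 := h2 r hr hqr
      rw [abs_le]
      constructor <;> linarith

theorem exists_location (h : T.WaveAtomAdmissible) {k : ℕ} (hk : 2 * k ≤ 2 ^ L) :
    (∃ q, InLowest T q k) ∨ (∃ q, InHighest T q k) ∨ ∃ r, InWindow T r k := by
  have hL : 0 < 2 ^ L := by positivity
  obtain ⟨q, hq, h1, h2⟩ : ∃ q ∈ T.leaves, 2 * center q ≤ 2 * k ∧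
      2 * (k : ℤ) ≤ (q.2 + 1) * 2 ^ q.1 := by
    -- The frequency k = 2^(L - 1) occurs only with a minus sign, at index 2^L - 1; index 2k would
    -- lie outside the tree.
    have hp := T.leafAt_spec (min (2 * k) (2 ^ L - 1)) (by omega)
    refine ⟨_, hp.1, ?_, ?_⟩
    · rw [two_mul_center (one_le_of_mem hp.1)]
      exact_mod_cast hp.2.1.trans (min_le_left _ _)
    · have h3 := hp.2.2
      have h4 : 2 * k ≤ ((T.leafAt (min (2 * k) (2 ^ L - 1))).2 + 1) *
        2 ^ (T.leafAt (min (2 * k) (2 ^ L - 1))).1 := by omega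
      exact_mod_cast h4
  have h3 := radius_nonneg q
  rcases location_of_leaf h hq (k := k) (by omega) (fun r hr hqr => by
    have h4 := hqr.ends_int
    rw [h4, ← two_mul_center (one_le_of_mem hr)] at h2
    have h5 := radius_nonneg r
    omega) with h4 | h4 | h4 | ⟨r, -, h4⟩
  · exact Or.inl ⟨q, h4⟩
  · exact Or.inr (Or.inl ⟨q, h4⟩)
  · exact Or.inr (Or.inr ⟨q, h4⟩)
  · exact Or.inr (Or.inr ⟨r, h4⟩)

theorem blendingLeaf_eq_some_iff (h : T.WaveAtomAdmissible) {k : ℕ} {r : ℕ × ℕ} :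
    WaveAtom.blendingLeaf T k = some r ↔ InWindow T r k := by
  have hsome : ∀ {q}, WaveAtom.blendingLeaf T k = some q → InWindow T q k := by
    intro q hq
    have h1 := List.mem_of_find?_eq_some hq
    have h2 := List.find?_some hq
    rw [mem_tail_iff h] at h1
    exact ⟨h1.1, h1.2, of_decide_eq_true h2⟩
  refine ⟨hsome, fun hr => ?_⟩
  rcases hf : WaveAtom.blendingLeaf T k with _ | q
  · rw [WaveAtom.blendingLeaf, List.find?_eq_none] at hf
    exact absurd (decide_eq_true hr.2.2) (hf r ((mem_tail_iff h).mpr ⟨hr.1, hr.2.1⟩))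
  · rw [(hsome hf).unique h hr]

/-- The block of r starts at index 2 * `center r`. At k = `center r` the frequency k, index 2k, is
therefore stored in r, and -k, index 2k - 1, in the left neighbour. This decides between weak and
strict inequalities here and in the three companion lemmas. -/
theorem leafAt_two_mul_of_le {r : ℕ × ℕ} {k : ℕ} (hr : InWindow T r k) (hk : center r ≤ k) :
    T.leafAt (2 * k) = r := by
  have h1 := one_le_of_mem hr.1
  have h2 := center_add_radius_lt h1
  have h3 := two_mul_center h1
  have h4 := hr.bounds.2
  exact leafFrom_eq T 0 r hr.1 _ (by zify; linarith) (by zify; linarith)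

theorem leafAt_two_mul_of_lt {q r : ℕ × ℕ} {k : ℕ} (hr : InWindow T r k) (hq : q ∈ T.leaves)
    (hqr : Neighbours q r) (hk : (k : ℤ) < center r) : T.leafAt (2 * k) = q := by
  have h1 := one_le_of_mem hq
  have h2 := one_le_of_mem hr.1
  have h3 := two_mul_center h1
  have h4 := two_mul_center h2
  have h5 := hr.bounds.1
  have h6 := hqr.windows h1 h2
  have h7 := radius_nonneg q
  have h8 := hqr.ends_int
  exact leafFrom_eq T 0 q hq _ (by zify; linarith) (by zify; linarith)

theorem leafAt_two_mul_sub_of_lt {r : ℕ × ℕ} {k : ℕ} (hr : InWindow T r k) (hk : center r < k) :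
    T.leafAt (2 * k - 1) = r := by
  have h1 := one_le_of_mem hr.1
  have h2 := center_add_radius_lt h1
  have h3 := two_mul_center h1
  have h4 := hr.bounds.2
  have h5 := center_nonneg r
  refine leafFrom_eq T 0 r hr.1 _ ?_ ?_
  · zify [(by omega : 1 ≤ 2 * k)]; linarith
  · zify [(by omega : 1 ≤ 2 * k)]; linarith

theorem leafAt_two_mul_sub_of_le {q r : ℕ × ℕ} {k : ℕ} (hr : InWindow T r k) (hq : q ∈ T.leaves)
    (hqr : Neighbours q r) (hk : (k : ℤ) ≤ center r) : T.leafAt (2 * k - 1) = q := by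
  have h1 := one_le_of_mem hq
  have h2 := one_le_of_mem hr.1
  have h3 := two_mul_center h1
  have h4 := two_mul_center h2
  have h5 := hr.bounds.1
  have h6 := hqr.windows h1 h2
  have h7 := radius_nonneg q
  have h8 := hqr.ends_int
  have h9 := center_nonneg q
  refine leafFrom_eq T 0 q hq _ ?_ ?_
  · zify [(by omega : 1 ≤ 2 * k)]; linarith
  · zify [(by omega : 1 ≤ 2 * k)]; linarith

end WaveletTree

/-! ### The reflection is an involution that preserves the windows -/

namespace Qubit

open Matrix WaveletTree

section Reflect

variable {L : ℕ} {T : WaveletTree L}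

/-- The offset of index 2k - 1 in its block, increased by 1, is 2 * (k - center), so the test is
`le_radius_iff` with s = k - center. -/
theorem inLeftWindow_iff {k : ℕ} (hk : 1 ≤ k) (hk2 : 2 * k ≤ 2 ^ L) :
    inLeftWindow T (2 * k - 1) ↔
      (k : ℤ) ≤ center (T.leafAt (2 * k - 1)) + radius (T.leafAt (2 * k - 1)) := by
  have hp : 2 * k - 1 < 2 ^ L := by omega
  obtain ⟨hq, -, -⟩ := T.leafAt_spec (2 * k - 1) hp
  have h1 := T.leafAt_div hp
  rw [inLeftWindow]
  generalize T.leafAt (2 * k - 1) = q at *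
  have h3 := two_mul_center (one_le_of_mem hq)
  have h4 := Nat.div_add_mod (2 * k - 1) (2 ^ q.1)
  rw [h1] at h4
  have h5 : (2 * (k : ℤ)) = q.2 * 2 ^ q.1 + ((2 * k - 1) % 2 ^ q.1 : ℕ) + 1 := by
    have : 2 * k = 2 ^ q.1 * q.2 + (2 * k - 1) % 2 ^ q.1 + 1 := by omega
    rw [mul_comm (q.2 : ℤ)]
    exact_mod_cast this
  rw [← sub_le_iff_le_add', le_radius_iff (one_le_of_mem hq)]
  generalize (2 * k - 1) % 2 ^ q.1 = l at *
  zify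
  constructor <;> intro h <;> linarith

theorem mirror_odd {k : ℕ} (hk : 1 ≤ k) (hk2 : 2 * k ≤ 2 ^ L) :
    mirror T (2 * k - 1) = 4 * center (T.leafAt (2 * k - 1)) - 2 * k - 1 +
      if inLeftWindow T (2 * k - 1) then 0 else 2 ^ ((T.leafAt (2 * k - 1)).1 + 1) := by
  have hp : 2 * k - 1 < 2 ^ L := by omega
  obtain ⟨hq, -, -⟩ := T.leafAt_spec (2 * k - 1) hp
  have h1 := T.leafAt_div hp
  rw [mirror]
  congr 1
  generalize T.leafAt (2 * k - 1) = q at *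
  have h3 := two_mul_center (one_le_of_mem hq)
  have h4 := Nat.div_add_mod (2 * k - 1) (2 ^ q.1)
  rw [h1] at h4
  have h5 : (2 * (k : ℤ)) = q.2 * 2 ^ q.1 + ((2 * k - 1) % 2 ^ q.1 : ℕ) + 1 := by
    have : 2 * k = 2 ^ q.1 * q.2 + (2 * k - 1) % 2 ^ q.1 + 1 := by omega
    rw [mul_comm (q.2 : ℤ)]
    exact_mod_cast this
  have h6 : ((2 * k - 1 : ℕ) : ℤ) = 2 * k - 1 := by omega
  linarith

theorem _root_.WaveletTree.InWindow.range (h : T.WaveAtomAdmissible) {r : ℕ × ℕ} {k : ℤ}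
    (hr : InWindow T r k) : 1 ≤ k ∧ 2 * k + 2 ≤ 2 ^ L := by
  obtain ⟨q, hq, hqr⟩ := exists_prev h hr.1 hr.2.1
  have h1 := hqr.windows (one_le_of_mem hq) (one_le_of_mem hr.1)
  have h2 := center_nonneg q
  have h3 := radius_nonneg q
  have h4 := hr.bounds
  refine ⟨by omega, ?_⟩
  have h5 := center_add_radius_lt (one_le_of_mem hr.1)
  have h6 := (leavesFrom_range T 0 r hr.1).2
  rw [zero_add, one_mul] at h6
  zify at h6
  have h7 : 1 ≤ L := (one_le_of_mem hr.1).trans (level_bounds T 0 r hr.1).2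
  obtain ⟨l, rfl⟩ : ∃ l, L = l + 1 := ⟨L - 1, by omega⟩
  rw [pow_succ] at h6 ⊢
  omega

theorem _root_.WaveletTree.InWindow.reflect {r : ℕ × ℕ} {k : ℤ} (hr : InWindow T r k) :
    InWindow T r (2 * center r - k) :=
  ⟨hr.1, hr.2.1, by rw [← abs_neg]; convert hr.2.2 using 2; ring⟩

/-- On either side of the center the mirror is the same point: index 2k - 1 lies in r and is
reflected at its left end, or it lies in the left neighbour and is reflected at its right end. -/
theorem mirror_window (h : T.WaveAtomAdmissible) {k : ℕ} {r : ℕ × ℕ} (hr : InWindow T r k) :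
    mirror T (2 * k - 1) = 2 * (2 * center r - k) - 1 := by
  have h1 := hr.range h
  have hk : 1 ≤ k := by omega
  have hk2 : 2 * k ≤ 2 ^ L := by zify; omega
  rw [mirror_odd hk hk2]
  rcases le_or_gt (k : ℤ) (center r) with hkr | hkr
  · obtain ⟨q, hq, hqr⟩ := exists_prev h hr.1 hr.2.1
    have hl := leafAt_two_mul_sub_of_le hr hq hqr hkr
    rw [if_neg, hl]
    · have h2 := two_mul_center (one_le_of_mem hr.1)
      have h3 := two_mul_center (one_le_of_mem hq)
      have h4 := hqr.ends_int
      rw [pow_succ]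
      linarith
    · rw [inLeftWindow_iff hk hk2, hl]
      have h2 := hqr.windows (one_le_of_mem hq) (one_le_of_mem hr.1)
      have h3 := hr.bounds
      omega
  · have hl := leafAt_two_mul_sub_of_lt hr hkr
    rw [if_pos, hl]
    · ring
    · rw [inLeftWindow_iff hk hk2, hl]
      exact hr.bounds.2

theorem mirror_inLowest {k : ℕ} (hk : 1 ≤ k) {q : ℕ × ℕ} (hq : InLowest T q k) :
    mirror T (2 * k - 1) < 0 := by
  have h1 := center_add_radius_lt (one_le_of_mem hq.1)
  have h2 := center_eq_zero hq.2.1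
  have h3 := hq.2.2
  have h4 := (leavesFrom_range T 0 q hq.1).2
  rw [zero_add, one_mul] at h4
  have hk2 : 2 * k ≤ 2 ^ L := by zify at h4 ⊢; linarith
  have hl : T.leafAt (2 * k - 1) = q := by
    refine leafFrom_eq T 0 q hq.1 _ (by simp [hq.2.1]) ?_
    zify [(by omega : 1 ≤ 2 * k)]; linarith
  rw [mirror_odd hk hk2, if_pos, hl]
  · omega
  · rw [inLeftWindow_iff hk hk2, hl]
    omega

theorem mirror_inHighest {k : ℕ} (hk2 : 2 * k ≤ 2 ^ L) {q : ℕ × ℕ} (hq : InHighest T q k) :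
    mirror T (2 * k - 1) = 2 ^ (L + 1) - 2 * k - 1 := by
  have h2 := center_nonneg q
  have h3 := radius_nonneg q
  have h4 := hq.2.2
  have hk : 1 ≤ k := by omega
  have h5 := two_mul_center (one_le_of_mem hq.1)
  have hl : T.leafAt (2 * k - 1) = q := by
    refine leafFrom_eq T 0 q hq.1 _ ?_ (by rw [hq.2.1]; omega)
    zify [(by omega : 1 ≤ 2 * k)]; linarith
  rw [mirror_odd hk hk2, if_neg, hl]
  · have h6 : ((q.2 : ℤ) + 1) * 2 ^ q.1 = 2 ^ L := by exact_mod_cast hq.2.1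
    rw [pow_succ, pow_succ]
    linarith
  · rw [inLeftWindow_iff hk hk2, hl]
    omega

theorem reflectBits_of_even {x : Bits (Fin L)} {k : ℕ} (hx : val x = 2 * k) :
    reflectBits T x = x := by
  rw [reflectBits, if_neg]
  omega

theorem val_reflectBits (h : T.WaveAtomAdmissible) {x : Bits (Fin L)} {k : ℕ}
    (hx : val x = 2 * k - 1) {r : ℕ × ℕ} (hr : InWindow T r k) :
    (val (reflectBits T x) : ℤ) = 2 * (2 * center r - k) - 1 := by
  have h1 := hr.range h
  have h2 := hr.reflect.range h
  have h3 := mirror_window h hr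
  rw [reflectBits, hx, h3, if_pos ⟨by omega, by omega, by omega⟩, val_bitsOf,
    Int.emod_eq_of_lt (by omega) (by omega)]

theorem reflectBits_of_notWindow (h : T.WaveAtomAdmissible) {x : Bits (Fin L)} {k : ℕ}
    (hx : (val x + 1) / 2 = k) (hr : ∀ r, ¬ InWindow T r k) : reflectBits T x = x := by
  rcases Nat.even_or_odd' (val x) with ⟨c, hc | hc⟩
  · exact reflectBits_of_even hc
  · have hk : 1 ≤ k := by omega
    have hx' : val x = 2 * k - 1 := by omega
    have hlt := val_lt x
    have h2 : L ≠ 0 := by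
      rintro rfl
      simp at hlt
      omega
    have h3 : 2 ^ L = 2 * 2 ^ (L - 1) := by rw [← pow_succ']; congr 1; omega
    have hk2 : 2 * k ≤ 2 ^ L := by omega
    rcases exists_location h hk2 with ⟨q, hq⟩ | ⟨q, hq⟩ | ⟨r, hr'⟩
    · have := mirror_inLowest hk hq
      rw [reflectBits, if_neg]
      rw [hx']
      omega
    · have h4 := mirror_inHighest hk2 hq
      rw [reflectBits]
      -- The mirror image 2^(L + 1) - 2k - 1 is below 2^L only for k = 2^(L - 1), and then it is the
      -- index itself.
      split_ifs with h5
      · rw [hx', h4] at h5 ⊢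
        zify at h3 hk2
        have h6 : (2 ^ (L + 1) - 2 * k - 1 : ℤ) = val x := by
          rw [hx']
          zify [(by omega : 1 ≤ 2 * k)]
          rw [pow_succ] at h5 ⊢
          omega
        rw [h6, bitsOf_val]
      · rfl
    · exact absurd hr' (hr r)

/-- Windows are symmetric about their centers, so a reflected index lies in the window of the same
leaf and is sent back. As its own inverse, the map can be performed in place. -/
theorem reflectBits_reflectBits (h : T.WaveAtomAdmissible) (x : Bits (Fin L)) :
    reflectBits T (reflectBits T x) = x := by
  by_cases hw : ∃ r, InWindow T r ((val x + 1) / 2 : ℕ)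
  · obtain ⟨r, hr⟩ := hw
    rcases Nat.even_or_odd' (val x) with ⟨c, hc | hc⟩
    · rw [reflectBits_of_even hc, reflectBits_of_even hc]
    · have h1 := val_reflectBits h (x := x) (by omega) hr
      have h2 := hr.reflect
      have h3 := h2.range h
      obtain ⟨l, hl⟩ : ∃ l : ℕ, (l : ℤ) = 2 * center r - ((val x + 1) / 2 : ℕ) :=
        ⟨(2 * center r - ((val x + 1) / 2 : ℕ)).toNat, Int.toNat_of_nonneg (by omega)⟩
      rw [← hl] at h2 h1
      have h4 := val_reflectBits h (x := reflectBits T x) (k := l) (by omega) h2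
      apply val_injective
      omega
  · push Not at hw
    rw [reflectBits_of_notWindow h rfl hw, reflectBits_of_notWindow h rfl hw]

theorem impl_reflectBits (h : T.WaveAtomAdmissible) {k : ℕ}
    (hk : ImplementableWith T.helperOperator k) :
    Impl (pm (reflectBits T)) (40000 * k + 200000 * (L + 3) ^ 2 + 2 * L) := by
  have h1 := comp_reflectBits T hk
  refine (h1.impl_pm h1 (reflectBits_reflectBits h)).mono ?_
  rw [Fintype.card_fin]
  omega

end Reflect

/-! ### Columns of the blending matrix -/

section Blending

variable {L : ℕ} {T : WaveletTree L}

theorem onQubits_blendingMatrix (g : ℝ → ℝ) (y x : Bits (Fin L)) :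
    onQubits (WaveAtom.blendingMatrix T g) y x = if (val y + 1) / 2 = (val x + 1) / 2 then
      match WaveAtom.blendingLeaf T ((val y + 1) / 2) with
      | some (j, m) =>
        if y = x then WaveAtom.gMinus g j m (((val y + 1) / 2 : ℕ) - center (j, m))
        else WaveAtom.gPlus g j m (((val y + 1) / 2 : ℕ) - center (j, m))
      | none => if y = x then 1 else 0
    else 0 := by
  simp only [onQubits, submatrix_apply, WaveAtom.blendingMatrix, of_apply, EmbeddingLike.apply_eq_iff_eq]
  rfl

theorem sum_blending_of_notWindow (h : T.WaveAtomAdmissible) (g : ℝ → ℝ) (F : Bits (Fin L) → ℂ)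
    {x : Bits (Fin L)} (hw : ∀ r, ¬ InWindow T r ((val x + 1) / 2 : ℕ)) :
    ∑ y, F y * onQubits (WaveAtom.blendingMatrix T g) y x = F x := by
  have hb : WaveAtom.blendingLeaf T ((val x + 1) / 2) = none := by
    rw [Option.eq_none_iff_forall_ne_some]
    intro r hr
    exact hw r ((blendingLeaf_eq_some_iff h).mp hr)
  rw [Finset.sum_eq_single x]
  · rw [onQubits_blendingMatrix, if_pos rfl, hb]
    simp
  · intro y _ hy
    rw [onQubits_blendingMatrix]
    split_ifs with h1
    · rw [h1, hb]
      simp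
    · simp
  · simp

theorem sum_blending_of_window (h : T.WaveAtomAdmissible) (g : ℝ → ℝ) (F : Bits (Fin L) → ℂ)
    {x z : Bits (Fin L)} (hz : (val z + 1) / 2 = (val x + 1) / 2) (hzx : z ≠ x) {r : ℕ × ℕ}
    (hr : InWindow T r ((val x + 1) / 2 : ℕ)) :
    ∑ y, F y * onQubits (WaveAtom.blendingMatrix T g) y x =
      F x * WaveAtom.gMinus g r.1 r.2 (((val x + 1) / 2 : ℕ) - center r) +
      F z * WaveAtom.gPlus g r.1 r.2 (((val x + 1) / 2 : ℕ) - center r) := by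
  have hb := (blendingLeaf_eq_some_iff h).mpr hr
  rw [Finset.sum_eq_add x z hzx.symm]
  · rw [onQubits_blendingMatrix, onQubits_blendingMatrix, if_pos rfl, hz, if_pos rfl, hb]
    simp [hzx]
  · intro y _ hy
    rw [onQubits_blendingMatrix, if_neg, mul_zero]
    intro h1
    have h2 : val y ≠ val x := fun h => hy.1 (val_injective h)
    have h3 : val y ≠ val z := fun h => hy.2 (val_injective h)
    have h4 : val z ≠ val x := fun h => hzx (val_injective h)
    omega
  · simp
  · simp

/-- Substituting the reflected index in the sum shows that conjugation by R only relabels: column x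
blends the columns of `W` at the reflected indices of one block of `G`. -/
theorem reflected_blending (h : T.WaveAtomAdmissible) (W G : Op (Fin L)) (y x : Bits (Fin L)) :
    (W * (pm (reflectBits T) * (G * pm (reflectBits T)))) y x =
      ∑ t, W y (reflectBits T t) * G t (reflectBits T x) := by
  have hinv := reflectBits_reflectBits h
  have h1 : ∀ t, (pm (reflectBits T) * (G * pm (reflectBits T))) t x =
      G (reflectBits T t) (reflectBits T x) := by
    intro t
    rw [Matrix.mul_apply, Finset.sum_eq_single (reflectBits T t)]
    · rw [pm, of_apply, if_pos (hinv t).symm, one_mul, Matrix.mul_apply,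
        Finset.sum_eq_single (reflectBits T x)]
      · simp
      · intro u _ hu
        rw [of_apply, if_neg hu, mul_zero]
      · simp
    · intro u _ hu
      rw [pm, of_apply, if_neg, zero_mul]
      intro h2
      exact hu (by rw [h2, hinv])
    · simp
  rw [Matrix.mul_apply, ← Equiv.sum_comp (Function.Involutive.toPerm (reflectBits T) hinv)]
  refine Finset.sum_congr rfl fun t _ => ?_
  change W y (reflectBits T t) * (pm (reflectBits T) * (G * pm (reflectBits T))) (reflectBits T t) x = _
  rw [h1, hinv]

end Blending

end Qubit

/-! ### Supports and symmetries of the wave packets -/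

namespace WaveAtom

open Complex WaveletTree
open scoped ComplexConjugate

section Profile

/-- The complex amplitude of a straightened wave packet at the nonnegative frequency `k`. -/
noncomputable def amplitude (q : ℕ × ℕ) (k : ℤ) : ℂ :=
  ((1 / Real.sqrt (2 ^ q.1) : ℝ) : ℂ) * exp (-(I * Real.pi * k / 2 ^ q.1)) * exp (I * alpha q.2)

theorem straightened_of_nonneg {q : ℕ × ℕ} {k : ℤ} (hk : 0 ≤ k) :
    straightened q.1 q.2 k = amplitude q k := by
  rw [straightened, amplitude, if_neg (not_lt.mpr hk), one_mul]

theorem straightened_neg {q : ℕ × ℕ} {k : ℤ} (hk : 0 < k) :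
    straightened q.1 q.2 (-k) = conj (amplitude q k) := by
  rw [straightened, amplitude, if_pos (by omega)]
  simp only [map_mul, ← exp_conj, conj_ofReal, map_neg, map_div₀, conj_I, map_pow, map_intCast]
  have : conj (2 : ℂ) = 2 := Complex.conj_ofNat 2
  rw [this]
  congr 3
  · push_cast
    ring
  · ring

/-- The profile of the leaf `q` at the frequency `k`. -/
noncomputable def profile (g : ℝ → ℝ) (q : ℕ × ℕ) (k : ℤ) : ℝ :=
  g ((-1) ^ q.2 * (2 * Real.pi * (k / 2 ^ q.1) - 2 * alpha q.2))

/-- The profile of the leaf `q` at the frequency `-k`. -/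
noncomputable def mirrorProfile (g : ℝ → ℝ) (q : ℕ × ℕ) (k : ℤ) : ℝ :=
  g ((-1) ^ (q.2 + 1) * (2 * Real.pi * (k / 2 ^ q.1) + 2 * alpha q.2))

theorem psiHat_eq (g : ℝ → ℝ) {q : ℕ × ℕ} {k : ℤ} (h : mirrorProfile g q k = 0) :
    psiHat g q.1 q.2 k = amplitude q k * profile g q k := by
  rw [mirrorProfile] at h
  rw [psiHat, psiHatZero, h, amplitude, profile]
  push_cast
  rw [mul_zero, add_zero, ← mul_div_assoc]
  ring

theorem psiHat_neg (g : ℝ → ℝ) (j m : ℕ) (x : ℝ) : psiHat g j m (-x) = conj (psiHat g j m x) := by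
  have h1 : (-1 : ℝ) ^ m * (2 * Real.pi * (-x / 2 ^ j) - 2 * alpha m) =
      (-1) ^ (m + 1) * (2 * Real.pi * (x / 2 ^ j) + 2 * alpha m) := by ring
  have h2 : (-1 : ℝ) ^ (m + 1) * (2 * Real.pi * (-x / 2 ^ j) + 2 * alpha m) =
      (-1) ^ m * (2 * Real.pi * (x / 2 ^ j) - 2 * alpha m) := by ring
  rw [psiHat, psiHat, psiHatZero, psiHatZero, h1, h2]
  simp only [map_mul, map_add, ← exp_conj, conj_ofReal, map_neg, conj_I]
  push_cast
  ring_nf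

theorem psiTilde_neg {L : ℕ} (T : WaveletTree L) (g : ℝ → ℝ) {q : ℕ × ℕ} {k : ℤ} (hk : 0 < k) :
    psiTilde T g q.1 q.2 (-k) = conj (psiTilde T g q.1 q.2 k) := by
  rw [psiTilde, psiTilde, abs_neg, straightened_neg hk, straightened_of_nonneg hk.le, Int.cast_neg,
    psiHat_neg]
  split_ifs <;> rfl

variable {g : ℝ → ℝ}

theorem _root_.IsWaveAtomProfile.bounds (hg : IsWaveAtomProfile g) {a : ℝ} (h : g (Real.pi * a) ≠ 0) :
    -7 < 6 * a ∧ 6 * a < 5 := by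
  obtain ⟨h1, h2⟩ := hg.support_subset (Function.mem_support.mpr h)
  have hp := Real.pi_pos
  constructor
  · by_contra hn
    push Not at hn
    nlinarith
  · by_contra hn
    push Not at hn
    nlinarith

/-- At k ≥ 0 the argument of g in the bump at negative frequencies is ± π (2k / 2^j + m + 1/2), with
plus for odd m. It can lie in the support only for m = 0 and k < 2^j / 3, and those frequencies of
the leftmost leaf are straightened. -/
theorem mirrorProfile_eq_zero (hg : IsWaveAtomProfile g) {q : ℕ × ℕ} {k : ℤ} (hk : 0 ≤ k)
    (h : q.2 = 0 → radius q < k) : mirrorProfile g q k = 0 := by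
  obtain ⟨j, m⟩ := q
  by_contra hne
  have hk' : (0 : ℝ) ≤ k := by exact_mod_cast hk
  have h0 : (0 : ℝ) ≤ k / 2 ^ j := by positivity
  rw [mirrorProfile, alpha] at hne
  simp only at hne
  rcases Nat.even_or_odd m with hm | hm
  · rw [hm.add_one.neg_one_pow] at hne
    have h1 := (hg.bounds (a := -(2 * (k / 2 ^ j) + (m + 1 / 2))) (by convert hne using 2; ring)).1
    have h2 : m = 0 := by
      by_contra hm0
      have : (1 : ℝ) ≤ m := by exact_mod_cast Nat.one_le_iff_ne_zero.mpr hm0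
      linarith
    have h3 := h h2
    subst h2
    rw [radius_even hm] at h3
    have h4 : (k : ℝ) / 2 ^ j < 1 / 3 := by push_cast at h1; linarith
    rw [div_lt_iff₀ (by positivity)] at h4
    have h5 : 3 * k < (2 ^ j : ℕ) := by
      have : (3 * k : ℝ) < 2 ^ j := by linarith
      exact_mod_cast this
    omega
  · rw [hm.add_one.neg_one_pow, one_mul] at hne
    have h1 := (hg.bounds (a := 2 * (k / 2 ^ j) + (m + 1 / 2)) (by convert hne using 2; ring)).2
    have : (1 : ℝ) ≤ m := by exact_mod_cast hm.pos
    linarith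

theorem profile_eq (g : ℝ → ℝ) {q : ℕ × ℕ} (hq : 1 ≤ q.1) (k : ℤ) : profile g q k =
    g ((-1) ^ q.2 * (2 * Real.pi * (k - center q : ℤ) / 2 ^ q.1 - Real.pi / 2)) := by
  have h : 2 * (center q : ℝ) = q.2 * 2 ^ q.1 := by exact_mod_cast two_mul_center hq
  have h2 : (2 : ℝ) ^ q.1 ≠ 0 := by positivity
  rw [profile, alpha]
  congr 2
  push_cast
  field_simp
  linear_combination 2 * h

theorem profile_support (hg : IsWaveAtomProfile g) {q : ℕ × ℕ} (hq : 1 ≤ q.1) {k : ℤ}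
    (h : profile g q k ≠ 0) :
    6 * (center q - k) + 2 ^ q.1 * (q.2 % 2 : ℕ) < 2 ^ (q.1 + 1) ∧
      6 * (k - center q) < (4 + (q.2 % 2 : ℕ)) * 2 ^ q.1 := by
  rw [profile_eq g hq] at h
  obtain ⟨j, m⟩ := q
  simp only at h hq ⊢
  generalize center (j, m) = c at *
  have hj : (0 : ℝ) < 2 ^ j := by positivity
  have h3 : ((k - c : ℤ) : ℝ) = (k - c : ℤ) / 2 ^ j * 2 ^ j := by field_simp
  set a : ℝ := (k - c : ℤ) / 2 ^ j with ha
  rw [mul_div_assoc, ← ha] at h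
  rcases Nat.even_or_odd m with hm | hm
  · rw [hm.neg_one_pow, one_mul] at h
    obtain ⟨h1, h2⟩ := hg.bounds (a := 2 * a - 1 / 2) (by convert h using 2; ring)
    rw [Nat.even_iff.mp hm]
    have h4 : (6 * (c - k) : ℝ) < 2 * 2 ^ j := by push_cast at h3; nlinarith
    have h5 : (6 * (k - c) : ℝ) < 4 * 2 ^ j := by push_cast at h3; nlinarith
    have h4' : 6 * (c - k) < 2 * 2 ^ j := by exact_mod_cast h4
    have h5' : 6 * (k - c) < 4 * 2 ^ j := by exact_mod_cast h5
    rw [pow_succ]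
    constructor <;> push_cast <;> linarith
  · rw [hm.neg_one_pow] at h
    obtain ⟨h1, h2⟩ := hg.bounds (a := -(2 * a - 1 / 2)) (by convert h using 2; ring)
    rw [Nat.odd_iff.mp hm]
    have h4 : (6 * (c - k) : ℝ) < 2 ^ j := by push_cast at h3; nlinarith
    have h5 : (6 * (k - c) : ℝ) < 5 * 2 ^ j := by push_cast at h3; nlinarith
    have h4' : 6 * (c - k) < 2 ^ j := by exact_mod_cast h4
    have h5' : 6 * (k - c) < 5 * 2 ^ j := by exact_mod_cast h5
    rw [pow_succ]
    constructor <;> push_cast <;> linarith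

theorem lower_of_profile (hg : IsWaveAtomProfile g) {q : ℕ × ℕ} (hq : 1 ≤ q.1) {k : ℤ}
    (h : profile g q k ≠ 0) : center q - radius q ≤ k := by
  have h1 := (le_radius_iff hq (center q - k)).mpr (profile_support hg hq h).1
  linarith

/-- The right flank of q ends inside the window of its right neighbour; in each admissible
combination of level and parity the support of g gives exactly the bound of `le_radius_iff`. -/
theorem upper_of_profile (hg : IsWaveAtomProfile g) {q r : ℕ × ℕ} (hq : 1 ≤ q.1) (hr : 1 ≤ r.1)
    (hqr : Neighbours q r) {k : ℤ} (h : profile g q k ≠ 0) : k ≤ center r + radius r := by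
  have h1 := (profile_support hg hq h).2
  suffices h2 : k - center r ≤ radius r by linarith
  rw [le_radius_iff hr]
  have h3 := hqr.ends_int
  rw [← two_mul_center hr, add_one_mul, ← two_mul_center hq] at h3
  rw [pow_succ]
  have h0 : (0 : ℤ) < 2 ^ q.1 := by positivity
  rcases hqr.cases with ⟨h4, h5⟩ | ⟨h4, h5, h6⟩ | ⟨h4, h5, h6⟩
  · rw [h4, h5]
    rcases Nat.mod_two_eq_zero_or_one q.2 with h6 | h6
    · rw [h6] at h1
      rw [show (q.2 + 1) % 2 = 1 by omega]
      push_cast at h1 ⊢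
      linarith
    · rw [h6] at h1
      rw [show (q.2 + 1) % 2 = 0 by omega]
      push_cast at h1 ⊢
      linarith
  · rw [Nat.odd_iff.mp h5] at h1
    rw [Nat.odd_iff.mp h6, h4, pow_succ]
    push_cast at h1 ⊢
    linarith
  · rw [Nat.even_iff.mp h5] at h1
    rw [Nat.even_iff.mp h6]
    rw [h4, pow_succ] at h1 h3
    push_cast at h1 ⊢
    linarith

/-- The profile of the left neighbour of the leaf `r` is the mirror image of that of `r`. -/
theorem profile_of_neighbours (hg : IsWaveAtomProfile g) {q r : ℕ × ℕ} (hq : 1 ≤ q.1)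
    (hr : 1 ≤ r.1) (hqr : Neighbours q r) {k : ℤ} (hk : |k - center r| ≤ radius r) :
    profile g q k = profile g r (2 * center r - k) := by
  have h3 := hqr.ends_int
  rw [← two_mul_center hr, add_one_mul, ← two_mul_center hq] at h3
  have h4 := (abs_le.mp hk).1
  have h5 := (abs_le.mp hk).2
  have h6 := (le_radius_iff hr (k - center r)).mp h5
  have h7 := (le_radius_iff hr (center r - k)).mp (by linarith)
  have hp := Real.pi_pos
  rw [profile_eq g hq, profile_eq g hr]
  have h3' : 2 * (center q : ℝ) + 2 ^ q.1 = 2 * center r := by exact_mod_cast h3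
  have hz : (2 : ℝ) ^ q.1 ≠ 0 := by positivity
  have e1 : 2 * Real.pi * (k - center q : ℤ) / 2 ^ q.1 - Real.pi / 2 =
      2 * Real.pi * (k - center r : ℤ) / 2 ^ q.1 + Real.pi / 2 := by
    push_cast
    field_simp
    linear_combination (-2) * h3'
  have e2 : (2 * center r - k - center r : ℤ) = -(k - center r) := by ring
  rw [e1, e2]
  rcases hqr.cases with ⟨h8, h9⟩ | ⟨h8, h9, h10⟩ | ⟨h8, h9, h10⟩
  -- On equal levels the parities differ, and the two arguments of g coincide.
  · rw [h8, h9, pow_succ]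
    congr 1
    push_cast
    ring
  · rw [Nat.odd_iff.mp h10, pow_succ] at h6 h7
    generalize k - center r = s at *
    have h7' : 6 * (-s) + 2 ^ r.1 * ((1 : ℕ) : ℤ) < 2 ^ r.1 * 2 := by linarith
    rw [h9.neg_one_pow, h10.neg_one_pow]
    have hy : (0 : ℝ) < 2 ^ r.1 := by positivity
    have h6r : (6 * s : ℝ) < 2 ^ r.1 := by
      have : 6 * s < 2 ^ r.1 := by push_cast at h6; linarith
      exact_mod_cast this
    have h7r : (-(6 * s) : ℝ) < 2 ^ r.1 := by
      have : -(6 * s) < 2 ^ r.1 := by push_cast at h7'; linarith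
      exact_mod_cast this
    -- Here q and r are odd and r is one level higher. With w = 2π s / 2^j, j the level of r, the
    -- arguments of g for q and r are -2w - π/2 and π/2 + w.
    have hs := hg.stretch (2 * Real.pi * (s / 2 ^ r.1)) (by
      have a1 : (s : ℝ) / 2 ^ r.1 < 1 / 6 := by rw [div_lt_iff₀ hy]; linarith
      have a2 : -(1 / 6) < (s : ℝ) / 2 ^ r.1 := by rw [lt_div_iff₀ hy]; linarith
      constructor <;> nlinarith)
    convert hs using 2
    · rw [h8, pow_succ]
      field_simp
      ring
    · push_cast
      ring
  · rw [Nat.even_iff.mp h10, pow_succ] at h6 h7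
    generalize k - center r = s at *
    rw [h9.neg_one_pow, h10.neg_one_pow]
    have hy : (0 : ℝ) < 2 ^ r.1 := by positivity
    have h6r : (3 * s : ℝ) < 2 ^ r.1 := by
      have : 3 * s < 2 ^ r.1 := by push_cast at h6; linarith
      exact_mod_cast this
    have h7r : (-(3 * s) : ℝ) < 2 ^ r.1 := by
      have : -(3 * s) < 2 ^ r.1 := by push_cast at h7; linarith
      exact_mod_cast this
    -- Here q and r are even and r is one level lower. With w = π s / 2^j the two arguments exchange
    -- their roles.
    have hs := hg.stretch (Real.pi * (s / 2 ^ r.1)) (by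
      have a1 : (s : ℝ) / 2 ^ r.1 < 1 / 3 := by rw [div_lt_iff₀ hy]; linarith
      have a2 : -(1 / 3) < (s : ℝ) / 2 ^ r.1 := by rw [lt_div_iff₀ hy]; linarith
      constructor <;> nlinarith)
    convert hs.symm using 2
    · rw [h8, pow_succ]
      field_simp
      ring
    · push_cast
      ring

theorem gMinus_eq (g : ℝ → ℝ) {r : ℕ × ℕ} (hr : 1 ≤ r.1) (s : ℤ) :
    gMinus g r.1 r.2 s = profile g r (center r + |s|) := by
  rw [gMinus, profile_eq g hr, add_sub_cancel_left]
  push_cast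
  rfl

theorem gPlus_eq (g : ℝ → ℝ) {r : ℕ × ℕ} (hr : 1 ≤ r.1) (s : ℤ) :
    gPlus g r.1 r.2 s = I * (if s < 0 then -1 else 1) * profile g r (center r - |s|) := by
  rw [gPlus, profile_eq g hr]
  congr 3
  push_cast
  ring

variable {L : ℕ} {T : WaveletTree L}

theorem psiTilde_of_straight {q : ℕ × ℕ} {k : ℤ} (hk : 0 ≤ k)
    (h : InLowest T q k ∨ InHighest T q k) : psiTilde T g q.1 q.2 k = amplitude q k := by
  rw [psiTilde, abs_of_nonneg hk, straightened_of_nonneg hk]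
  rcases h with h | h
  · rw [if_pos ⟨head_iff.mpr ⟨h.1, h.2.1⟩, h.2.2⟩]
  · have h1 : T.leaves.getLast? = some (q.1, q.2) ∧
        ((q.2 * 2 ^ (q.1 - 1) + muZero q.1 q.2 : ℕ) : ℤ) < k := by
      refine ⟨getLast_iff.mpr ⟨h.1, h.2.1⟩, ?_⟩
      have := h.2.2
      rw [center, radius] at this
      push_cast at this ⊢
      exact this
    rw [if_pos h1, ite_self]

theorem psiTilde_of_not_straight (hg : IsWaveAtomProfile g) {q : ℕ × ℕ} (hq : q ∈ T.leaves) {k : ℤ}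
    (hk : 0 ≤ k) (h1 : ¬ InLowest T q k) (h2 : ¬ InHighest T q k) :
    psiTilde T g q.1 q.2 k = amplitude q k * profile g q k := by
  rw [psiTilde, abs_of_nonneg hk, if_neg, if_neg]
  · refine psiHat_eq g (mirrorProfile_eq_zero hg hk fun h0 => ?_)
    by_contra hn
    exact h1 ⟨hq, h0, by omega⟩
  · rintro ⟨h3, h4⟩
    refine h2 ⟨hq, (getLast_iff.mp h3).2, ?_⟩
    rw [center, radius]
    push_cast at h4 ⊢
    exact h4
  · rintro ⟨h3, h4⟩
    exact h1 ⟨hq, (head_iff.mp h3).2, h4⟩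

/-- A nonzero value of another leaf would, by the support bounds and `location_of_leaf`, put k into
a window or into another straightened range. All of these are disjoint from the low range of the
leftmost leaf. -/
theorem psiTilde_of_inLowest (hg : IsWaveAtomProfile g) (h : T.WaveAtomAdmissible) {p q : ℕ × ℕ}
    (hp : p ∈ T.leaves) {k : ℤ} (hk : 0 ≤ k) (hq : InLowest T q k) :
    psiTilde T g p.1 p.2 k = if p = q then amplitude p k else 0 := by
  split_ifs with hpq
  · rw [hpq, psiTilde_of_straight hk (Or.inl hq)]
  · have h1 : ¬ InLowest T p k := fun h' => hpq (h'.unique hq)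
    have h2 : ¬ InHighest T p k := fun h' => by
      have := h'.le_of_mem h hq.1
      rw [center_eq_zero hq.2.1] at this
      have := hq.2.2
      omega
    rw [psiTilde_of_not_straight hg hp hk h1 h2]
    by_contra hne
    have hpr : profile g p k ≠ 0 := by
      rintro h0
      rw [h0, ofReal_zero, mul_zero] at hne
      exact hne rfl
    rcases location_of_leaf h hp (lower_of_profile hg (one_le_of_mem hp) hpr) (fun r hr hqr =>
      upper_of_profile hg (one_le_of_mem hp) (one_le_of_mem hr) hqr hpr) with h3 | h3 | h3 | ⟨r, -, h3⟩
    · exact h1 h3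
    · exact h2 h3
    · exact h3.not_inLowest h hq
    · exact h3.not_inLowest h hq

theorem psiTilde_of_inHighest (hg : IsWaveAtomProfile g) (h : T.WaveAtomAdmissible) {p q : ℕ × ℕ}
    (hp : p ∈ T.leaves) {k : ℤ} (hk : 0 ≤ k) (hq : InHighest T q k) :
    psiTilde T g p.1 p.2 k = if p = q then amplitude p k else 0 := by
  split_ifs with hpq
  · rw [hpq, psiTilde_of_straight hk (Or.inr hq)]
  · have h1 : ¬ InHighest T p k := fun h' => hpq (h'.unique hq)
    have h2 : ¬ InLowest T p k := fun h' => by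
      have := hq.le_of_mem h h'.1
      rw [center_eq_zero h'.2.1] at this
      have := h'.2.2
      omega
    rw [psiTilde_of_not_straight hg hp hk h2 h1]
    by_contra hne
    have hpr : profile g p k ≠ 0 := by
      rintro h0
      rw [h0, ofReal_zero, mul_zero] at hne
      exact hne rfl
    rcases location_of_leaf h hp (lower_of_profile hg (one_le_of_mem hp) hpr) (fun r hr hqr =>
      upper_of_profile hg (one_le_of_mem hp) (one_le_of_mem hr) hqr hpr) with h3 | h3 | h3 | ⟨r, -, h3⟩
    · exact h2 h3
    · exact h1 h3
    · exact absurd (hq.le_of_mem h h3.1) (not_lt.mpr h3.bounds.2)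
    · exact absurd (hq.le_of_mem h h3.1) (not_lt.mpr h3.bounds.2)

theorem psiTilde_of_inWindow (hg : IsWaveAtomProfile g) (h : T.WaveAtomAdmissible) {p r : ℕ × ℕ}
    (hp : p ∈ T.leaves) {k : ℤ} (hk : 0 ≤ k) (hr : InWindow T r k) :
    psiTilde T g p.1 p.2 k = amplitude p k * profile g p k := by
  refine psiTilde_of_not_straight hg hp hk (fun h' => hr.not_inLowest h h') fun h' => ?_
  exact absurd (h'.le_of_mem h hr.1) (not_lt.mpr hr.bounds.2)

theorem _root_.WaveletTree.Neighbours.left_unique {p q r : ℕ × ℕ} (hp : p ∈ T.leaves)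
    (hq : q ∈ T.leaves) (hpr : Neighbours p r) (hqr : Neighbours q r) : p = q := by
  have h1 := hpr.ends
  have h2 := hqr.ends
  have h3 : 0 < 2 ^ p.1 := by positivity
  have h4 : 0 < 2 ^ q.1 := by positivity
  have h5 : r.2 * 2 ^ r.1 ≠ 0 := by rw [← h1]; positivity
  refine leaf_ext hp hq (p := r.2 * 2 ^ r.1 - 1) ?_ (by omega) ?_ (by omega)
  · rw [add_one_mul] at h1; omega
  · rw [add_one_mul] at h2; omega

/-- If the profile of p is nonzero at k, then k lies in a straightened range or in the window of p
or of its right neighbour. Windows are disjoint, so p is r or precedes r. -/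
theorem profile_eq_zero_of_inWindow (hg : IsWaveAtomProfile g) (h : T.WaveAtomAdmissible)
    {p q r : ℕ × ℕ} (hp : p ∈ T.leaves) {k : ℤ} (hr : InWindow T r k) (hq : q ∈ T.leaves)
    (hqr : Neighbours q r) (hpr : p ≠ r) (hpq : p ≠ q) : profile g p k = 0 := by
  by_contra hne
  rcases location_of_leaf h hp (lower_of_profile hg (one_le_of_mem hp) hne) (fun r hr hqr =>
    upper_of_profile hg (one_le_of_mem hp) (one_le_of_mem hr) hqr hne) with h3 | h3 | h3 | ⟨r', h4, h3⟩
  · exact hr.not_inLowest h h3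
  · exact absurd (h3.le_of_mem h hr.1) (not_lt.mpr hr.bounds.2)
  · exact hpr (h3.unique h hr)
  · obtain rfl := h3.unique h hr
    exact hpq (h4.left_unique hp hq hqr)

/-- Reflecting a frequency at the left end of a leaf. -/
theorem amplitude_reflect_right {r : ℕ × ℕ} (hr : 1 ≤ r.1) (k : ℤ) :
    amplitude r (2 * center r - k) = conj (-I * amplitude r k) := by
  have h : 2 * (center r : ℂ) = r.2 * 2 ^ r.1 := by exact_mod_cast two_mul_center hr
  have h2 : (2 : ℂ) ^ r.1 ≠ 0 := pow_ne_zero _ two_ne_zero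
  -- As 2 * `center r` = m 2^j, the phase of the left side differs from the conjugate phase at k by
  -- exp(-iπ m + 2i α_m) = i. The factor i in g_+ compensates for it, up to the sign (-1)^[s < 0].
  have hI : -I = exp (-(Real.pi / 2 * I)) := by
    rw [exp_neg, exp_pi_div_two_mul_I, inv_I]
  rw [hI, amplitude, amplitude]
  have : conj (2 : ℂ) = 2 := Complex.conj_ofNat 2
  simp only [map_mul, ← exp_conj, conj_ofReal, map_neg, map_div₀, conj_I, map_pow, map_intCast, this]
  rw [mul_left_comm, mul_assoc, mul_assoc, mul_assoc, ← exp_add, ← exp_add, ← exp_add]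
  congr 1
  refine exp_eq_exp_iff_exists_int.mpr ⟨0, ?_⟩
  rw [alpha]
  push_cast
  field_simp
  linear_combination (-4) * h

/-- Reflecting a frequency at the right end of a leaf. -/
theorem amplitude_reflect_left {q r : ℕ × ℕ} (hr : 1 ≤ r.1) (hqr : Neighbours q r) (k : ℤ) :
    amplitude q (2 * center r - k) = conj (I * amplitude q k) := by
  have h : 2 * (center r : ℂ) = (q.2 + 1) * 2 ^ q.1 := by
    have := two_mul_center hr
    rw [← hqr.ends_int] at this
    exact_mod_cast this
  have h2 : (2 : ℂ) ^ q.1 ≠ 0 := pow_ne_zero _ two_ne_zero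
  have : conj (2 : ℂ) = 2 := Complex.conj_ofNat 2
  -- For the left neighbour (j, m), 2 * `center r` = (m + 1) 2^j, and the same computation gives -i.
  have hI' : conj I = exp (-(Real.pi / 2 * I)) := by
    rw [conj_I, exp_neg, exp_pi_div_two_mul_I, inv_I]
  rw [map_mul, hI', amplitude, amplitude]
  simp only [map_mul, ← exp_conj, conj_ofReal, map_neg, map_div₀, conj_I, map_pow, map_intCast, this]
  rw [mul_left_comm, mul_assoc, mul_assoc, mul_assoc, ← exp_add, ← exp_add, ← exp_add]
  congr 1
  refine exp_eq_exp_iff_exists_int.mpr ⟨0, ?_⟩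
  rw [alpha]
  push_cast
  field_simp
  linear_combination (-4) * h

end Profile

end WaveAtom

/-! ### Entries of the leaf operator -/

namespace Qubit

open Matrix WaveletTree WaveAtom
open scoped ComplexConjugate

section LeafEntries

variable {L : ℕ} (T : WaveletTree L)

theorem conj_exp_I (t : ℝ) (z : ℂ) (h : z = -(2 * Real.pi * t * Complex.I)) :
    conj (Complex.exp z) = cis t := by
  rw [h, ← Complex.exp_conj, cis]
  congr 1
  have h2 : conj (2 : ℂ) = 2 := Complex.conj_ofNat 2
  simp only [map_neg, map_mul, Complex.conj_ofReal, Complex.conj_I, h2]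
  ring

theorem totalPhase_eq (y : Bits (Fin L)) (hL : 1 ≤ L) :
    totalPhase y = cis (-(1 / 8) + (val y % 2 ^ (L - 1) : ℕ) / 2 ^ (L + 1)) := by
  obtain ⟨l, rfl⟩ : ∃ l, L = l + 1 := ⟨L - 1, by omega⟩
  rw [totalPhase, Fin.prod_univ_castSucc, ← val_low, Nat.add_sub_cancel, val_eq,
    Fin.sum_univ_castSucc, add_comm (-(1 / 8) : ℝ), cis_add]
  congr 1
  · simp only [Fin.val_castSucc, Fin.is_lt, if_true, Fin.val_last, lt_irrefl, if_false]
    simp only [Fin.val_zero, zero_mul, add_zero]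
    push_cast
    rw [Finset.sum_div, cis_sum]
    refine Finset.prod_congr rfl fun i _ => ?_
    rw [bitPhase, if_neg]
    · rfl
    · rw [Fin.val_castSucc]; omega
  · rw [bitPhase, if_pos (by rw [Fin.val_last])]

theorem freqDecode_two_mul (k : ℕ) : freqDecode (2 * k) = k := by
  rw [freqDecode, if_pos (even_two_mul k)]
  congr 1
  omega

theorem freqDecode_two_mul_sub {k : ℕ} (hk : 1 ≤ k) : freqDecode (2 * k - 1) = -(k : ℤ) := by
  rw [freqDecode, if_neg]
  · congr 2
    omega
  · rw [Nat.not_even_iff]; omega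

theorem shiftBits_mod (x : Bits (Fin L)) : ((val (shiftBits T x) % 2 ^ (L - 1) : ℕ) : ℤ) =
    2 ^ (L - (leafOf T x).1) * freqDecode (val x) % 2 ^ (L - 1) := by
  push_cast
  rw [val_shiftBits, Int.emod_emod_of_dvd _ (pow_dvd_pow _ (by omega))]

/-- For k = m 2^(j - 1) + u the phase exp(iπ k / 2^j - iα_m) is that of u / 2^(j + 1) - 1/8 in full
turns: m drops out. For negative frequencies the contribution of m cancels too, and reducing the
shifted frequency modulo 2^(L - 1) adds 1/4, which turns -1/8 into the required +1/8. One formula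
thus covers both signs, with the top digit left out. -/
theorem straightened_eq_cis (x : Bits (Fin L)) :
    conj (straightened (leafOf T x).1 (leafOf T x).2 (freqDecode (val x))) =
      ((1 / Real.sqrt 2 : ℝ) : ℂ) ^ (leafOf T x).1 * totalPhase (shiftBits T x) := by
  have h1 := one_le_level T x
  have h2 := level_le T x
  have h3 := shiftBits_mod T x
  rw [totalPhase_eq _ (h1.trans h2)]
  have hdiv := Nat.div_add_mod (val x) (2 ^ (leafOf T x).1)
  have hmod := Nat.mod_lt (val x) (y := 2 ^ (leafOf T x).1) (by positivity)
  rw [val_div_level] at hdiv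
  generalize hj : (leafOf T x).1 = j at *
  generalize (leafOf T x).2 = m at *
  generalize val x % 2 ^ j = lo at *
  generalize val x = p at *
  obtain ⟨i, rfl⟩ : ∃ i, j = i + 1 := ⟨j - 1, by omega⟩
  obtain ⟨d, rfl⟩ : ∃ d, L = i + 1 + d := ⟨L - (i + 1), by omega⟩
  generalize val (shiftBits T x) % 2 ^ (i + 1 + d - 1) = z at *
  have e1 : i + 1 + d - (i + 1) = d := by omega
  have e2 : i + 1 + d - 1 = i + d := by omega
  rw [e1, e2] at h3
  rw [pow_succ] at hdiv hmod
  have hamp : conj (((1 / Real.sqrt (2 ^ (i + 1)) : ℝ) : ℂ)) =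
      ((1 / Real.sqrt 2 : ℝ) : ℂ) ^ (i + 1) := by
    rw [Complex.conj_ofReal, sqrt_two_pow, ← Complex.ofReal_pow, div_pow, one_pow]
  rw [straightened, map_mul, map_mul, hamp, mul_assoc]
  congr 1
  rcases Nat.even_or_odd' p with ⟨k, hk | hk⟩
  · obtain ⟨u, hu⟩ : ∃ u, lo = 2 * u := ⟨lo / 2, by
      have : p = 2 * (2 ^ i * m) + lo := by rw [← hdiv]; ring
      omega⟩
    have hkm : k = 2 ^ i * m + u := by
      have : p = 2 * (2 ^ i * m) + lo := by rw [← hdiv]; ring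
      omega
    have hz : z = 2 ^ d * u := by
      rw [hk, freqDecode_two_mul, hkm] at h3
      have h4 : (2 ^ d * ((2 ^ i * m + u : ℕ) : ℤ)) = 2 ^ d * u + 2 ^ (i + d) * m := by
        push_cast; ring
      rw [h4, Int.add_mul_emod_self_left, Int.emod_eq_of_lt (by positivity)] at h3
      · exact_mod_cast h3
      · rw [pow_add, mul_comm]
        have : (u : ℤ) < 2 ^ i := by
          have : u < 2 ^ i := by omega
          exact_mod_cast this
        exact mul_lt_mul_of_pos_right this (by positivity)
    rw [hk, freqDecode_two_mul, if_neg (by omega), hz,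
      conj_exp_I ((k : ℝ) / 2 ^ (i + 2)) _ (by push_cast; field_simp; ring),
      conj_exp_I (-(m / 4 + 1 / 8)) _ (by rw [alpha]; push_cast; ring), ← cis_add]
    congr 1
    rw [hkm]
    push_cast
    rw [show i + 1 + d + 1 = d + (i + 2) by ring, pow_add 2 d (i + 2)]
    field_simp
    ring
  · obtain ⟨u, hu⟩ : ∃ u, lo = 2 * u + 1 := ⟨lo / 2, by
      have : p = 2 * (2 ^ i * m) + lo := by rw [← hdiv]; ring
      omega⟩
    have hkm : k = 2 ^ i * m + u := by
      have : p = 2 * (2 ^ i * m) + lo := by rw [← hdiv]; ring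
      omega
    have hz : (z : ℤ) = 2 ^ (i + d) - 2 ^ d * (u + 1) := by
      rw [show p = 2 * (k + 1) - 1 by omega, freqDecode_two_mul_sub (by omega), hkm] at h3
      have h4 : (2 ^ d * (-((2 ^ i * m + u + 1 : ℕ) : ℤ))) =
          (2 ^ (i + d) - 2 ^ d * (u + 1)) + 2 ^ (i + d) * (-m - 1) := by
        push_cast; ring
      have h5 : (u : ℤ) + 1 ≤ 2 ^ i := by
        have : u + 1 ≤ 2 ^ i := by omega
        exact_mod_cast this
      have h6 : (0 : ℤ) < 2 ^ d := by positivity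
      rw [h4, Int.add_mul_emod_self_left, Int.emod_eq_of_lt] at h3
      · exact h3
      · rw [pow_add, mul_comm]
        nlinarith
      · have : (0 : ℤ) < 2 ^ d * (u + 1) := by positivity
        linarith
    have hz' : (z : ℝ) = 2 ^ (i + d) - 2 ^ d * (u + 1) := by exact_mod_cast hz
    rw [show p = 2 * (k + 1) - 1 by omega, freqDecode_two_mul_sub (by omega), if_pos (by omega), hz',
      conj_exp_I (-((k : ℝ) + 1) / 2 ^ (i + 2)) _ (by push_cast; field_simp; ring),
      conj_exp_I (m / 4 + 1 / 8) _ (by rw [alpha]; push_cast; ring), ← cis_add]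
    congr 1
    rw [hkm]
    push_cast
    rw [show i + 1 + d + 1 = d + (i + 2) by ring, pow_add 2 d (i + 2), pow_add 2 i d]
    field_simp
    ring

/-- The phase of the shift by `n` at the frequency `k`. -/
noncomputable def shiftPhase (j n : ℕ) (k : ℤ) : ℂ :=
  Complex.exp (-(Complex.I * 2 * Real.pi * n * k / 2 ^ j))

theorem conj_shiftPhase (j n : ℕ) (k : ℤ) : conj (shiftPhase j n k) = cis (n * k / 2 ^ j) :=
  conj_exp_I _ _ (by push_cast; ring)

theorem shiftPhase_neg (j n : ℕ) (k : ℤ) : shiftPhase j n (-k) = conj (shiftPhase j n k) := by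
  rw [conj_shiftPhase, shiftPhase, cis]
  congr 1
  push_cast
  ring

theorem shiftPhase_add (j n : ℕ) (k l : ℤ) : shiftPhase j n (k + l * 2 ^ j) = shiftPhase j n k := by
  apply (starRingEnd ℂ).injective
  rw [conj_shiftPhase, conj_shiftPhase]
  refine cis_eq_of_sub_int (n * l) ?_
  push_cast
  field_simp

/-- The shifted frequency over 2^L is k / 2^j up to an integer, so the Fourier phase is the phase of
the shift by the offset of y. -/
theorem leafOp_eq (y x : Bits (Fin L)) : leafOp T y x =
    if leafOf T x = leafOf T y then
      conj (shiftPhase (leafOf T y).1 (val y - (leafOf T y).2 * 2 ^ (leafOf T y).1)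
        (freqDecode (val x)) *
        straightened (leafOf T y).1 (leafOf T y).2 (freqDecode (val x))) else 0 := by
  rw [leafOp, of_apply]
  by_cases h : leafOf T y = leafOf T x
  · have h1 := one_le_level T x
    have h2 := level_le T x
    rw [if_pos h, if_pos h.symm, map_mul, h, straightened_eq_cis, conj_shiftPhase]
    have h3 : val (lowBits T y) = val y - (leafOf T x).2 * 2 ^ (leafOf T x).1 := by
      have h4 := val_div_level T y
      have h5 := Nat.div_add_mod (val y) (2 ^ (leafOf T y).1)
      rw [h4] at h5
      rw [val_lowBits, ← h, mul_comm (leafOf T y).2]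
      omega
    rw [← h3, mul_right_comm, mul_comm]
    congr 1
    have h6 := val_shiftBits T x
    rw [Int.emod_def] at h6
    generalize 2 ^ (L - (leafOf T x).1) * freqDecode (val x) / 2 ^ L = e at h6
    refine cis_eq_of_sub_int (-(val (lowBits T y) * e)) ?_
    have h7 : ((val (shiftBits T x) : ℤ) : ℝ) =
      ((2 ^ (L - (leafOf T x).1) * freqDecode (val x) - 2 ^ L * e : ℤ) : ℝ) := by rw [h6]
    have h8 : (2 : ℝ) ^ L = 2 ^ (L - (leafOf T x).1) * 2 ^ (leafOf T x).1 := by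
      rw [← pow_add]; congr 1; omega
    push_cast at h7
    rw [h7, h8]
    push_cast
    field_simp
    ring
  · rw [if_neg h, if_neg (fun h' => h h'.symm)]

end LeafEntries

end Qubit

/-! ### Factorization of the coefficient matrix -/

namespace Qubit

open Matrix WaveletTree WaveAtom
open scoped ComplexConjugate

section Factorization

variable {L : ℕ} {T : WaveletTree L} {g : ℝ → ℝ}

theorem exists_bits {p : ℕ} (hp : p < 2 ^ L) : ∃ x : Bits (Fin L), val x = p := by
  refine ⟨bitsOf L p, ?_⟩
  zify
  rw [val_bitsOf, Int.emod_eq_of_lt (by positivity) (by exact_mod_cast hp)]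

/-- The offset of an index in the block of its leaf. -/
def offset (T : WaveletTree L) (y : Bits (Fin L)) : ℕ :=
  val y - (leafOf T y).2 * 2 ^ (leafOf T y).1

theorem leafOp_even {y x : Bits (Fin L)} {k : ℕ} (hx : val x = 2 * k) : leafOp T y x =
    if T.leafAt (2 * k) = leafOf T y then
      conj (shiftPhase (leafOf T y).1 (offset T y) k * amplitude (leafOf T y) k) else 0 := by
  have h : leafOf T x = T.leafAt (2 * k) := by rw [leafOf, hx]
  rw [leafOp_eq, h, hx, freqDecode_two_mul, straightened_of_nonneg (by positivity)]
  rfl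

theorem leafOp_odd {y x : Bits (Fin L)} {k : ℕ} (hk : 1 ≤ k) (hx : val x = 2 * k - 1) :
    leafOp T y x = if T.leafAt (2 * k - 1) = leafOf T y then
      shiftPhase (leafOf T y).1 (offset T y) k * amplitude (leafOf T y) k else 0 := by
  have h : leafOf T x = T.leafAt (2 * k - 1) := by rw [leafOf, hx]
  rw [leafOp_eq, h, hx, freqDecode_two_mul_sub hk, straightened_neg (by exact_mod_cast hk),
    shiftPhase_neg, map_mul, Complex.conj_conj, Complex.conj_conj]
  rfl

theorem onQubits_coeffMatrix (y x : Bits (Fin L)) : onQubits (coeffMatrix T g) y x =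
    conj (shiftPhase (leafOf T y).1 (offset T y) (freqDecode (val x)) *
      psiTilde T g (leafOf T y).1 (leafOf T y).2 (freqDecode (val x))) := rfl

theorem coeffMatrix_even {y x : Bits (Fin L)} {k : ℕ} (hx : val x = 2 * k) :
    onQubits (coeffMatrix T g) y x = conj (shiftPhase (leafOf T y).1 (offset T y) k *
      psiTilde T g (leafOf T y).1 (leafOf T y).2 k) := by
  rw [onQubits_coeffMatrix, hx, freqDecode_two_mul]

theorem coeffMatrix_odd {y x : Bits (Fin L)} {k : ℕ} (hk : 1 ≤ k) (hx : val x = 2 * k - 1) :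
    onQubits (coeffMatrix T g) y x = shiftPhase (leafOf T y).1 (offset T y) k *
      psiTilde T g (leafOf T y).1 (leafOf T y).2 k := by
  rw [onQubits_coeffMatrix, hx, freqDecode_two_mul_sub hk, psiTilde_neg T g (by exact_mod_cast hk),
    shiftPhase_neg, map_mul, Complex.conj_conj, Complex.conj_conj]

/-- Twice the center is a multiple of the period 2^j, so 2 * `center r` - k and -k are
indistinguishable for the shifts; the next lemma is the same for the left neighbour. -/
theorem shiftPhase_reflect_right {r : ℕ × ℕ} (hr : 1 ≤ r.1) (n : ℕ) (k : ℤ) :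
    shiftPhase r.1 n (2 * center r - k) = conj (shiftPhase r.1 n k) := by
  rw [← shiftPhase_neg, two_mul_center hr, ← shiftPhase_add r.1 n (-k) r.2]
  congr 1
  ring

theorem shiftPhase_reflect_left {q r : ℕ × ℕ} (hr : 1 ≤ r.1) (hqr : Neighbours q r) (n : ℕ) (k : ℤ) :
    shiftPhase q.1 n (2 * center r - k) = conj (shiftPhase q.1 n k) := by
  rw [← shiftPhase_neg, two_mul_center hr, ← hqr.ends_int, ← shiftPhase_add q.1 n (-k) (q.2 + 1)]
  congr 1
  ring

theorem ne_of_neighbours {q r : ℕ × ℕ} (h : Neighbours q r) : q ≠ r := by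
  rintro rfl
  have h1 := h.ends
  have : 0 < 2 ^ q.1 := by positivity
  rw [add_one_mul] at h1
  omega

/-- The straightened wave packets at a frequency that is not in a blending window. -/
theorem coeffMatrix_of_notWindow (hg : IsWaveAtomProfile g) (h : T.WaveAtomAdmissible)
    {y x : Bits (Fin L)} (hw : ∀ r, ¬ InWindow T r ((val x + 1) / 2 : ℕ)) :
    onQubits (coeffMatrix T g) y x = leafOp T y x := by
  have hlt := val_lt x
  have hy := leafOf_mem T y
  have hL : L ≠ 0 := by
    have h1 := one_le_level T y
    have h2 := level_le T y
    omega
  have h3 : 2 ^ L = 2 * 2 ^ (L - 1) := by rw [← pow_succ']; congr 1; omega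
  generalize hk : (val x + 1) / 2 = k at hw
  -- Outside all windows k is straightened in the first or the last leaf and vanishes in all others.
  -- Whichever of 2k - 1 and 2k the index is, it lies in the block of that leaf.
  have hpsi : psiTilde T g (leafOf T y).1 (leafOf T y).2 k =
      if leafOf T x = leafOf T y then amplitude (leafOf T y) k else 0 := by
    rcases exists_location h (k := k) (by omega) with ⟨q, hq⟩ | ⟨q, hq⟩ | ⟨r, hr⟩
    · have hx : leafOf T x = q := by
        have h4 := center_add_radius_lt (one_le_of_mem hq.1)
        have h5 := center_eq_zero hq.2.1
        have h6 := hq.2.2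
        exact leafFrom_eq T 0 q hq.1 _ (by simp [hq.2.1]) (by zify at hk ⊢; omega)
      rw [psiTilde_of_inLowest hg h hy (by positivity) hq, hx]
      exact if_congr eq_comm rfl rfl
    · have hx : leafOf T x = q := by
        have h4 := two_mul_center (one_le_of_mem hq.1)
        have h5 := radius_nonneg q
        have h6 := hq.2.2
        exact leafFrom_eq T 0 q hq.1 _ (by zify at hk ⊢; omega) (by rw [hq.2.1]; exact hlt)
      rw [psiTilde_of_inHighest hg h hy (by positivity) hq, hx]
      exact if_congr eq_comm rfl rfl
    · exact absurd hr (hw r)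
  rcases Nat.even_or_odd' (val x) with ⟨c, hc | hc⟩
  · obtain rfl : c = k := by omega
    rw [coeffMatrix_even hc, leafOp_even hc, hpsi, ← hc]
    change _ = if leafOf T x = leafOf T y then _ else _
    split_ifs <;> simp
  · have hc' : val x = 2 * k - 1 := by omega
    rw [coeffMatrix_odd (by omega) hc', leafOp_odd (by omega) hc', hpsi, ← hc']
    change _ = if leafOf T x = leafOf T y then _ else _
    split_ifs <;> simp

/-- Blending of the even columns. -/
theorem blend_even (hg : IsWaveAtomProfile g) (h : T.WaveAtomAdmissible) {r : ℕ × ℕ} {k l : ℕ}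
    (hr : InWindow T r k) (hl : (l : ℤ) = 2 * center r - k) {y x z : Bits (Fin L)}
    (hx : val x = 2 * k) (hz : val z = 2 * l - 1) :
    onQubits (coeffMatrix T g) y x = leafOp T y x * gMinus g r.1 r.2 (k - center r) +
      leafOp T y z * gPlus g r.1 r.2 (k - center r) := by
  have hr1 := one_le_of_mem hr.1
  have hrl : InWindow T r l := hl ▸ hr.reflect
  have hl1 : 1 ≤ l := by have := (hrl.range h).1; omega
  obtain ⟨q, hq, hqr⟩ := exists_prev h hr.1 hr.2.1
  have hne := ne_of_neighbours hqr
  rw [coeffMatrix_even hx, leafOp_even hx, leafOp_odd hl1 hz,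
    psiTilde_of_inWindow hg h (leafOf_mem T y) (by positivity) hr, gMinus_eq g hr1, gPlus_eq g hr1]
  by_cases hyr : leafOf T y = r
  -- For k at or right of the center, index 2k lies in the block of r and g_- supplies the profile.
  -- To the left, r stores the reflected negative frequency instead, and g_+ acts through
  -- `amplitude_reflect_right`.
  · rw [hyr]
    generalize offset T y = n
    rcases le_or_gt (center r) k with hs | hs
    · rw [leafAt_two_mul_of_le hr hs, if_pos rfl, leafAt_two_mul_sub_of_le hrl hq hqr (by omega),
        if_neg hne, zero_mul, add_zero, abs_of_nonneg (by omega), add_sub_cancel, ← mul_assoc,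
        map_mul _ (_ * _), Complex.conj_ofReal]
    · rw [leafAt_two_mul_of_lt hr hq hqr hs, if_neg hne, zero_mul, zero_add,
        leafAt_two_mul_sub_of_lt hrl (by omega), if_pos rfl, if_pos (by omega),
        abs_of_neg (by omega), sub_neg_eq_add, add_sub_cancel, hl, shiftPhase_reflect_right hr1,
        amplitude_reflect_right hr1]
      simp only [map_mul, map_neg, Complex.conj_ofReal, Complex.conj_I]
      linear_combination (conj (shiftPhase r.1 n k) * conj (amplitude r k) * profile g r k) *
        Complex.I_mul_I
  · by_cases hyq : leafOf T y = q
    · rw [hyq]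
      generalize offset T y = n
      -- The weights of q are thus values of the profile of r at the mirrored frequency, the form in
      -- which g_- and g_+ are given.
      rw [profile_of_neighbours hg (one_le_of_mem hq) hr1 hqr hr.2.2]
      rcases le_or_gt (center r) k with hs | hs
      · rw [leafAt_two_mul_of_le hr hs, if_neg hne.symm, leafAt_two_mul_sub_of_le hrl hq hqr (by omega),
          if_pos rfl, zero_mul, zero_add, if_neg (by omega), abs_of_nonneg (by omega),
          hl, shiftPhase_reflect_left hr1 hqr, amplitude_reflect_left hr1 hqr,
          show center r - (k - center r) = 2 * center r - k by ring]
        simp only [map_mul, Complex.conj_ofReal, Complex.conj_I]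
        linear_combination (conj (shiftPhase q.1 n k) * conj (amplitude q k) *
          profile g r (2 * center r - k)) * Complex.I_mul_I
      · rw [leafAt_two_mul_of_lt hr hq hqr hs, if_pos rfl, leafAt_two_mul_sub_of_lt hrl (by omega),
          if_neg hne.symm, zero_mul, add_zero, abs_of_neg (by omega),
          show center r + -(k - center r) = 2 * center r - k by ring, ← mul_assoc,
          map_mul _ (_ * _), Complex.conj_ofReal]
    · rw [profile_eq_zero_of_inWindow hg h (leafOf_mem T y) hr hq hqr hyr hyq, if_neg, if_neg]
      · simp
      · rcases le_or_gt (l : ℤ) (center r) with hs | hs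
        · rw [leafAt_two_mul_sub_of_le hrl hq hqr hs]; exact fun h' => hyq h'.symm
        · rw [leafAt_two_mul_sub_of_lt hrl hs]; exact fun h' => hyr h'.symm
      · rcases le_or_gt (center r) k with hs | hs
        · rw [leafAt_two_mul_of_le hr hs]; exact fun h' => hyr h'.symm
        · rw [leafAt_two_mul_of_lt hr hq hqr hs]; exact fun h' => hyq h'.symm

/-- Blending of the odd columns. -/
theorem blend_odd (hg : IsWaveAtomProfile g) (h : T.WaveAtomAdmissible) {r : ℕ × ℕ} {k l : ℕ}
    (hr : InWindow T r k) (hl : (l : ℤ) = 2 * center r - k) {y x z : Bits (Fin L)}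
    (hx : val x = 2 * k - 1) (hz : val z = 2 * l) :
    onQubits (coeffMatrix T g) y x = leafOp T y x * gMinus g r.1 r.2 (l - center r) +
      leafOp T y z * gPlus g r.1 r.2 (l - center r) := by
  have hr1 := one_le_of_mem hr.1
  have hrl : InWindow T r l := hl ▸ hr.reflect
  have hk1 : 1 ≤ k := by have := (hr.range h).1; omega
  obtain ⟨q, hq, hqr⟩ := exists_prev h hr.1 hr.2.1
  have hne := ne_of_neighbours hqr
  rw [coeffMatrix_odd hk1 hx, leafOp_odd hk1 hx, leafOp_even hz,
    psiTilde_of_inWindow hg h (leafOf_mem T y) (by positivity) hr, gMinus_eq g hr1, gPlus_eq g hr1]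
  by_cases hyr : leafOf T y = r
  · rw [hyr]
    generalize offset T y = n
    rcases le_or_gt (center r) l with hs | hs
    · rw [leafAt_two_mul_of_le hrl hs, if_pos rfl, leafAt_two_mul_sub_of_le hr hq hqr (by omega),
        if_neg hne, zero_mul, zero_add, if_neg (by omega), abs_of_nonneg (by omega),
        show center r - (l - center r) = k by omega, hl, shiftPhase_reflect_right hr1,
        amplitude_reflect_right hr1]
      simp only [map_mul, map_neg, Complex.conj_conj]
      linear_combination (shiftPhase r.1 n k * amplitude r k * profile g r k) * Complex.I_mul_I
    · rw [leafAt_two_mul_of_lt hrl hq hqr hs, if_neg hne, zero_mul, add_zero,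
        leafAt_two_mul_sub_of_lt hr (by omega), if_pos rfl, abs_of_neg (by omega),
        show center r + -(l - center r) = k by omega]
      ring
  · by_cases hyq : leafOf T y = q
    · rw [hyq]
      generalize offset T y = n
      rw [profile_of_neighbours hg (one_le_of_mem hq) hr1 hqr hr.2.2]
      rcases le_or_gt (center r) l with hs | hs
      · rw [leafAt_two_mul_of_le hrl hs, if_neg hne.symm, leafAt_two_mul_sub_of_le hr hq hqr (by omega),
          if_pos rfl, zero_mul, add_zero, abs_of_nonneg (by omega), ← hl, add_sub_cancel]
        ring
      · rw [leafAt_two_mul_of_lt hrl hq hqr hs, if_pos rfl, leafAt_two_mul_sub_of_lt hr (by omega),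
          if_neg hne.symm, zero_mul, zero_add, if_pos (by omega), abs_of_neg (by omega),
          show center r - -(l - center r) = 2 * center r - k by omega, hl,
          shiftPhase_reflect_left hr1 hqr, amplitude_reflect_left hr1 hqr]
        simp only [map_mul, Complex.conj_conj]
        linear_combination (shiftPhase q.1 n k * amplitude q k *
          profile g r (2 * center r - k)) * Complex.I_mul_I
    · rw [profile_eq_zero_of_inWindow hg h (leafOf_mem T y) hr hq hqr hyr hyq, if_neg, if_neg]
      · simp
      · rcases le_or_gt (center r) l with hs | hs
        · rw [leafAt_two_mul_of_le hrl hs]; exact fun h' => hyr h'.symm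
        · rw [leafAt_two_mul_of_lt hrl hq hqr hs]; exact fun h' => hyq h'.symm
      · rcases le_or_gt (k : ℤ) (center r) with hs | hs
        · rw [leafAt_two_mul_sub_of_le hr hq hqr hs]; exact fun h' => hyq h'.symm
        · rw [leafAt_two_mul_sub_of_lt hr hs]; exact fun h' => hyr h'.symm

theorem coeffMatrix_factorization (hg : IsWaveAtomProfile g) (h : T.WaveAtomAdmissible) :
    onQubits (coeffMatrix T g) = leafOp T * (pm (reflectBits T) *
      (onQubits (blendingMatrix T g) * pm (reflectBits T))) := by
  ext y x
  rw [reflected_blending h]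
  by_cases hw : ∃ r, InWindow T r ((val x + 1) / 2 : ℕ)
  · obtain ⟨r, hr⟩ := hw
    generalize hk : (val x + 1) / 2 = k at hr
    have hrl := hr.reflect
    have h1 := hr.range h
    have h2 := hrl.range h
    obtain ⟨l, hl⟩ : ∃ l : ℕ, (l : ℤ) = 2 * center r - k :=
      ⟨(2 * center r - k).toNat, Int.toNat_of_nonneg (by omega)⟩
    rw [← hl] at hrl h2
    -- An even index 2k is fixed by R, and its block partner 2k - 1 stands for the column 2l - 1,
    -- where l = 2 * `center r` - k. An odd index 2k - 1 is first moved to 2l - 1, whose block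
    -- partner 2l is fixed. In both cases the column is blended with its alias modulo the periods of
    -- both leaves.
    rcases Nat.even_or_odd' (val x) with ⟨c, hc | hc⟩
    · obtain rfl : c = k := by omega
      obtain ⟨z, hz⟩ := exists_bits (L := L) (p := 2 * c - 1) (by zify; omega)
      have hzx : z ≠ x := by
        rintro rfl
        omega
      rw [reflectBits_of_even hc, sum_blending_of_window h g _ (by omega) hzx (r := r) (by rwa [hk]),
        reflectBits_of_even hc, hk]
      have hz' := val_reflectBits h hz hr
      exact blend_even hg h hr hl hc (by omega)
    · have hx : val x = 2 * k - 1 := by omega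
      have hx' := val_reflectBits h hx hr
      rw [← hl] at hx'
      have hk' : (val (reflectBits T x) + 1) / 2 = l := by omega
      obtain ⟨z, hz⟩ := exists_bits (L := L) (p := 2 * l) (by zify; omega)
      have hzx : z ≠ reflectBits T x := by
        rintro rfl
        omega
      rw [sum_blending_of_window h g _ (by omega) hzx (r := r) (by rwa [hk']),
        reflectBits_reflectBits h, reflectBits_of_even hz, hk']
      exact blend_odd hg h hr hl hx hz
  · push Not at hw
    rw [reflectBits_of_notWindow h rfl hw, sum_blending_of_notWindow h g _ hw,
      reflectBits_of_notWindow h rfl hw, coeffMatrix_of_notWindow hg h hw]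

end Factorization

end Qubit

theorem theorem3 (A B : ℕ) :
    ∃ C : ℕ, ∀ (L : ℕ) (T : WaveletTree L) (g : ℝ → ℝ),
      T.WaveAtomAdmissible → IsWaveAtomProfile g →
      ImplementableWith (onQubits (WaveAtom.blendingMatrix T g)) (A * L ^ 2) →
      ImplementableWith T.helperOperator (B * L ^ 2) →
      ImplementableWith (onQubits (WaveAtom.transform T g)) (C * L ^ 2) := by
  refine ⟨A + 100000 * B + 10000000, fun L T g hT hg hA hB => ?_⟩
  -- Since L ≥ 1, all linear and constant terms are at most multiples of L^2; the largest, 400000 (L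
  -- + 3)^2 from the two reflections, is at most 6400000 L^2.
  have hL : 1 ≤ L := by
    have h := T.leafAt_spec 0 (by positivity)
    have := WaveletTree.level_bounds T 0 _ h.1
    omega
  have hR := Qubit.impl_reflectBits hT hB
  have hG := Qubit.impl_of_implementableWith hA
  have h := ((Qubit.impl_leafOp T hB).mul (hR.mul (hG.mul hR))).mul (Qubit.impl_fourierDecoded L)
  rw [← Qubit.coeffMatrix_factorization hg hT] at h
  have he : onQubits (WaveAtom.transform T g) =
      onQubits (WaveAtom.coeffMatrix T g) * onQubits (WaveAtom.fourierDecoded L) := by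
    rw [onQubits, onQubits, onQubits, Matrix.submatrix_mul_equiv]
    rfl
  rw [he]
  refine (h.mono ?_).implementableWith
  nlinarith
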